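/- **Setting.** Let $\nu$ be a $\sigma$-finite measure on a measurable space $\mathcal X$, let $p_+,p_-$ be probability laws on $\mathcal X$ with densities with respect to $\nu$ (the class-conditional laws), and let $\pi_+,\pi_->0$, $\pi_++\pi_-=1$, be the class priors. Let $M\ge 1$, and let $$p_{MDP}(x^1,\dots,x^M)=\frac{\sum_{k=0}^{\lfloor M/2\rfloor}\pi_+^{M-k}\pi_-^{k}\sum_{|S|=k}\prod_{i\in S}p_-(x^i)\prod_{i\notin S}p_+(x^i)}{\sum_{k=0}^{\lfloor M/2\rfloor}\binom Mk\pi_+^{M-k}\pi_-^k},\qquad p_U=\pi_+p_++\pi_-p_-,$$ where $S$ ranges over subsets of $\{1,\dots,M\}$, and $$a=\frac{\sum_{k=0}^{\lfloor M/2\rfloor}\binom{M-1}{k}\pi_+^{M-k}\pi_-^k}{\sum_{k=0}^{\lfloor M/2\rfloor}\binom Mk\pi_+^{M-k}\pi_-^k},\qquad b=\frac{\sum_{k=1}^{\lfloor M/2\rfloor}\binom{M-1}{k-1}\pi_+^{M-k}\pi_-^k}{\sum_{k=0}^{\lfloor M/2\rfloor}\binom Mk\pi_+^{M-k}\pi_-^k}.$$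 The data are $n_{MDP}\ge1$ independent tuples $(x_i^1,\dots,x_i^M)\sim p_{MDP}$ and, independently of them, $n_U\ge1$ independent points $x_{U,j}\sim p_U$. For a loss $\ell:\mathbb R\times\{+1,-1\}\to[0,\infty)$ put $$R(g)=\pi_+\,\mathbb E_{x\sim p_+}[\ell(g(x),+1)]+\pi_-\,\mathbb E_{x\sim p_-}[\ell(g(x),-1)],$$ $$\hat R(g)=\frac{\pi_+\pi_-}{Mn_{MDP}}\sum_{i=1}^{n_{MDP}}\sum_{j=1}^M\frac{\ell(g(x_i^j),+1)-\ell(g(x_i^j),-1)}{a\pi_--b\pi_+}+\frac1{n_U}\sum_{j=1}^{n_U}\frac{-b\pi_+\,\ell(g(x_{U,j}),+1)+a\pi_-\,\ell(g(x_{U,j}),-1)}{a\pi_--b\pi_+}.$$ **Assumptions.** $\mathcal G$ is a class of measurable functions $g:\mathcal X\to\mathbb R$ for which the suprema over $\mathcal G$ of finite sums $\sum_i\varphi_i(g(x_i))$, $\varphi_i$ continuous, are measurable functions of the sample points $(x_i)_i$. There is $C_g>0$ with $|g(x)|\le C_g$ for all $g\in\mathcal G$, $x\in\mathcal X$. There is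 $C_\ell>0$ with $\ell(z,y)\le C_\ell$ for $|z|\le C_g$ and both $y$, and $\ell(\cdot,y)$ is $\rho$-Lipschitz on $[-C_g,C_g]$ for both $y$. There is $C_{\mathcal G}\ge0$ such that for every probability law $\mu$ on $\mathcal X$ with a density with respect to $\nu$ and every $n\ge1$, $$\mathfrak R_n(\mathcal G;\mu)=\mathbb E_{Z_1,\dots,Z_n\sim\mu\ \text{i.i.d.}}\ \mathbb E_\sigma\Big[\sup_{g\in\mathcal G}\frac1n\sum_{i=1}^n\sigma_ig(Z_i)\Big]\le\frac{C_{\mathcal G}}{\sqrt n},$$ with $\sigma$ uniform on $\{-1,+1\}^n$. Let $g^*\in\mathcal G$ minimize $R$ over $\mathcal G$. **Theorem 2.** For all $n_{MDP},n_U\ge1$ and every $\delta>0$, with probability at least $1-\delta$, every minimizer $\hat g$ of $\hat R$ over $\mathcal G$ satisfies $$R(\hat g)-R(g^*)\le 2\pi_+\pi_-\frac{4\sqrt2\,\rho C_{\mathcal G}+2C_\ell\sqrt{\log\frac4\delta}}{|a\pi_--b\pi_+|\sqrt{2Mn_{MDP}}}+\frac{2(|-b\pi_+|+|a\pi_-|)\sqrt8\,\rho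 C_{\mathcal G}}{|a\pi_--b\pi_+|\sqrt{2n_U}}+\frac{2(|-b\pi_+|+|a\pi_-|)\,C_\ell\sqrt{\log\frac4\delta}}{|a\pi_--b\pi_+|\sqrt{2n_U}}$$ (for $\delta\ge1$ the claim is void). Consequently $R(\hat g)-R(g^*)=\mathcal O_p\big(1/\sqrt{n_{MDP}}+1/\sqrt{n_U}\big)$: for every $\varepsilon>0$ there is a $K$ such that for all $n_{MDP},n_U\ge1$, with probability at least $1-\varepsilon$, every minimizer $\hat g$ of $\hat R$ over $\mathcal G$ satisfies $|R(\hat g)-R(g^*)|\le K(1/\sqrt{n_{MDP}}+1/\sqrt{n_U})$. -/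

import Mathlib

open MeasureTheory

noncomputable section

namespace MDPU

/-- The probability that an `M`-tuple with i.i.d. labels has at most `⌊M/2⌋` negative entries:
`∑_{k ≤ ⌊M/2⌋} (M choose k) π₊^(M-k) π₋^k`. -/
def normConst (M : ℕ) (πp πm : ℝ) : ℝ :=
  ∑ k ∈ Finset.range (M / 2 + 1), (M.choose k : ℝ) * πp ^ (M - k) * πm ^ k

/-- The weight `a` of the positive class in the one-point marginals of the tuple law. -/
def coefA (M : ℕ) (πp πm : ℝ) : ℝ :=
  (∑ k ∈ Finset.range (M / 2 + 1), ((M - 1).choose k : ℝ) * πp ^ (M - k) * πm ^ k) /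
    normConst M πp πm

/-- The weight `b` of the negative class in the one-point marginals of the tuple law. -/
def coefB (M : ℕ) (πp πm : ℝ) : ℝ :=
  (∑ k ∈ Finset.Icc 1 (M / 2), ((M - 1).choose (k - 1) : ℝ) * πp ^ (M - k) * πm ^ k) /
    normConst M πp πm

section Laws

variable {X : Type*} [MeasurableSpace X]

/-- The law of an `M`-tuple in which positive points dominate: the normalized sum, over the sets
`S` of at most `⌊M/2⌋` negative positions, of `π₊^(M-|S|) π₋^|S|` times the product law having
marginal `p₋` at the positions in `S` and `p₊` at the others. -/
def tupleLaw (M : ℕ) (πp πm : ℝ) (pP pN : Measure X) : Measure (Fin M → X) :=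
  ∑ k ∈ Finset.range (M / 2 + 1), ∑ S ∈ Finset.powersetCard k (Finset.univ : Finset (Fin M)),
    ENNReal.ofReal (πp ^ (M - k) * πm ^ k / normConst M πp πm) •
      Measure.pi (fun i : Fin M => if i ∈ S then pN else pP)

/-- The law `p_U = π₊ p₊ + π₋ p₋` of an unlabeled point. -/
def unlabeledLaw (πp πm : ℝ) (pP pN : Measure X) : Measure X :=
  ENNReal.ofReal πp • pP + ENNReal.ofReal πm • pN

/-- The law of the whole data set: `n` independent dominant positive `M`-tuples and, independently
of them, `m` independent unlabeled points. -/
def sampleLaw (M n m : ℕ) (πp πm : ℝ) (pP pN : Measure X) :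
    Measure ((Fin n → Fin M → X) × (Fin m → X)) :=
  (Measure.pi (fun _ : Fin n => tupleLaw M πp πm pP pN)).prod
    (Measure.pi (fun _ : Fin m => unlabeledLaw πp πm pP pN))

/-- The classification risk `R(g) = π₊ E₊[ℓ(g(x), +1)] + π₋ E₋[ℓ(g(x), -1)]`; the labels `+1`, `-1`
are the two elements of `ℤˣ`. -/
def risk (ℓ : ℝ → ℤˣ → ℝ) (πp πm : ℝ) (pP pN : Measure X) (g : X → ℝ) : ℝ :=
  πp * ∫ x, ℓ (g x) 1 ∂pP + πm * ∫ x, ℓ (g x) (-1) ∂pN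

end Laws

/-- The loss `L_MDP` of a predicted value `z` at a point of a tuple. -/
def lossMDP (ℓ : ℝ → ℤˣ → ℝ) (M : ℕ) (πp πm : ℝ) (z : ℝ) : ℝ :=
  (ℓ z 1 - ℓ z (-1)) / (coefA M πp πm * πm - coefB M πp πm * πp)

/-- The loss `L_U` of a predicted value `z` at an unlabeled point. -/
def lossU (ℓ : ℝ → ℤˣ → ℝ) (M : ℕ) (πp πm : ℝ) (z : ℝ) : ℝ :=
  (-(coefB M πp πm * πp) * ℓ z 1 + coefA M πp πm * πm * ℓ z (-1)) /
    (coefA M πp πm * πm - coefB M πp πm * πp)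

/-- The empirical risk of `g` on the data `d`: the `n` tuples `d.1 i = (d.1 i 1, …, d.1 i M)`
and the `m` unlabeled points `d.2 j`. -/
def empRisk {X : Type*} (ℓ : ℝ → ℤˣ → ℝ) (M n m : ℕ) (πp πm : ℝ)
    (d : (Fin n → Fin M → X) × (Fin m → X)) (g : X → ℝ) : ℝ :=
  πp * πm / ((M : ℝ) * (n : ℝ)) * ∑ i : Fin n, ∑ j : Fin M, lossMDP ℓ M πp πm (g (d.1 i j)) +
    1 / (m : ℝ) * ∑ j : Fin m, lossU ℓ M πp πm (g (d.2 j))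

/-- The Rademacher complexity of the class `G` for samples of size `n` drawn from `μ`. -/
def rademacher {X : Type*} [MeasurableSpace X] (G : Set (X → ℝ)) (μ : Measure X) (n : ℕ) : ℝ :=
  ∫ z : Fin n → X,
    (1 / 2 ^ n : ℝ) * ∑ σ : Fin n → ℤˣ,
      ⨆ g : G, 1 / (n : ℝ) * ∑ i : Fin n, (((σ i : ℤˣ) : ℤ) : ℝ) * g.1 (z i)
    ∂(Measure.pi (fun _ : Fin n => μ))

/-- The suprema over the class `G` that occur in expectations are measurable functions of the
sample. This holds for instance if `G` has a countable subset that is dense in it for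
pointwise convergence. -/
def MeasurableSuprema {X : Type*} [MeasurableSpace X] (G : Set (X → ℝ)) : Prop :=
  ∀ (n : ℕ) (φ : Fin n → ℝ → ℝ), (∀ i, Continuous (φ i)) →
    Measurable (fun z : Fin n → X => ⨆ g : G, ∑ i : Fin n, φ i (g.1 (z i)))

end MDPU

end

/-! By `risk_eq` the risk is the mean of the empirical risk. As a minimizer has empirical risk at
most that of g*, its excess risk is at most the increment of R − R̂ from g* to it. So one needs
one-sided deviation bounds, uniform over the class, for increments relative to g*: one for the
tuples (`LipClass.exists_deviation_le`) and one for the unlabeled points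
(`LipClass.exists_deviation_le_pi`, the case of tuples of length one). The difficulty is that the M
points of a tuple are dependent, yet the rate is that of Mn independent points; a bounded difference
inequality with whole tuples as units would lose a factor √M.

Concentration. Given the set S of negative positions a tuple has independent points, and the mean of
an order-invariant function depends on S only through |S|, a binomial variable conditioned to be at
most ⌊M/2⌋. The entropy of such a function under the tuple law is therefore an average of entropies
under product laws, which are subadditive (`ent_pi_le`), plus the entropy of a function of |S|. The
latter is bounded by M times an average of two-point entropies (`truncated_binomial_ent_le`). These
are exactly the between-class terms by which the entropy of one coordinate under π₊p₊ + π₋p₋ exceeds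
its average within the classes (`ent_unlabeledLaw`). Hence, in `ent_tupleLaw_le`, a coordinate costs
no more than one coordinate with a single law: the mixture if its label is free given the others, p₊
if the others already contain ⌊M/2⌋ negatives. Hoeffding's lemma in entropy form and Herbst's
argument then give the bounded difference inequality `measureReal_pi_tupleLaw_ge_le` with variance
factor Mn.

Mean. The expectation a E₊ + b E₋ is represented by ghost samples of both classes, weighted by a and
b. Given the labels, the sample of T = Mn points is compared class by class with the ghosts, by
symmetrization and contraction, at cost of order √T. What remains is a difference between negative
and positive ghosts times b − |S|/T, where S now collects the negative positions of all tuples. This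
factor is centred with mean absolute value at most 1/(2√T), because truncation does not increase the
binomial variance bound M/4. A crude bound of order T for the difference of ghosts therefore
suffices (`LipClass.integral_ghostMean_le`).

Finally a π₋ − b π₊ > 0 (`coef_sub_pos`), so the division in the losses is legitimate and the
absolute values in the bound disappear. -/

namespace MDPU

/-! ### Bounded measurable functions: integrability bookkeeping -/

section BoundedFunctions

variable {Ω Ω' : Type*} [MeasurableSpace Ω] [MeasurableSpace Ω']

/-- Bounded measurable real functions. -/
def BddMeas (f : Ω → ℝ) : Prop := Measurable f ∧ ∃ C, ∀ x, |f x| ≤ C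

/-- Measurable real functions with values in a compact subset of `(0, ∞)`. -/
def PosBdd (f : Ω → ℝ) : Prop := Measurable f ∧ ∃ a b, 0 < a ∧ ∀ x, a ≤ f x ∧ f x ≤ b

lemma BddMeas.integrable {f : Ω → ℝ} (hf : BddMeas f) (μ : Measure Ω) [IsFiniteMeasure μ] :
    Integrable f μ := by
  obtain ⟨hm, C, hC⟩ := hf
  exact Integrable.of_bound hm.aestronglyMeasurable C (Filter.Eventually.of_forall hC)

lemma BddMeas.mul {f g : Ω → ℝ} (hf : BddMeas f) (hg : BddMeas g) :
    BddMeas (fun x => f x * g x) := by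
  obtain ⟨hm, C, hC⟩ := hf
  obtain ⟨hm', C', hC'⟩ := hg
  refine ⟨hm.mul hm', C * C', fun x => ?_⟩
  rw [abs_mul]
  exact mul_le_mul (hC x) (hC' x) (abs_nonneg _) ((abs_nonneg _).trans (hC x))

lemma BddMeas.add {f g : Ω → ℝ} (hf : BddMeas f) (hg : BddMeas g) :
    BddMeas (fun x => f x + g x) := by
  obtain ⟨hm, C, hC⟩ := hf
  obtain ⟨hm', C', hC'⟩ := hg
  exact ⟨hm.add hm', C + C', fun x => (abs_add_le _ _).trans (add_le_add (hC x) (hC' x))⟩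

lemma BddMeas.sub {f g : Ω → ℝ} (hf : BddMeas f) (hg : BddMeas g) :
    BddMeas (fun x => f x - g x) := by
  obtain ⟨hm, C, hC⟩ := hf
  obtain ⟨hm', C', hC'⟩ := hg
  exact ⟨hm.sub hm', C + C', fun x => (abs_sub _ _).trans (add_le_add (hC x) (hC' x))⟩

lemma bddMeas_const (c : ℝ) : BddMeas (fun _ : Ω => c) :=
  ⟨measurable_const, |c|, fun _ => le_rfl⟩

lemma BddMeas.sum {ι : Type*} (s : Finset ι) {f : ι → Ω → ℝ} (hf : ∀ i ∈ s, BddMeas (f i)) :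
    BddMeas (fun x => ∑ i ∈ s, f i x) := by
  classical
  induction s using Finset.induction_on with
  | empty => simpa using bddMeas_const 0
  | insert i s hi ih =>
    simp only [Finset.sum_insert hi]
    exact (hf i (by simp)).add (ih fun j hj => hf j (by simp [hj]))

lemma BddMeas.comp {f : Ω → ℝ} (hf : BddMeas f) {g : Ω' → Ω} (hg : Measurable g) :
    BddMeas (fun x => f (g x)) :=
  ⟨hf.1.comp hg, hf.2.imp fun _ h _ => h _⟩

lemma BddMeas.integral_right {f : Ω × Ω' → ℝ} (hf : BddMeas f) (ν : Measure Ω')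
    [IsProbabilityMeasure ν] : BddMeas (fun x => ∫ y, f (x, y) ∂ν) := by
  obtain ⟨hm, C, hC⟩ := hf
  refine ⟨hm.stronglyMeasurable.integral_prod_right'.measurable, C, fun x => ?_⟩
  have := norm_integral_le_of_norm_le_const (μ := ν) (f := fun y => f (x, y)) (C := C)
    (Filter.Eventually.of_forall fun y => hC _)
  simpa using this

lemma PosBdd.bddMeas {f : Ω → ℝ} (hf : PosBdd f) : BddMeas f := by
  obtain ⟨hm, a, b, ha, h⟩ := hf
  exact ⟨hm, b, fun x => abs_le.2 ⟨by linarith [h x], (h x).2⟩⟩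

lemma PosBdd.pos {f : Ω → ℝ} (hf : PosBdd f) (x : Ω) : 0 < f x := by
  obtain ⟨-, a, b, ha, h⟩ := hf
  exact ha.trans_le (h x).1

lemma PosBdd.log {f : Ω → ℝ} (hf : PosBdd f) : BddMeas (fun x => Real.log (f x)) := by
  obtain ⟨hm, a, b, ha, h⟩ := hf
  refine ⟨hm.log, |Real.log a| + |Real.log b|, fun x => abs_le.2 ⟨?_, ?_⟩⟩
  · have := Real.log_le_log ha (h x).1
    linarith [neg_abs_le (Real.log a), abs_nonneg (Real.log b)]
  · have := Real.log_le_log (ha.trans_le (h x).1) (h x).2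
    linarith [le_abs_self (Real.log b), abs_nonneg (Real.log a)]

lemma PosBdd.comp {f : Ω → ℝ} (hf : PosBdd f) {g : Ω' → Ω} (hg : Measurable g) :
    PosBdd (fun x => f (g x)) := by
  obtain ⟨hm, a, b, ha, h⟩ := hf
  exact ⟨hm.comp hg, a, b, ha, fun x => h _⟩

lemma PosBdd.integral_mem {f : Ω → ℝ} {a b : ℝ} (hm : Measurable f) (ha : 0 < a)
    (h : ∀ x, a ≤ f x ∧ f x ≤ b) (μ : Measure Ω) [IsProbabilityMeasure μ] :
    a ≤ ∫ x, f x ∂μ ∧ ∫ x, f x ∂μ ≤ b := by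
  have hi := (PosBdd.bddMeas ⟨hm, a, b, ha, h⟩).integrable μ
  constructor
  · simpa using integral_mono (integrable_const a) hi fun x => (h x).1
  · simpa using integral_mono hi (integrable_const b) fun x => (h x).2

lemma PosBdd.integral_pos {f : Ω → ℝ} (hf : PosBdd f) (μ : Measure Ω) [IsProbabilityMeasure μ] :
    0 < ∫ x, f x ∂μ := by
  obtain ⟨hm, a, b, ha, h⟩ := hf
  exact ha.trans_le (PosBdd.integral_mem hm ha h μ).1

lemma PosBdd.integral_right {f : Ω × Ω' → ℝ} (hf : PosBdd f) (ν : Measure Ω')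
    [IsProbabilityMeasure ν] : PosBdd (fun x => ∫ y, f (x, y) ∂ν) := by
  obtain ⟨hm, a, b, ha, h⟩ := hf
  exact ⟨hm.stronglyMeasurable.integral_prod_right'.measurable, a, b, ha, fun x =>
    PosBdd.integral_mem (hm.comp measurable_prodMk_left) ha (fun y => h _) ν⟩

lemma BddMeas.posBdd_exp {f : Ω → ℝ} (hf : BddMeas f) : PosBdd (fun x => Real.exp (f x)) := by
  obtain ⟨hm, C, hC⟩ := hf
  exact ⟨hm.exp, Real.exp (-C), Real.exp C, Real.exp_pos _, fun x =>
    ⟨Real.exp_le_exp.2 (abs_le.1 (hC x)).1, Real.exp_le_exp.2 (abs_le.1 (hC x)).2⟩⟩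

end BoundedFunctions

/-! ### Entropy, its duality and its subadditivity over product measures -/

section Entropy

/-- The graph of x log x lies above its tangent at s. All entropy comparisons below, integral or
discrete, are averages of this inequality. -/
lemma sub_le_mul_log_sub_log {t s : ℝ} (ht : 0 < t) (hs : 0 < s) :
    t - s ≤ t * (Real.log t - Real.log s) := by
  have h := Real.add_one_le_exp (Real.log s - Real.log t)
  rw [Real.exp_sub, Real.exp_log hs, Real.exp_log ht, le_div_iff₀ ht] at h
  nlinarith

variable {Ω Ω' : Type*} [MeasurableSpace Ω] [MeasurableSpace Ω']

/-- The entropy functional `∫ f log f - (∫ f) log (∫ f)`. -/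
noncomputable def ent (μ : Measure Ω) (f : Ω → ℝ) : ℝ :=
  ∫ x, f x * Real.log (f x) ∂μ - (∫ x, f x ∂μ) * Real.log (∫ x, f x ∂μ)

/-- Duality: the entropy is the supremum of these functionals, which are linear in f, and g = f
attains it. The tangent inequality is used at g rescaled to have the mean of f. -/
lemma integral_mul_log_sub_le_ent (μ : Measure Ω) [IsProbabilityMeasure μ] {f g : Ω → ℝ}
    (hf : PosBdd f) (hg : PosBdd g) :
    ∫ x, f x * Real.log (g x) ∂μ - (∫ x, f x ∂μ) * Real.log (∫ x, g x ∂μ) ≤ ent μ f := by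
  set m := ∫ x, f x ∂μ with hm
  set γ := ∫ x, g x ∂μ with hγ
  have hm0 : 0 < m := hf.integral_pos μ
  have hγ0 : 0 < γ := hg.integral_pos μ
  have hpt : ∀ x, f x - m / γ * g x ≤
      f x * Real.log (f x) - f x * Real.log (g x) - (Real.log m - Real.log γ) * f x := by
    intro x
    have h := sub_le_mul_log_sub_log (hf.pos x) (mul_pos (div_pos hm0 hγ0) (hg.pos x))
    rw [Real.log_mul (div_pos hm0 hγ0).ne' (hg.pos x).ne', Real.log_div hm0.ne' hγ0.ne'] at h
    linarith
  have i1 := hf.bddMeas.integrable μ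
  have i2 := (hg.bddMeas.integrable μ).const_mul (m / γ)
  have i3 := (hf.bddMeas.mul hf.log).integrable μ
  have i4 := (hf.bddMeas.mul hg.log).integrable μ
  have i5 := i1.const_mul (Real.log m - Real.log γ)
  have i34 : Integrable (fun x => f x * Real.log (f x) - f x * Real.log (g x)) μ := i3.sub i4
  have h := integral_mono (i1.sub i2) (i34.sub i5) hpt
  simp only [Pi.sub_apply] at h
  rw [integral_sub i1 i2, integral_sub i34 i5, integral_sub i3 i4, integral_const_mul,
    integral_const_mul, ← hm, ← hγ, div_mul_cancel₀ _ hγ0.ne'] at h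
  unfold ent
  rw [← hm]
  linarith

lemma BddMeas.ent_right {f : Ω × Ω' → ℝ} (hf : PosBdd f) (ν : Measure Ω')
    [IsProbabilityMeasure ν] : BddMeas (fun x => ent ν fun y => f (x, y)) := by
  unfold ent
  exact ((hf.bddMeas.mul hf.log).integral_right ν).sub
    ((hf.integral_right ν).bddMeas.mul (hf.integral_right ν).log)

/-- The entropy equals the mean entropy in the second variable plus the entropy of the partial mean
G. Duality with the same test function G on every slice, integrated over the slices, bounds the
latter. -/
lemma ent_prod_le (μ : Measure Ω) (ν : Measure Ω') [IsProbabilityMeasure μ]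
    [IsProbabilityMeasure ν] {f : Ω × Ω' → ℝ} (hf : PosBdd f) :
    ent (μ.prod ν) f ≤
      ∫ x, ent ν (fun y => f (x, y)) ∂μ + ∫ y, ent μ (fun x => f (x, y)) ∂ν := by
  have hsw : PosBdd (fun z : Ω' × Ω => f (z.2, z.1)) := hf.comp measurable_swap
  set G : Ω → ℝ := fun x => ∫ y, f (x, y) ∂ν with hG
  have hGp : PosBdd G := hf.integral_right ν
  have hfl := hf.bddMeas.mul hf.log
  have e1 : ∫ x, ent ν (fun y => f (x, y)) ∂μ =
      ∫ z, f z * Real.log (f z) ∂(μ.prod ν) - ∫ x, G x * Real.log (G x) ∂μ := by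
    unfold ent
    rw [integral_sub ((hfl.integral_right ν).integrable μ)
      ((hGp.bddMeas.mul hGp.log).integrable μ), integral_prod _ (hfl.integrable _)]
  have hm : ∫ z, f z ∂(μ.prod ν) = ∫ x, G x ∂μ := integral_prod _ (hf.bddMeas.integrable _)
  have hfG : BddMeas (fun z : Ω × Ω' => f z * Real.log (G z.1)) :=
    hf.bddMeas.mul (hGp.log.comp measurable_fst)
  have hfG' : BddMeas (fun z : Ω' × Ω => f (z.2, z.1) * Real.log (G z.2)) :=
    hfG.comp measurable_swap
  have e2 : ∫ x, G x * Real.log (G x) ∂μ =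
      ∫ y, ∫ x, f (x, y) * Real.log (G x) ∂μ ∂ν := by
    rw [← integral_prod_symm _ (hfG.integrable _), integral_prod _ (hfG.integrable _)]
    refine integral_congr_ae (Filter.Eventually.of_forall fun x => ?_)
    simp only [hG]
    rw [integral_mul_const]
  have e3 : ∫ x, G x ∂μ = ∫ y, ∫ x, f (x, y) ∂μ ∂ν := by
    rw [← hm, integral_prod_symm _ (hf.bddMeas.integrable _)]
  have key : ∫ y, (∫ x, f (x, y) * Real.log (G x) ∂μ -
      (∫ x, f (x, y) ∂μ) * Real.log (∫ x, G x ∂μ)) ∂ν ≤ ∫ y, ent μ (fun x => f (x, y)) ∂ν := by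
    refine integral_mono ?_ ?_ fun y => ?_
    · exact ((hfG'.integral_right μ).integrable ν).sub
        (((hsw.integral_right μ).bddMeas.integrable ν).mul_const _)
    · exact (BddMeas.ent_right hsw μ).integrable ν
    · exact integral_mul_log_sub_le_ent μ (hsw.comp measurable_prodMk_left) hGp
  rw [integral_sub ((hfG'.integral_right μ).integrable ν)
    (((hsw.integral_right μ).bddMeas.integrable ν).mul_const _), integral_mul_const, ← e2,
    ← e3] at key
  rw [e1]
  unfold ent at key ⊢
  rw [hm]
  linarith

lemma measurable_finCons {X : Type*} [MeasurableSpace X] (n : ℕ) :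
    Measurable fun z : X × (Fin n → X) => (Fin.cons z.1 z.2 : Fin (n + 1) → X) := by
  have h := (MeasurableEquiv.piFinSuccAbove (fun _ : Fin (n + 1) => X) 0).symm.measurable
  refine (congrArg Measurable (funext fun z => ?_)).mp h
  exact Fin.insertNth_zero' z.1 z.2

lemma integral_pi_succ {X : Type*} [MeasurableSpace X] {n : ℕ} (μ : Fin (n + 1) → Measure X)
    [∀ i, IsProbabilityMeasure (μ i)] (h : (Fin (n + 1) → X) → ℝ) :
    ∫ x, h x ∂(Measure.pi μ) =
      ∫ z, h (Fin.cons z.1 z.2) ∂((μ 0).prod (Measure.pi fun i => μ i.succ)) := by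
  set e := MeasurableEquiv.piFinSuccAbove (fun _ : Fin (n + 1) => X) 0 with he
  have hcons : ∀ z : X × (Fin n → X), e.symm z = Fin.cons z.1 z.2 := fun z =>
    Fin.insertNth_zero' z.1 z.2
  rw [← ((measurePreserving_piFinSuccAbove (fun i => μ i) 0).symm e).integral_comp' (g := h)]
  simp only [hcons]
  rfl

/-- Subadditivity of the entropy over the coordinates of a product measure. -/
lemma ent_pi_le {X : Type*} [MeasurableSpace X] : ∀ (n : ℕ) (μ : Fin n → Measure X)
    [∀ i, IsProbabilityMeasure (μ i)] (f : (Fin n → X) → ℝ), PosBdd f →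
    ent (Measure.pi μ) f ≤
      ∑ j, ∫ x, ent (μ j) (fun t => f (Function.update x j t)) ∂(Measure.pi μ) := by
  intro n
  induction n with
  | zero =>
    intro μ _ f hf
    have : ∀ x, f x = f default := fun x => congrArg f (Subsingleton.elim _ _)
    simp only [ent, Finset.univ_eq_empty, Finset.sum_empty]
    simp_rw [this]
    simp
  | succ n ih =>
    intro μ _ f hf
    set ν : Fin n → Measure X := fun i => μ i.succ with hν
    have hint := integral_pi_succ μ
    have hcm := measurable_finCons (X := X) n
    set f' : X × (Fin n → X) → ℝ := fun z => f (Fin.cons z.1 z.2) with hf'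
    have hfp : PosBdd f' := hf.comp hcm
    have e0 : ent (Measure.pi μ) f = ent ((μ 0).prod (Measure.pi ν)) f' := by
      unfold ent
      rw [hint, hint]
    rw [e0, Fin.sum_univ_succ]
    refine (ent_prod_le _ _ hfp).trans ?_
    rw [add_comm]
    have hmeas : ∀ j, BddMeas fun x => ent (μ j) (fun t => f (Function.update x j t)) := by
      intro j
      refine BddMeas.ent_right (f := fun z : (Fin (n + 1) → X) × X =>
        f (Function.update z.1 j z.2)) (hf.comp ?_) (μ j)
      exact measurable_update' (a := j)
    refine add_le_add (le_of_eq ?_) ?_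
    · rw [hint]
      simp only [Fin.update_cons_zero]
      rw [integral_fun_snd (fun y => ent (μ 0) fun t => f (Fin.cons t y))]
      simp [hf', hν]
    · have h1 : ∀ x, ent (Measure.pi ν) (fun y => f' (x, y)) ≤
          ∑ j : Fin n, ∫ y, ent (ν j) (fun t => f' (x, Function.update y j t))
            ∂(Measure.pi ν) := fun x =>
        ih ν (fun y => f' (x, y)) (hfp.comp measurable_prodMk_left)
      have h2 : ∀ j : Fin n, BddMeas fun z : X × (Fin n → X) =>
          ent (ν j) (fun t => f' (z.1, Function.update z.2 j t)) := by
        intro j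
        have := (hmeas j.succ).comp hcm
        simp only [Fin.cons_update, hf']
        exact this
      refine (integral_mono ((BddMeas.ent_right hfp _).integrable _)
        (integrable_finsetSum _ fun j _ => ((h2 j).integral_right _).integrable _) h1).trans ?_
      rw [integral_finsetSum _ fun j _ => ((h2 j).integral_right _).integrable _]
      refine le_of_eq (Finset.sum_congr rfl fun j _ => ?_)
      rw [← integral_prod _ ((h2 j).integrable _), hint]
      simp only [← Fin.cons_update, hf']
      rfl

end Entropy

/-! ### From entropy bounds to exponential moments -/

section Cumulants

open ProbabilityTheory Filter Topology

variable {Ω : Type*} [MeasurableSpace Ω] {μ : Measure Ω} [IsProbabilityMeasure μ] {F : Ω → ℝ}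

lemma BddMeas.const_mul (hF : BddMeas F) (l : ℝ) : BddMeas (fun x => l * F x) :=
  (bddMeas_const l).mul hF

lemma BddMeas.integrableExpSet_eq (hF : BddMeas F) : integrableExpSet F μ = Set.univ :=
  Set.eq_univ_of_forall fun l => ((hF.const_mul l).posBdd_exp.bddMeas).integrable μ

lemma BddMeas.mem_interior (hF : BddMeas F) (l : ℝ) : l ∈ interior (integrableExpSet F μ) := by
  simp [hF.integrableExpSet_eq]

lemma BddMeas.mgf_pos (hF : BddMeas F) (l : ℝ) : 0 < mgf F μ l :=
  (hF.const_mul l).posBdd_exp.integral_pos μ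

/-- Turns an entropy bound into a differential inequality for the cumulant generating function ψ, in
the combination l ψ' − ψ. -/
lemma ent_exp_mul (hF : BddMeas F) (l : ℝ) :
    ent μ (fun x => Real.exp (l * F x)) =
      mgf F μ l * (l * deriv (cgf F μ) l - cgf F μ l) := by
  have h : ∫ x, Real.exp (l * F x) * Real.log (Real.exp (l * F x)) ∂μ =
      l * ∫ x, F x * Real.exp (l * F x) ∂μ := by
    rw [← integral_const_mul]
    refine integral_congr_ae (Eventually.of_forall fun x => ?_)
    simp only [Real.log_exp]
    ring
  have hp := (hF.mgf_pos (μ := μ) l).ne'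
  unfold ent
  rw [h, deriv_cgf (hF.mem_interior l)]
  change _ - mgf F μ l * cgf F μ l = _
  field_simp

lemma BddMeas.hasDerivAt_cgf (hF : BddMeas F) (l : ℝ) :
    HasDerivAt (cgf F μ) (deriv (cgf F μ) l) l :=
  (analyticAt_cgf (hF.mem_interior l)).differentiableAt.hasDerivAt

lemma BddMeas.hasDerivAt_deriv_cgf (hF : BddMeas F) (l : ℝ) :
    HasDerivAt (deriv (cgf F μ)) (iteratedDeriv 2 (cgf F μ) l) l := by
  rw [iteratedDeriv_succ, iteratedDeriv_one]
  exact (analyticAt_cgf (hF.mem_interior l)).deriv.differentiableAt.hasDerivAt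

/-- The second derivative is the variance of F under the exponentially tilted law, and F takes
values in an interval of length c. -/
lemma iteratedDeriv_two_cgf_le (hF : BddMeas F) {c : ℝ} (hc : ∀ x y, F x - F y ≤ c) (l : ℝ) :
    iteratedDeriv 2 (cgf F μ) l ≤ c ^ 2 / 4 := by
  have : Nonempty Ω := nonempty_of_isProbabilityMeasure μ
  have hbdd : BddBelow (Set.range F) := by
    obtain ⟨C, hC⟩ := hF.2
    exact ⟨-C, by rintro _ ⟨x, rfl⟩; exact (abs_le.1 (hC x)).1⟩
  rw [← variance_tilted_mul (hF.mem_interior l)]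
  have : IsProbabilityMeasure (μ.tilted (l * F ·)) :=
    isProbabilityMeasure_tilted ((hF.const_mul l).posBdd_exp.bddMeas.integrable μ)
  refine (variance_le_sq_of_bounded (a := ⨅ x, F x) (b := (⨅ x, F x) + c)
    (Eventually.of_forall fun x => ⟨ciInf_le hbdd x, ?_⟩) hF.1.aemeasurable).trans
    (le_of_eq (by ring))
  have : F x - c ≤ ⨅ x, F x := le_ciInf fun y => by linarith [hc x y]
  linarith

/-- Entropy form of Hoeffding's lemma. -/
lemma ent_exp_mul_le (hF : BddMeas F) {c : ℝ} (hc : ∀ x y, F x - F y ≤ c) {l : ℝ} (hl : 0 ≤ l) :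
    ent μ (fun x => Real.exp (l * F x)) ≤ l ^ 2 * c ^ 2 / 8 * ∫ x, Real.exp (l * F x) ∂μ := by
  -- With ψ the cumulant generating function, t ψ' − ψ vanishes at 0 and has derivative t ψ'' ≤ t
  -- c²/4, so r increases from 0.
  set r : ℝ → ℝ := fun t => t ^ 2 * c ^ 2 / 8 - (t * deriv (cgf F μ) t - cgf F μ t) with hr
  have hd : ∀ t, HasDerivAt r (t * (c ^ 2 / 4 - iteratedDeriv 2 (cgf F μ) t)) t := by
    intro t
    have h1 : HasDerivAt (fun t : ℝ => t ^ 2 * c ^ 2 / 8) (t * (c ^ 2 / 4)) t := by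
      have := (((hasDerivAt_id t).pow 2).mul_const (c ^ 2)).div_const 8
      refine this.congr_deriv ?_
      simp
      ring
    refine (h1.sub (((hasDerivAt_id t).mul (hF.hasDerivAt_deriv_cgf t)).sub
      (hF.hasDerivAt_cgf t))).congr_deriv ?_
    simp only [id]
    ring
  have hmono : MonotoneOn r (Set.Ici 0) := by
    refine monotoneOn_of_deriv_nonneg (convex_Ici 0)
      (fun t _ => (hd t).continuousAt.continuousWithinAt)
      (fun t _ => (hd t).differentiableAt.differentiableWithinAt) fun t ht => ?_
    rw [interior_Ici] at ht
    rw [(hd t).deriv]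
    exact mul_nonneg (le_of_lt ht) (by linarith [iteratedDeriv_two_cgf_le (μ := μ) hF hc t])
  have h0 : r 0 = 0 := by simp [hr]
  have h := hmono (Set.mem_Ici.2 le_rfl) (Set.mem_Ici.2 hl) hl
  rw [h0] at h
  rw [ent_exp_mul hF]
  change _ ≤ _ * mgf F μ l
  rw [mul_comm (l ^ 2 * c ^ 2 / 8)]
  exact mul_le_mul_of_nonneg_left (by simp only [hr] at h; linarith) (hF.mgf_pos l).le

/-- **Herbst's argument.** -/
lemma cgf_le_of_ent_le (hF : BddMeas F) {B : ℝ}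
    (hB : ∀ l, 0 < l → ent μ (fun x => Real.exp (l * F x)) ≤
      l ^ 2 * B * ∫ x, Real.exp (l * F x) ∂μ) {l : ℝ} (hl : 0 < l) :
    cgf F μ l ≤ l * ∫ x, F x ∂μ + l ^ 2 * B := by
  have hent : ∀ t, 0 < t → t * deriv (cgf F μ) t - cgf F μ t ≤ t ^ 2 * B := by
    intro t ht
    have h := hB t ht
    rw [ent_exp_mul hF, mul_comm (t ^ 2 * B)] at h
    exact le_of_mul_le_mul_left h (hF.mgf_pos t)
  -- The derivative of ψ(t)/t is (t ψ' − ψ)/t² ≤ B, so g is nonincreasing on (0, ∞); its limit at 0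
  -- is ψ'(0), the mean of F.
  set g : ℝ → ℝ := fun t => t⁻¹ * cgf F μ t - t * B with hg
  have hd : ∀ t, 0 < t → HasDerivAt g
      (-(t ^ 2)⁻¹ * cgf F μ t + t⁻¹ * deriv (cgf F μ) t - 1 * B) t := fun t ht =>
    ((hasDerivAt_inv ht.ne').mul (hF.hasDerivAt_cgf t)).sub ((hasDerivAt_id t).mul_const B)
  have hanti : AntitoneOn g (Set.Ioi 0) := by
    refine antitoneOn_of_deriv_nonpos (convex_Ioi 0)
      (fun t ht => (hd t ht).continuousAt.continuousWithinAt)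
      (fun t ht => (hd t (interior_subset ht)).differentiableAt.differentiableWithinAt)
      fun t ht => ?_
    have ht : 0 < t := interior_subset ht
    rw [(hd t ht).deriv]
    have h := hent t ht
    have : -(t ^ 2)⁻¹ * cgf F μ t + t⁻¹ * deriv (cgf F μ) t - 1 * B =
        (t ^ 2)⁻¹ * (t * deriv (cgf F μ) t - cgf F μ t - t ^ 2 * B) := by
      field_simp
      ring
    rw [this]
    exact mul_nonpos_of_nonneg_of_nonpos (by positivity) (by linarith)
  have hlim : Tendsto g (𝓝[>] 0) (𝓝 (∫ x, F x ∂μ)) := by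
    have h1 := (hF.hasDerivAt_cgf (μ := μ) 0).tendsto_slope_zero_right
    simp only [zero_add, cgf_zero, sub_zero, smul_eq_mul,
      deriv_cgf_zero (hF.mem_interior (μ := μ) 0), probReal_univ, div_one] at h1
    have h2 : Tendsto (fun t : ℝ => t * B) (𝓝[>] 0) (𝓝 0) := by
      have : Tendsto (fun t : ℝ => t * B) (𝓝 0) (𝓝 (0 * B)) := tendsto_id.mul_const B
      rw [zero_mul] at this
      exact this.mono_left nhdsWithin_le_nhds
    simpa using h1.sub h2
  have hle : g l ≤ ∫ x, F x ∂μ := by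
    refine ge_of_tendsto hlim ?_
    filter_upwards [Ioo_mem_nhdsGT hl] with t ht
    exact hanti ht.1 hl ht.2.le
  simp only [hg] at hle
  have := mul_le_mul_of_nonneg_left hle hl.le
  rw [mul_sub, ← mul_assoc, mul_inv_cancel₀ hl.ne', one_mul] at this
  nlinarith

end Cumulants

/-! ### Entropy on two points and its convexity -/

section TwoPoint

/-- The entropy of a function with values `x`, `y` under the law with weights `q`, `p`. -/
noncomputable def pairEnt (q p x y : ℝ) : ℝ :=
  q * (x * Real.log x) + p * (y * Real.log y) - (q * x + p * y) * Real.log (q * x + p * y)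

variable {q p : ℝ}

/-- Two-point duality, with equality at (x₀, y₀) = (x, y). It exhibits `pairEnt` as a supremum of
linear functions of (x, y), whence both forms of Jensen's inequality below. -/
lemma pairEnt_ge (hq : 0 < q) (hp : 0 < p) {x y x₀ y₀ : ℝ} (hx : 0 < x) (hy : 0 < y)
    (hx₀ : 0 < x₀) (hy₀ : 0 < y₀) :
    q * x * (Real.log x₀ - Real.log (q * x₀ + p * y₀)) +
      p * y * (Real.log y₀ - Real.log (q * x₀ + p * y₀)) ≤ pairEnt q p x y := by
  have hm : 0 < q * x + p * y := by positivity
  have hm₀ : 0 < q * x₀ + p * y₀ := by positivity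
  have h1 := sub_le_mul_log_sub_log hx (div_pos (mul_pos hx₀ hm) hm₀)
  have h2 := sub_le_mul_log_sub_log hy (div_pos (mul_pos hy₀ hm) hm₀)
  rw [Real.log_div (by positivity) (by positivity), Real.log_mul (by positivity) (by positivity)]
    at h1 h2
  have h3 : q * (x₀ * (q * x + p * y) / (q * x₀ + p * y₀)) +
      p * (y₀ * (q * x + p * y) / (q * x₀ + p * y₀)) = q * x + p * y := by
    field_simp
  have h1' := mul_le_mul_of_nonneg_left h1 hq.le
  have h2' := mul_le_mul_of_nonneg_left h2 hp.le
  unfold pairEnt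
  linarith

lemma pairEnt_eq (q p x y : ℝ) : pairEnt q p x y =
    q * x * (Real.log x - Real.log (q * x + p * y)) +
      p * y * (Real.log y - Real.log (q * x + p * y)) := by
  unfold pairEnt
  ring

lemma pairEnt_self (hqp : q + p = 1) (x : ℝ) : pairEnt q p x x = 0 := by
  unfold pairEnt
  rw [← add_mul, ← add_mul, hqp]
  ring_nf

lemma pairEnt_combine_le (hq : 0 < q) (hp : 0 < p) {x y x' y' : ℝ} (hx : 0 < x)
    (hy : 0 < y) (hx' : 0 < x') (hy' : 0 < y') :
    pairEnt q p (q * x + p * x') (q * y + p * y') ≤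
      q * pairEnt q p x y + p * pairEnt q p x' y' := by
  have hX : 0 < q * x + p * x' := by positivity
  have hY : 0 < q * y + p * y' := by positivity
  have h1 := mul_le_mul_of_nonneg_left (pairEnt_ge hq hp hx hy hX hY) hq.le
  have h2 := mul_le_mul_of_nonneg_left (pairEnt_ge hq hp hx' hy' hX hY) hp.le
  rw [pairEnt_eq]
  linarith

/-- Jensen's inequality for `pairEnt`. -/
lemma pairEnt_integral_le {Ω : Type*} [MeasurableSpace Ω] (μ : Measure Ω) [IsProbabilityMeasure μ]
    (hq : 0 < q) (hp : 0 < p) {f g : Ω → ℝ} (hf : PosBdd f) (hg : PosBdd g) :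
    pairEnt q p (∫ x, f x ∂μ) (∫ x, g x ∂μ) ≤ ∫ x, pairEnt q p (f x) (g x) ∂μ := by
  set m := q * ∫ x, f x ∂μ + p * ∫ x, g x ∂μ
  have h1 : BddMeas (fun x => q * f x * (Real.log (∫ x, f x ∂μ) - Real.log m)) := by
    simp only [mul_comm _ (_ - _)]
    exact (hf.bddMeas.const_mul _).const_mul _
  have h2 : BddMeas (fun x => p * g x * (Real.log (∫ x, g x ∂μ) - Real.log m)) := by
    simp only [mul_comm _ (_ - _)]
    exact (hg.bddMeas.const_mul _).const_mul _
  have h3 : PosBdd (fun x => q * f x + p * g x) := by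
    obtain ⟨hm, a, b, ha, h⟩ := hf
    obtain ⟨hm', a', b', ha', h'⟩ := hg
    refine ⟨(hm.const_mul q).add (hm'.const_mul p), q * a + p * a', q * b + p * b', by positivity,
      fun x => ⟨?_, ?_⟩⟩
    · exact add_le_add (mul_le_mul_of_nonneg_left (h x).1 hq.le)
        (mul_le_mul_of_nonneg_left (h' x).1 hp.le)
    · exact add_le_add (mul_le_mul_of_nonneg_left (h x).2 hq.le)
        (mul_le_mul_of_nonneg_left (h' x).2 hp.le)
  have h4 : BddMeas (fun x => pairEnt q p (f x) (g x)) :=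
    (((hf.bddMeas.mul hf.log).const_mul q).add ((hg.bddMeas.mul hg.log).const_mul p)).sub
      (h3.bddMeas.mul h3.log)
  have h := integral_mono ((h1.add h2).integrable μ) (h4.integrable μ) fun x =>
    pairEnt_ge hq hp (hf.pos x) (hg.pos x) (hf.integral_pos μ) (hg.integral_pos μ)
  rw [integral_add (h1.integrable μ) (h2.integrable μ), integral_mul_const, integral_mul_const,
    integral_const_mul, integral_const_mul] at h
  rw [pairEnt_eq]
  exact h

end TwoPoint

/-! ### Entropy under binomial and truncated binomial laws -/

section Binomial

/-- The averaging operator `u ↦ q u(·) + p u(· + 1)` on sequences. -/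
def avgShift (q p : ℝ) (u : ℕ → ℝ) : ℕ → ℝ := fun k => q * u k + p * u (k + 1)

variable {q p : ℝ}

lemma avgShift_pos (hq : 0 < q) (hp : 0 < p) {u : ℕ → ℝ} (hu : ∀ k, 0 < u k) (k : ℕ) :
    0 < avgShift q p u k := by
  have := hu k
  have := hu (k + 1)
  unfold avgShift
  positivity

lemma iterate_avgShift_mono (hq : 0 < q) (hp : 0 < p) (m : ℕ) {u v : ℕ → ℝ} (huv : ∀ k, u k ≤ v k) :
    ∀ k, ((avgShift q p)^[m] u) k ≤ ((avgShift q p)^[m] v) k := by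
  induction m generalizing u v with
  | zero => exact huv
  | succ m ih =>
    simp only [Function.iterate_succ, Function.comp]
    refine ih fun k => ?_
    exact add_le_add (mul_le_mul_of_nonneg_left (huv k) hq.le)
      (mul_le_mul_of_nonneg_left (huv (k + 1)) hp.le)

lemma iterate_avgShift_add (m : ℕ) (u v : ℕ → ℝ) (k : ℕ) :
    ((avgShift q p)^[m] fun k => u k + v k) k =
      ((avgShift q p)^[m] u) k + ((avgShift q p)^[m] v) k := by
  induction m generalizing u v with
  | zero => rfl
  | succ m ih =>
    simp only [Function.iterate_succ, Function.comp]
    rw [← ih]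
    refine congrFun (congrArg _ (funext fun k => ?_)) k
    simp only [avgShift]
    ring

/-- One application of the operator averages over one further label, so its m-th iterate is the
expectation under a binomial law with m trials. -/
lemma iterate_avgShift_apply (m : ℕ) (u : ℕ → ℝ) (k : ℕ) :
    ((avgShift q p)^[m] u) k =
      ∑ i ∈ Finset.range (m + 1), (m.choose i : ℝ) * q ^ (m - i) * p ^ i * u (k + i) := by
  induction m generalizing k with
  | zero => simp
  | succ m ih =>
    rw [Function.iterate_succ_apply', avgShift, ih, ih, Finset.mul_sum, Finset.mul_sum,
      Finset.sum_range_succ' _ (m + 1), Finset.sum_range_succ' _ m, Finset.sum_range_succ _ m,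
      Finset.sum_range_succ _ m]
    have : ∀ i ∈ Finset.range m,
        ((m + 1).choose (i + 1) : ℝ) * q ^ (m + 1 - (i + 1)) * p ^ (i + 1) *
        u (k + (i + 1)) = q * ((m.choose (i + 1) : ℝ) * q ^ (m - (i + 1)) * p ^ (i + 1) *
          u (k + (i + 1))) + p * ((m.choose i : ℝ) * q ^ (m - i) * p ^ i * u (k + 1 + i)) := by
      intro i hi
      have hi : i < m := Finset.mem_range.1 hi
      obtain ⟨j, rfl⟩ := Nat.exists_eq_add_of_lt hi
      rw [Nat.choose_succ_succ, show i + j + 1 + 1 - (i + 1) = j + 1 by omega,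
        show i + j + 1 - (i + 1) = j by omega, show i + j + 1 - i = j + 1 by omega,
        show k + 1 + i = k + (i + 1) by omega]
      push_cast
      ring
    rw [Finset.sum_congr rfl this, Finset.sum_add_distrib]
    simp only [Nat.choose_self, Nat.choose_zero_right, Nat.sub_self, pow_zero, Nat.sub_zero,
      show k + 1 + m = k + (m + 1) by omega]
    push_cast
    ring

/-- Subadditivity of the entropy for binomial laws. -/
lemma iterate_avgShift_mul_log_le (hq : 0 < q) (hp : 0 < p) (m : ℕ) {u : ℕ → ℝ}
    (hu : ∀ k, 0 < u k) (k : ℕ) :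
    ((avgShift q p)^[m] fun k => u k * Real.log (u k)) k ≤
      ((avgShift q p)^[m] u) k * Real.log (((avgShift q p)^[m] u) k) +
        m * ((avgShift q p)^[m - 1] fun k => pairEnt q p (u k) (u (k + 1))) k := by
  induction m generalizing u k with
  | zero => simp
  | succ m ih =>
    set v := avgShift q p u with hv
    set E : ℕ → ℝ := fun k => pairEnt q p (u k) (u (k + 1)) with hE
    have h1 : (avgShift q p fun k => u k * Real.log (u k)) =
        fun k => v k * Real.log (v k) + E k := by
      funext k
      simp only [hv, hE, avgShift, pairEnt]
      ring
    -- Averaging over one label creates the two-point entropy E; by convexity the two-point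
    -- entropies of the averaged sequence are no larger than averages of E. Each of the m labels
    -- thus contributes at most the same term.
    have h2 : ∀ k, pairEnt q p (v k) (v (k + 1)) ≤ avgShift q p E k := fun k =>
      pairEnt_combine_le hq hp (hu _) (hu _) (hu _) (hu _)
    have h3 := ih (fun k => avgShift_pos hq hp hu k) k
    simp only [Function.iterate_succ, Function.comp, h1]
    rw [iterate_avgShift_add, Nat.add_sub_cancel]
    have h4 : (m : ℝ) * ((avgShift q p)^[m - 1] fun k => pairEnt q p (v k) (v (k + 1))) k ≤
        m * ((avgShift q p)^[m] E) k := by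
      rcases Nat.eq_zero_or_pos m with rfl | hm
      · simp
      · refine mul_le_mul_of_nonneg_left ?_ (Nat.cast_nonneg m)
        conv_rhs => rw [show m = m - 1 + 1 by omega]
        exact iterate_avgShift_mono hq hp (m - 1) h2 k
    push_cast
    linarith

/-- Subadditivity of the entropy for binomial laws conditioned to be at most `K`. -/
lemma truncated_binomial_ent_le (hq : 0 < q) (hp : 0 < p) (hqp : q + p = 1) {M K : ℕ}
    (hKM : K < M) {u : ℕ → ℝ} (hu : ∀ k, 0 < u k) :
    (∑ k ∈ Finset.range (K + 1), (M.choose k : ℝ) * q ^ (M - k) * p ^ k * (u k * Real.log (u k))) -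
      (∑ k ∈ Finset.range (K + 1), (M.choose k : ℝ) * q ^ (M - k) * p ^ k * u k) *
        Real.log ((∑ k ∈ Finset.range (K + 1), (M.choose k : ℝ) * q ^ (M - k) * p ^ k * u k) /
          ∑ k ∈ Finset.range (K + 1), (M.choose k : ℝ) * q ^ (M - k) * p ^ k) ≤
      M * ∑ k ∈ Finset.range K, ((M - 1).choose k : ℝ) * q ^ (M - 1 - k) * p ^ k *
        pairEnt q p (u k) (u (k + 1)) := by
  set w : ℕ → ℝ := fun k => (M.choose k : ℝ) * q ^ (M - k) * p ^ k with hw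
  set Z := ∑ k ∈ Finset.range (K + 1), w k with hZ
  set m := ∑ k ∈ Finset.range (K + 1), w k * u k with hm
  -- Freezing the sequence beyond K reduces the truncated law to the full binomial law: the
  -- two-point entropies at k ≥ K vanish, which leaves the sum over k < K.
  set v : ℕ → ℝ := fun k => u (min k K) with hv
  have hvp : ∀ k, 0 < v k := fun k => hu _
  have hw0 : ∀ k, 0 ≤ w k := fun k => by positivity
  have hwp : 0 < w 0 := by simp only [hw]; simp; positivity
  have hZ0 : 0 < Z := Finset.sum_pos' (fun k _ => hw0 k) ⟨0, by simp, hwp⟩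
  have hm0 : 0 < m := Finset.sum_pos' (fun k _ => mul_nonneg (hw0 k) (hu k).le)
    ⟨0, by simp, mul_pos hwp (hu 0)⟩
  have hall : ∀ x : ℕ → ℝ, ((avgShift q p)^[M] x) 0 = ∑ k ∈ Finset.range (M + 1), w k * x k := by
    intro x
    simp [iterate_avgShift_apply, hw]
  set t := ∑ k ∈ Finset.range (M + 1), w k * v k with ht
  have ht0 : 0 < t := Finset.sum_pos' (fun k _ => mul_nonneg (hw0 k) (hvp k).le)
    ⟨0, by simp, mul_pos hwp (hvp 0)⟩
  have hw1 : ∑ k ∈ Finset.range (M + 1), w k = 1 := by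
    have := add_pow p q M
    rw [add_comm p q, hqp, one_pow] at this
    rw [this]
    exact Finset.sum_congr rfl fun k _ => by simp only [hw]; ring
  have hbin := iterate_avgShift_mul_log_le hq hp M hvp 0
  rw [hall, hall, iterate_avgShift_apply, Nat.sub_add_cancel (by omega)] at hbin
  have htail : ∑ i ∈ Finset.range M, ((M - 1).choose i : ℝ) * q ^ (M - 1 - i) * p ^ i *
      pairEnt q p (v (0 + i)) (v (0 + i + 1)) =
      ∑ k ∈ Finset.range K, ((M - 1).choose k : ℝ) * q ^ (M - 1 - k) * p ^ k *
        pairEnt q p (u k) (u (k + 1)) := by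
    symm
    refine Finset.sum_subset_zero_on_sdiff (fun k hk => ?_) (fun k hk => ?_) fun k hk => ?_
    · simp only [Finset.mem_range] at hk ⊢
      omega
    · simp only [Finset.mem_sdiff, Finset.mem_range] at hk
      simp only [hv, zero_add]
      rw [min_eq_right (by omega), min_eq_right (by omega), pairEnt_self hqp, mul_zero]
    · simp only [Finset.mem_range] at hk
      simp only [hv, zero_add]
      rw [min_eq_left (by omega), min_eq_left (by omega)]
  rw [htail] at hbin
  have hB : ∀ x, 0 < x → 0 ≤ x * Real.log x - x * Real.log t - x + t := fun x hx => by
    have := sub_le_mul_log_sub_log hx ht0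
    linarith
  -- After subtraction of the tangent at the full mean t all terms are nonnegative, so those with k
  -- > K may be dropped.
  have hcmp : ∑ k ∈ Finset.range (K + 1),
      w k * (u k * Real.log (u k) - u k * Real.log t - u k + t) ≤
      ∑ k ∈ Finset.range (M + 1), w k * (v k * Real.log (v k) - v k * Real.log t - v k + t) := by
    rw [Finset.sum_congr rfl
      (g := fun k => w k * (v k * Real.log (v k) - v k * Real.log t - v k + t))
      fun k hk => ?_]
    · refine Finset.sum_le_sum_of_subset_of_nonneg (fun k hk => ?_) fun k _ _ =>
        mul_nonneg (hw0 k) (hB _ (hvp k))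
      simp only [Finset.mem_range] at hk ⊢
      omega
    · simp only [Finset.mem_range] at hk
      simp only [hv]
      rw [min_eq_left (by omega)]
  have hexp : ∀ (s : Finset ℕ) (x : ℕ → ℝ),
      ∑ k ∈ s, w k * (x k * Real.log (x k) - x k * Real.log t - x k + t) =
      ∑ k ∈ s, w k * (x k * Real.log (x k)) - (∑ k ∈ s, w k * x k) * Real.log t -
        ∑ k ∈ s, w k * x k + (∑ k ∈ s, w k) * t := by
    intro s x
    rw [Finset.sum_mul, Finset.sum_mul, ← Finset.sum_sub_distrib, ← Finset.sum_sub_distrib,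
      ← Finset.sum_add_distrib]
    exact Finset.sum_congr rfl fun k _ => by ring
  rw [hexp, hexp, hw1, ← hZ, ← hm, ← ht] at hcmp
  -- The tangent was taken at t and not at the truncated mean m / Z. By this inequality the change
  -- to m / Z can only decrease the left side.
  have hfin := sub_le_mul_log_sub_log hm0 (mul_pos hZ0 ht0)
  rw [Real.log_mul hZ0.ne' ht0.ne'] at hfin
  rw [Real.log_div hm0.ne' hZ0.ne']
  linarith

end Binomial

/-! ### Relabelling and resampling coordinates of product measures -/

section ProductMeasures

variable {X : Type*} [MeasurableSpace X]

lemma map_pi_comp_injective {ι κ : Type*} [Fintype ι] [Fintype κ] (μ : ι → Measure X)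
    [∀ i, IsProbabilityMeasure (μ i)] {e : κ → ι} (he : Function.Injective e) :
    (Measure.pi μ).map (fun z k => z (e k)) = Measure.pi fun k => μ (e k) := by
  rw [← Measure.infinitePi_eq_pi, ← Measure.infinitePi_eq_pi]
  exact Measure.map_infinitePi_infinitePi_of_inj he

lemma integral_pi_comp_injective {ι κ : Type*} [Fintype ι] [Fintype κ] (μ : ι → Measure X)
    [∀ i, IsProbabilityMeasure (μ i)] {e : κ → ι} (he : Function.Injective e)
    {h : (κ → X) → ℝ} (hh : Measurable h) :
    ∫ z, h (fun k => z (e k)) ∂(Measure.pi μ) = ∫ z, h z ∂(Measure.pi fun k => μ (e k)) := by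
  rw [← map_pi_comp_injective μ he, integral_map]
  · exact (measurable_pi_lambda _ fun k => measurable_pi_apply _).aemeasurable
  · exact hh.aestronglyMeasurable

/-- Such a function factors through the coordinates other than j, whose joint law is the same under
both measures. -/
lemma integral_pi_congr_of_update {ι : Type*} [Fintype ι] [DecidableEq ι] (μ μ' : ι → Measure X)
    [∀ i, IsProbabilityMeasure (μ i)] [∀ i, IsProbabilityMeasure (μ' i)] (j : ι)
    (hμ : ∀ i, i ≠ j → μ i = μ' i) {h : (ι → X) → ℝ} (hh : Measurable h)
    (hj : ∀ x t, h (Function.update x j t) = h x) :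
    ∫ x, h x ∂(Measure.pi μ) = ∫ x, h x ∂(Measure.pi μ') := by
  have : Nonempty X := nonempty_of_isProbabilityMeasure (μ j)
  obtain ⟨t₀⟩ := this
  set ext : ({i // i ≠ j} → X) → ι → X := fun z i => if hi : i ≠ j then z ⟨i, hi⟩ else t₀ with hext
  have hm : Measurable ext := by
    refine measurable_pi_lambda _ fun i => ?_
    by_cases hi : i = j
    · simp [hext, hi]
    · simp only [hext, ne_eq, hi, not_false_eq_true, dite_true]
      exact measurable_pi_apply _
  have hr : ∀ x, h x = h (ext fun i => x i.1) := by
    intro x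
    rw [← hj x t₀]
    congr 1
    funext i
    by_cases hi : i = j
    · subst hi
      simp [hext]
    · simp [hext, hi]
  have hr' : ∀ ρ : Measure (ι → X), ∫ x, h x ∂ρ = ∫ x, h (ext fun i => x i.1) ∂ρ := fun ρ =>
    integral_congr_ae (.of_forall hr)
  rw [hr', hr',
    integral_pi_comp_injective (h := fun z => h (ext z)) μ Subtype.val_injective (hh.comp hm),
    integral_pi_comp_injective (h := fun z => h (ext z)) μ' Subtype.val_injective (hh.comp hm)]
  congr 2
  funext i
  exact hμ _ i.2

lemma map_update_pi_prod {ι : Type*} [Fintype ι] [DecidableEq ι] (μ : ι → Measure X)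
    [∀ i, IsProbabilityMeasure (μ i)] (j : ι) :
    ((Measure.pi μ).prod (μ j)).map (fun z => Function.update z.1 j z.2) = Measure.pi μ := by
  symm
  refine Measure.pi_eq fun s hs => ?_
  rw [Measure.map_apply (measurable_update' (a := j)) (MeasurableSet.univ_pi hs)]
  have : (fun z : (ι → X) × X => Function.update z.1 j z.2) ⁻¹' (Set.univ.pi s) =
      (Set.univ.pi (Function.update s j Set.univ)) ×ˢ (s j) := by
    ext ⟨x, t⟩
    simp only [Set.mem_preimage, Set.mem_univ_pi, Set.mem_prod]
    constructor
    · intro h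
      refine ⟨fun i => ?_, by simpa using h j⟩
      by_cases hi : i = j
      · subst hi; simp
      · simpa [hi] using h i
    · rintro ⟨h1, h2⟩ i
      by_cases hi : i = j
      · subst hi; simpa using h2
      · simpa [hi] using h1 i
  rw [this, Measure.prod_prod, Measure.pi_pi, ← Finset.mul_prod_erase _ _ (Finset.mem_univ j),
    ← Finset.mul_prod_erase _ (fun i => μ i (s i)) (Finset.mem_univ j)]
  simp only [Function.update_self, measure_univ, one_mul]
  rw [mul_comm]
  congr 1
  refine Finset.prod_congr rfl fun i hi => ?_
  rw [Function.update_of_ne (Finset.ne_of_mem_erase hi)]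

lemma integral_integral_update {ι : Type*} [Fintype ι] [DecidableEq ι] (μ : ι → Measure X)
    [∀ i, IsProbabilityMeasure (μ i)] (j : ι) {f : (ι → X) → ℝ} (hf : BddMeas f) :
    ∫ x, ∫ t, f (Function.update x j t) ∂(μ j) ∂(Measure.pi μ) = ∫ x, f x ∂(Measure.pi μ) := by
  have hu : Measurable fun z : (ι → X) × X => Function.update z.1 j z.2 :=
    measurable_update' (a := j)
  rw [← integral_prod (fun z : (ι → X) × X => f (Function.update z.1 j z.2))
    ((hf.comp hu).integrable _)]
  conv_rhs => rw [← map_update_pi_prod μ j]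
  rw [integral_map hu.aemeasurable hf.1.aestronglyMeasurable]

end ProductMeasures

/-! ### Samples with prescribed labels, and the mixture law of one point -/

section LabelLaws

variable {X : Type*} [MeasurableSpace X]

/-- The laws of points whose set of negative positions is `S`. -/
def labelLaw {ι : Type*} [DecidableEq ι] (pP pN : Measure X) (S : Finset ι) (i : ι) : Measure X :=
  if i ∈ S then pN else pP

instance {ι : Type*} [DecidableEq ι] (pP pN : Measure X) [IsProbabilityMeasure pP]
    [IsProbabilityMeasure pN] (S : Finset ι) (i : ι) :
    IsProbabilityMeasure (labelLaw pP pN S i) := by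
  unfold labelLaw
  split_ifs <;> infer_instance

variable (pP pN : Measure X) [IsProbabilityMeasure pP] [IsProbabilityMeasure pN]

/-- A bijection of S onto T extends to a permutation of all positions, which carries one product law
to the other and leaves f unchanged. -/
lemma integral_labelLaw_eq_of_card_eq {ι : Type*} [Fintype ι] [DecidableEq ι] {f : (ι → X) → ℝ}
    (hf : Measurable f) (hsymm : ∀ (σ : Equiv.Perm ι) x, f (fun i => x (σ i)) = f x)
    {S T : Finset ι} (hST : S.card = T.card) :
    ∫ x, f x ∂(Measure.pi (labelLaw pP pN S)) = ∫ x, f x ∂(Measure.pi (labelLaw pP pN T)) := by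
  have e : {x // x ∈ S} ≃ {x // x ∈ T} := Fintype.equivOfCardEq (by simpa using hST)
  have hσ : (fun i => labelLaw pP pN T (e.extendSubtype i)) = labelLaw pP pN S := by
    funext i
    unfold labelLaw
    by_cases hi : i ∈ S
    · rw [if_pos hi, if_pos (e.extendSubtype_mem i hi)]
    · rw [if_neg hi, if_neg (e.extendSubtype_not_mem i hi)]
  rw [← hσ, ← integral_pi_comp_injective _ e.extendSubtype.injective hf]
  simp_rw [hsymm]

variable {pP pN}

lemma isProbabilityMeasure_unlabeledLaw {q p : ℝ} (hq : 0 ≤ q) (hp : 0 ≤ p) (hqp : q + p = 1) :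
    IsProbabilityMeasure (unlabeledLaw q p pP pN) := by
  constructor
  simp only [unlabeledLaw, Measure.coe_add, Measure.coe_smul, Pi.add_apply, Pi.smul_apply,
    measure_univ, smul_eq_mul, mul_one]
  rw [← ENNReal.ofReal_add hq hp, hqp, ENNReal.ofReal_one]

lemma integral_unlabeledLaw {q p : ℝ} (hq : 0 ≤ q) (hp : 0 ≤ p) {f : X → ℝ} (hf : BddMeas f) :
    ∫ x, f x ∂(unlabeledLaw q p pP pN) = q * ∫ x, f x ∂pP + p * ∫ x, f x ∂pN := by
  unfold unlabeledLaw
  rw [integral_add_measure ((hf.integrable _).smul_measure ENNReal.ofReal_ne_top)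
    ((hf.integrable _).smul_measure ENNReal.ofReal_ne_top), integral_smul_measure,
    integral_smul_measure, ENNReal.toReal_ofReal hq, ENNReal.toReal_ofReal hp]
  rfl

/-- Entropy within the classes plus entropy between them. The second part is what will cancel the
entropy of the random number of negative labels. -/
lemma ent_unlabeledLaw {q p : ℝ} (hq : 0 ≤ q) (hp : 0 ≤ p) {f : X → ℝ} (hf : PosBdd f) :
    ent (unlabeledLaw q p pP pN) f =
      q * ent pP f + p * ent pN f + pairEnt q p (∫ x, f x ∂pP) (∫ x, f x ∂pN) := by
  unfold ent pairEnt
  rw [integral_unlabeledLaw hq hp (hf.bddMeas.mul hf.log), integral_unlabeledLaw hq hp hf.bddMeas]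
  ring

end LabelLaws

/-! ### Subadditivity of entropy for the dependent points of a tuple -/

section TupleLaw

variable {X : Type*} [MeasurableSpace X] {pP pN : Measure X} [IsProbabilityMeasure pP]
  [IsProbabilityMeasure pN] {q p : ℝ} {M : ℕ}

lemma normConst_pos (hq : 0 < q) (hp : 0 < p) : 0 < normConst M q p := by
  unfold normConst
  refine Finset.sum_pos' (fun k _ => by positivity) ⟨0, by simp, ?_⟩
  simp only [Nat.choose_zero_right]
  positivity

lemma integral_tupleLaw (hq : 0 < q) (hp : 0 < p) {f : (Fin M → X) → ℝ} (hf : BddMeas f) :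
    ∫ x, f x ∂(tupleLaw M q p pP pN) =
      (∑ k ∈ Finset.range (M / 2 + 1), q ^ (M - k) * p ^ k *
        ∑ S ∈ Finset.powersetCard k (Finset.univ : Finset (Fin M)),
          ∫ x, f x ∂(Measure.pi (labelLaw pP pN S))) / normConst M q p := by
  have hZ := normConst_pos (M := M) hq hp
  have hi : ∀ (k : ℕ) (S : Finset (Fin M)), Integrable f
      (ENNReal.ofReal (q ^ (M - k) * p ^ k / normConst M q p) •
        Measure.pi (labelLaw pP pN S)) := fun k S =>
    (hf.integrable _).smul_measure ENNReal.ofReal_ne_top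
  change ∫ x, f x ∂(∑ k ∈ Finset.range (M / 2 + 1),
    ∑ S ∈ Finset.powersetCard k (Finset.univ : Finset (Fin M)),
    ENNReal.ofReal (q ^ (M - k) * p ^ k / normConst M q p) •
      Measure.pi (labelLaw pP pN S)) = _
  rw [integral_finsetSum_measure fun k _ => integrable_finsetSum_measure.2 fun S _ => hi k S,
    Finset.sum_div]
  refine Finset.sum_congr rfl fun k _ => ?_
  rw [integral_finsetSum_measure fun S _ => hi k S, Finset.mul_sum, Finset.sum_div]
  refine Finset.sum_congr rfl fun S _ => ?_
  rw [integral_smul_measure, ENNReal.toReal_ofReal (by positivity), smul_eq_mul]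
  ring

lemma isProbabilityMeasure_tupleLaw (hq : 0 < q) (hp : 0 < p) :
    IsProbabilityMeasure (tupleLaw M q p pP pN) := by
  have hZ := normConst_pos (M := M) hq hp
  constructor
  change (∑ k ∈ Finset.range (M / 2 + 1),
    ∑ S ∈ Finset.powersetCard k (Finset.univ : Finset (Fin M)),
    ENNReal.ofReal (q ^ (M - k) * p ^ k / normConst M q p) •
      Measure.pi (labelLaw pP pN S)) Set.univ = 1
  simp only [Measure.coe_finsetSum, Finset.sum_apply, Measure.coe_smul, Pi.smul_apply,
    measure_univ, smul_eq_mul, mul_one, Finset.sum_const, Finset.card_powersetCard,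
    Finset.card_univ, Fintype.card_fin]
  simp_rw [← ENNReal.ofReal_nsmul]
  rw [← ENNReal.ofReal_sum_of_nonneg fun k _ => by positivity, ← ENNReal.ofReal_one]
  congr 1
  rw [← div_self hZ.ne']
  conv_rhs => rw [normConst, Finset.sum_div]
  exact Finset.sum_congr rfl fun k _ => by rw [nsmul_eq_mul, normConst]; ring

lemma sum_powersetCard_succ_univ {ι : Type*} [Fintype ι] [DecidableEq ι] (j : ι) (k : ℕ)
    (g : Finset ι → ℝ) :
    ∑ S ∈ Finset.powersetCard (k + 1) Finset.univ, g S =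
      ∑ T ∈ Finset.powersetCard (k + 1) (Finset.univ.erase j), g T +
        ∑ T ∈ Finset.powersetCard k (Finset.univ.erase j), g (insert j T) := by
  have hj : j ∉ Finset.univ.erase j := Finset.notMem_erase j _
  have hmem : ∀ {m} {T : Finset ι}, T ∈ Finset.powersetCard m (Finset.univ.erase j) → j ∉ T :=
    fun hT h => hj ((Finset.mem_powersetCard.1 hT).1 h)
  conv_lhs => rw [← Finset.insert_erase (Finset.mem_univ j), Finset.powersetCard_succ_insert hj]
  rw [Finset.sum_union, Finset.sum_image]
  · intro T hT T' hT' h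
    rw [← Finset.erase_insert (hmem hT), ← Finset.erase_insert (hmem hT'), h]
  · rw [Finset.disjoint_left]
    intro T hT hT'
    obtain ⟨T', -, rfl⟩ := Finset.mem_image.1 hT'
    exact hmem hT (Finset.mem_insert_self _ _)

/-- The sums over the label sets with at most `K` negative positions, split according to the
label of the position `j`. -/
lemma sum_weight_powersetCard {K : ℕ} (hK : K < M) (q p : ℝ) (j : Fin M) (g : Finset (Fin M) → ℝ) :
    ∑ k ∈ Finset.range (K + 1), q ^ (M - k) * p ^ k *
        ∑ S ∈ Finset.powersetCard k Finset.univ, g S =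
      ∑ k ∈ Finset.range K, q ^ (M - 1 - k) * p ^ k *
          ∑ T ∈ Finset.powersetCard k (Finset.univ.erase j), (q * g T + p * g (insert j T)) +
        q ^ (M - K) * p ^ K * ∑ T ∈ Finset.powersetCard K (Finset.univ.erase j), g T := by
  induction K with
  | zero => simp
  | succ K ih =>
    rw [Finset.sum_range_succ, ih (by omega), Finset.sum_range_succ,
      sum_powersetCard_succ_univ j, Finset.sum_add_distrib, ← Finset.mul_sum, ← Finset.mul_sum,
      show M - K = M - 1 - K + 1 by omega, show M - (K + 1) = M - 1 - K by omega]
    ring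

/-- Subadditivity of the entropy for the law of a tuple, combined with a bound on the entropies
along single coordinates, for functions which do not depend on the order of the points. -/
lemma ent_tupleLaw_le (hq : 0 < q) (hp : 0 < p) (hqp : q + p = 1) (hM : 1 ≤ M)
    {f : (Fin M → X) → ℝ} (hf : PosBdd f)
    (hsymm : ∀ (σ : Equiv.Perm (Fin M)) x, f (fun i => x (σ i)) = f x) {κ : ℝ}
    (hκ : ∀ (ν : Measure X) [IsProbabilityMeasure ν] x j,
      ent ν (fun t => f (Function.update x j t)) ≤ κ * ∫ t, f (Function.update x j t) ∂ν) :
    ent (tupleLaw M q p pP pN) f ≤ M * κ * ∫ x, f x ∂(tupleLaw M q p pP pN) := by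
  set K := M / 2 with hK
  have hKM : K < M := by omega
  have hZ := normConst_pos (M := M) hq hp
  set Z := normConst M q p with hZdef
  set P : Finset (Fin M) → Measure (Fin M → X) := fun S => Measure.pi (labelLaw pP pN S) with hP
  set u : Finset (Fin M) → ℝ := fun S => ∫ x, f x ∂(P S) with hu
  -- The common value of u on the sets of size k ≤ M, read off at an initial segment. The definition
  -- also makes sense, and is positive, for larger k.
  set w : ℕ → ℝ := fun k => u (Finset.univ.filter fun i : Fin M => i.val < k) with hw
  have hwpos : ∀ k, 0 < w k := fun k => hf.integral_pos _
  have huw : ∀ S, u S = w S.card := by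
    intro S
    refine integral_labelLaw_eq_of_card_eq pP pN hf.1 hsymm ?_
    have hS : S.card ≤ M := by simpa using Finset.card_le_univ S
    rw [Fin.card_filter_val_lt, min_eq_right hS]
  have hupd : ∀ j, Measurable fun z : (Fin M → X) × X => Function.update z.1 j z.2 := fun j =>
    measurable_update' (a := j)
  have hfu : ∀ j, PosBdd fun z : (Fin M → X) × X => f (Function.update z.1 j z.2) := fun j =>
    hf.comp (hupd j)
  have hfx : ∀ j x, PosBdd fun t : X => f (Function.update x j t) := fun j x =>
    hf.comp (measurable_update x)
  set Ap : Fin M → Finset (Fin M) → ℝ := fun j T =>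
    ∫ x, ent pP (fun t => f (Function.update x j t)) ∂(P T) with hAp
  set An : Fin M → Finset (Fin M) → ℝ := fun j T =>
    ∫ x, ent pN (fun t => f (Function.update x j t)) ∂(P T) with hAn
  set A : Fin M → Finset (Fin M) → ℝ := fun j S =>
    ∫ x, ent (labelLaw pP pN S j) (fun t => f (Function.update x j t)) ∂(P S) with hA
  have hinsert : ∀ (j : Fin M) (T : Finset (Fin M)) {h : (Fin M → X) → ℝ}, Measurable h →
      (∀ x t, h (Function.update x j t) = h x) →
      ∫ x, h x ∂(P (insert j T)) = ∫ x, h x ∂(P T) := by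
    intro j T h hh hj
    refine integral_pi_congr_of_update _ _ j (fun i hi => ?_) hh hj
    simp [labelLaw, Finset.mem_insert, hi]
  have hA1 : ∀ j T, j ∉ T → A j T = Ap j T := by
    intro j T hj
    simp [hA, hAp, labelLaw, hj]
  have hA2 : ∀ j T, A j (insert j T) = An j T := by
    intro j T
    simp only [hA, hAn, labelLaw, Finset.mem_insert_self, if_true]
    exact hinsert j T (BddMeas.ent_right (hfu j) pN).1 fun x t => by simp
  have hu1 : ∀ j T, j ∉ T → ∫ x, ∫ t, f (Function.update x j t) ∂pP ∂(P T) = u T := by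
    intro j T hj
    have := integral_integral_update (labelLaw pP pN T) j hf.bddMeas
    simpa only [labelLaw, hj, if_false] using this
  have hu2 : ∀ j T, ∫ x, ∫ t, f (Function.update x j t) ∂pN ∂(P T) = u (insert j T) := by
    intro j T
    have := integral_integral_update (labelLaw pP pN (insert j T)) j hf.bddMeas
    rw [← hinsert j T ((hfu j).integral_right pN).1 fun x t => by simp]
    simp only [hP, hu]
    rw [← this]
    simp [labelLaw]
  -- While both labels of j are allowed, `hκ` is applied to the mixture law of the coordinate. The
  -- between-class part of the entropy is then subtracted, after Jensen's inequality has moved the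
  -- integral inside `pairEnt`.
  have hmix : ∀ j T, j ∉ T → q * Ap j T + p * An j T ≤
      κ * (q * u T + p * u (insert j T)) - pairEnt q p (u T) (u (insert j T)) := by
    intro j T hj
    have hU := isProbabilityMeasure_unlabeledLaw (pP := pP) (pN := pN) hq.le hp.le hqp
    have hi1 := (BddMeas.ent_right (hfu j) pP).const_mul q
    have hi2 := (BddMeas.ent_right (hfu j) pN).const_mul p
    have hm1 := (hfu j).integral_right pP
    have hm2 := (hfu j).integral_right pN
    have hent := BddMeas.ent_right (hfu j) (unlabeledLaw q p pP pN)
    have hpe : BddMeas fun x => pairEnt q p (∫ t, f (Function.update x j t) ∂pP)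
        (∫ t, f (Function.update x j t) ∂pN) := by
      have := (hent.sub hi1).sub hi2
      refine (congrArg BddMeas (funext fun x => ?_)).mp this
      rw [ent_unlabeledLaw hq.le hp.le (hfx j x)]
      ring
    have h1 : ∫ x, ent (unlabeledLaw q p pP pN) (fun t => f (Function.update x j t)) ∂(P T) ≤
        κ * (q * u T + p * u (insert j T)) := by
      have hr := ((hm1.bddMeas.const_mul q).add (hm2.bddMeas.const_mul p)).const_mul κ
      refine (integral_mono (hent.integrable _) (hr.integrable _) fun x => ?_).trans (le_of_eq ?_)
      · refine (hκ _ x j).trans (le_of_eq ?_)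
        rw [integral_unlabeledLaw hq.le hp.le (hfx j x).bddMeas]
      · rw [integral_const_mul, integral_add ((hm1.bddMeas.const_mul q).integrable _)
          ((hm2.bddMeas.const_mul p).integrable _), integral_const_mul, integral_const_mul,
          hu1 j T hj, hu2 j T]
    have h2 : ∫ x, ent (unlabeledLaw q p pP pN) (fun t => f (Function.update x j t)) ∂(P T) =
        q * Ap j T + p * An j T + ∫ x, pairEnt q p (∫ t, f (Function.update x j t) ∂pP)
          (∫ t, f (Function.update x j t) ∂pN) ∂(P T) := by
      simp_rw [fun x => ent_unlabeledLaw (pP := pP) (pN := pN) hq.le hp.le (hfx j x)]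
      rw [integral_add ((hi1.add hi2).integrable _) (hpe.integrable _),
        integral_add (hi1.integrable _) (hi2.integrable _), integral_const_mul,
        integral_const_mul]
    have h3 := pairEnt_integral_le (P T) hq hp hm1 hm2
    rw [hu1 j T hj, hu2 j T] at h3
    linarith
  -- Used when T has the maximal size K: the point at j is then necessarily positive and there is no
  -- mixture to exploit.
  have hplus : ∀ j T, j ∉ T → Ap j T ≤ κ * u T := by
    intro j T hj
    have hm1 := (hfu j).integral_right pP
    refine (integral_mono ((BddMeas.ent_right (hfu j) pP).integrable _)
      ((hm1.bddMeas.const_mul κ).integrable _) fun x => hκ pP x j).trans (le_of_eq ?_)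
    rw [integral_const_mul, hu1 j T hj]
  have hmem : ∀ {j : Fin M} {m} {T : Finset (Fin M)},
      T ∈ Finset.powersetCard m (Finset.univ.erase j) → j ∉ T ∧ T.card = m := fun hT =>
    ⟨fun h => Finset.notMem_erase _ _ ((Finset.mem_powersetCard.1 hT).1 h),
      (Finset.mem_powersetCard.1 hT).2⟩
  set m := ∑ k ∈ Finset.range (K + 1), q ^ (M - k) * p ^ k *
    ∑ S ∈ Finset.powersetCard k Finset.univ, u S with hm
  set B := ∑ k ∈ Finset.range K, ((M - 1).choose k : ℝ) * q ^ (M - 1 - k) * p ^ k *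
    pairEnt q p (w k) (w (k + 1)) with hB
  have hj : ∀ j, ∑ k ∈ Finset.range (K + 1), q ^ (M - k) * p ^ k *
      ∑ S ∈ Finset.powersetCard k Finset.univ, A j S ≤ κ * m - B := by
    intro j
    have hBj : B = ∑ k ∈ Finset.range K, q ^ (M - 1 - k) * p ^ k *
        ∑ T ∈ Finset.powersetCard k (Finset.univ.erase j),
          pairEnt q p (u T) (u (insert j T)) := by
      refine Finset.sum_congr rfl fun k _ => ?_
      rw [Finset.sum_congr rfl (g := fun _ => pairEnt q p (w k) (w (k + 1))) fun T hT => by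
        obtain ⟨h1, h2⟩ := hmem hT
        rw [huw, huw, Finset.card_insert_of_notMem h1, h2]]
      rw [Finset.sum_const, Finset.card_powersetCard, Finset.card_erase_of_mem (Finset.mem_univ j),
        Finset.card_univ, Fintype.card_fin, nsmul_eq_mul]
      ring
    rw [hm, hBj, sum_weight_powersetCard hKM q p j, sum_weight_powersetCard hKM q p j, mul_add,
      add_sub_right_comm]
    refine add_le_add ?_ ?_
    · rw [Finset.mul_sum, ← Finset.sum_sub_distrib]
      refine Finset.sum_le_sum fun k _ => ?_
      have key : ∑ T ∈ Finset.powersetCard k (Finset.univ.erase j),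
          (q * A j T + p * A j (insert j T)) ≤
          κ * ∑ T ∈ Finset.powersetCard k (Finset.univ.erase j), (q * u T + p * u (insert j T)) -
            ∑ T ∈ Finset.powersetCard k (Finset.univ.erase j),
              pairEnt q p (u T) (u (insert j T)) := by
        rw [Finset.mul_sum, ← Finset.sum_sub_distrib]
        refine Finset.sum_le_sum fun T hT => ?_
        obtain ⟨h1, -⟩ := hmem hT
        rw [hA1 j T h1, hA2 j T]
        exact hmix j T h1
      refine (mul_le_mul_of_nonneg_left key (by positivity :
        0 ≤ q ^ (M - 1 - k) * p ^ k)).trans (le_of_eq (by ring))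
    · have key : ∑ T ∈ Finset.powersetCard K (Finset.univ.erase j), A j T ≤
          κ * ∑ T ∈ Finset.powersetCard K (Finset.univ.erase j), u T := by
        rw [Finset.mul_sum]
        refine Finset.sum_le_sum fun T hT => ?_
        obtain ⟨h1, -⟩ := hmem hT
        rw [hA1 j T h1]
        exact hplus j T h1
      refine (mul_le_mul_of_nonneg_left key (by positivity :
        0 ≤ q ^ (M - K) * p ^ K)).trans (le_of_eq (by ring))
  have hentP : ∑ k ∈ Finset.range (K + 1), q ^ (M - k) * p ^ k *
      ∑ S ∈ Finset.powersetCard k Finset.univ, ent (P S) f ≤ M * (κ * m - B) := by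
    calc _ ≤ ∑ k ∈ Finset.range (K + 1), q ^ (M - k) * p ^ k *
          ∑ S ∈ Finset.powersetCard k Finset.univ, ∑ j, A j S :=
        Finset.sum_le_sum fun k _ => mul_le_mul_of_nonneg_left
          (Finset.sum_le_sum fun S _ => ent_pi_le M (labelLaw pP pN S) f hf) (by positivity)
      _ = ∑ j, ∑ k ∈ Finset.range (K + 1), q ^ (M - k) * p ^ k *
          ∑ S ∈ Finset.powersetCard k Finset.univ, A j S := by
        rw [Finset.sum_comm]
        refine Finset.sum_congr rfl fun k _ => ?_
        rw [Finset.sum_comm, Finset.mul_sum]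
      _ ≤ ∑ _j : Fin M, (κ * m - B) := Finset.sum_le_sum fun j _ => hj j
      _ = _ := by rw [Finset.sum_const, Finset.card_univ, Fintype.card_fin, nsmul_eq_mul]
  have hcard : ∀ (k : ℕ) (φ : ℝ → ℝ),
      ∑ S ∈ Finset.powersetCard k (Finset.univ : Finset (Fin M)), φ (u S) =
        (M.choose k : ℝ) * φ (w k) := by
    intro k φ
    rw [Finset.sum_congr rfl (g := fun _ => φ (w k)) fun S hS => by
      rw [huw, (Finset.mem_powersetCard.1 hS).2]]
    simp
  have hmw : m = ∑ k ∈ Finset.range (K + 1), (M.choose k : ℝ) * q ^ (M - k) * p ^ k * w k := by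
    refine Finset.sum_congr rfl fun k _ => ?_
    rw [hcard k fun x => x]
    ring
  -- The entropy of the label count is at most M B, which exactly compensates the −M B gained in
  -- `hentP`.
  have htr := truncated_binomial_ent_le hq hp hqp hKM hwpos
  rw [← hmw, ← hB] at htr
  change _ - m * Real.log (m / Z) ≤ _ at htr
  have hQ1 : ∫ x, f x ∂(tupleLaw M q p pP pN) = m / Z := integral_tupleLaw hq hp hf.bddMeas
  have hQ2 : Z * ∫ x, f x * Real.log (f x) ∂(tupleLaw M q p pP pN) =
      ∑ k ∈ Finset.range (K + 1), q ^ (M - k) * p ^ k *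
        ∑ S ∈ Finset.powersetCard k Finset.univ, ent (P S) f +
      ∑ k ∈ Finset.range (K + 1), (M.choose k : ℝ) * q ^ (M - k) * p ^ k *
        (w k * Real.log (w k)) := by
    rw [integral_tupleLaw hq hp (hf.bddMeas.mul hf.log), mul_div_cancel₀ _ hZ.ne',
      ← Finset.sum_add_distrib]
    refine Finset.sum_congr rfl fun k _ => ?_
    have := hcard k fun x => x * Real.log x
    rw [show ((M.choose k : ℝ) * q ^ (M - k) * p ^ k * (w k * Real.log (w k))) =
      q ^ (M - k) * p ^ k * (M.choose k * (w k * Real.log (w k))) by ring, ← this, ← mul_add,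
      ← Finset.sum_add_distrib]
    congr 1
    refine Finset.sum_congr rfl fun S _ => ?_
    simp only [ent, hu]
    ring
  have hfin : Z * ent (tupleLaw M q p pP pN) f ≤ M * κ * m := by
    rw [ent, mul_sub, hQ2, hQ1, ← mul_assoc, mul_div_cancel₀ _ hZ.ne']
    linarith
  rw [hQ1, ← mul_div_assoc, le_div_iff₀ hZ]
  linarith

end TupleLaw

/-! ### Bounded differences for independent tuples -/

section Concentration

open ProbabilityTheory

variable {X : Type*} [MeasurableSpace X] {pP pN : Measure X} [IsProbabilityMeasure pP]
  [IsProbabilityMeasure pN] {q p : ℝ} {M : ℕ}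

/-- Hoeffding's entropy bound depends only on the oscillation along a coordinate and not on its law.
It therefore serves the mixture as well as the two classes, as the entropy inequality for tuples
requires. -/
lemma integral_exp_tupleLaw_le (hq : 0 < q) (hp : 0 < p) (hqp : q + p = 1) (hM : 1 ≤ M)
    {F : (Fin M → X) → ℝ} (hF : BddMeas F)
    (hsymm : ∀ (σ : Equiv.Perm (Fin M)) x, F (fun i => x (σ i)) = F x) {c : ℝ}
    (hc : ∀ x j t, F (Function.update x j t) - F x ≤ c) {l : ℝ} (hl : 0 < l) :
    ∫ x, Real.exp (l * F x) ∂(tupleLaw M q p pP pN) ≤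
      Real.exp (l * ∫ x, F x ∂(tupleLaw M q p pP pN) + l ^ 2 * (M * (c ^ 2 / 8))) := by
  have hQ := isProbabilityMeasure_tupleLaw (M := M) (pP := pP) (pN := pN) hq hp
  have h := cgf_le_of_ent_le (μ := tupleLaw M q p pP pN) hF (B := M * (c ^ 2 / 8))
    (fun l hl => ?_) hl
  · exact (Real.log_le_iff_le_exp (hF.mgf_pos l)).1 h
  · have hf := (hF.const_mul l).posBdd_exp
    refine (ent_tupleLaw_le hq hp hqp hM hf (fun σ x => by rw [hsymm])
      (κ := l ^ 2 * c ^ 2 / 8) fun ν _ x j => ?_).trans (le_of_eq (by ring))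
    refine ent_exp_mul_le (F := fun t => F (Function.update x j t))
      (hF.comp (measurable_update x)) (fun s t => ?_) hl.le
    have := hc (Function.update x j t) j s
    rwa [Function.update_idem] at this

/-- The first tuple is integrated out; the partial mean inherits the invariance within each
remaining tuple and the difference bound c. -/
lemma integral_exp_pi_tupleLaw_le (hq : 0 < q) (hp : 0 < p) (hqp : q + p = 1) (hM : 1 ≤ M)
    {c l : ℝ} (hl : 0 < l) (n : ℕ) : ∀ {F : (Fin n → Fin M → X) → ℝ}, BddMeas F →
    (∀ z i (σ : Equiv.Perm (Fin M)), F (Function.update z i fun j => z i (σ j)) = F z) →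
    (∀ z i j t, F (Function.update z i (Function.update (z i) j t)) - F z ≤ c) →
    ∫ z, Real.exp (l * F z) ∂(Measure.pi fun _ : Fin n => tupleLaw M q p pP pN) ≤
      Real.exp (l * ∫ z, F z ∂(Measure.pi fun _ : Fin n => tupleLaw M q p pP pN) +
        l ^ 2 * (n * (M * (c ^ 2 / 8)))) := by
  have hQ := isProbabilityMeasure_tupleLaw (M := M) (pP := pP) (pN := pN) hq hp
  set Q := tupleLaw M q p pP pN with hQdef
  induction n with
  | zero =>
    intro F _ _ _
    have : ∀ z, F z = F default := fun z => congrArg F (Subsingleton.elim _ _)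
    simp_rw [this]
    simp
  | succ n ih =>
    intro F hF hsymm hc
    set F' : (Fin M → X) × (Fin n → Fin M → X) → ℝ := fun z => F (Fin.cons z.1 z.2) with hF'
    have hFb : BddMeas F' := hF.comp (measurable_finCons n)
    have hFs : BddMeas fun z : (Fin n → Fin M → X) × (Fin M → X) => F' (z.2, z.1) :=
      hFb.comp measurable_swap
    set G : (Fin n → Fin M → X) → ℝ := fun z => ∫ y, F' (y, z) ∂Q with hG
    have hGb : BddMeas G := hFs.integral_right Q
    have hsec : ∀ z, BddMeas fun y => F' (y, z) := fun z => hFb.comp measurable_prodMk_right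
    rw [integral_pi_succ, integral_pi_succ,
      integral_prod_symm _ ((hFb.const_mul l).posBdd_exp.bddMeas.integrable _),
      integral_prod_symm _ (hFb.integrable _)]
    have hstep : ∀ z, ∫ y, Real.exp (l * F' (y, z)) ∂Q ≤
        Real.exp (l ^ 2 * (M * (c ^ 2 / 8))) * Real.exp (l * G z) := by
      intro z
      rw [← Real.exp_add, add_comm]
      refine integral_exp_tupleLaw_le hq hp hqp hM (hsec z) (fun σ y => ?_) (fun y j t => ?_) hl
      · have := hsymm (Fin.cons y z) 0 σ
        simpa [hF'] using this
      · have := hc (Fin.cons y z) 0 j t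
        simpa [hF'] using this
    have hexp : BddMeas fun z : (Fin n → Fin M → X) × (Fin M → X) =>
        Real.exp (l * F' (z.2, z.1)) := (hFs.const_mul l).posBdd_exp.bddMeas
    refine (integral_mono ((hexp.integral_right Q).integrable _)
      (((hGb.const_mul l).posBdd_exp.bddMeas.const_mul _).integrable _) hstep).trans ?_
    rw [integral_const_mul]
    refine (mul_le_mul_of_nonneg_left (ih hGb (fun z i σ => ?_) fun z i j t => ?_)
      (Real.exp_pos _).le).trans ?_
    · refine integral_congr_ae (.of_forall fun y => ?_)
      have := hsymm (Fin.cons y z) i.succ σ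
      simpa [hF', ← Fin.cons_update] using this
    · rw [hG, ← integral_sub ((hsec _).integrable _) ((hsec _).integrable _)]
      refine (integral_mono (((hsec _).sub (hsec _)).integrable _) (integrable_const c)
        fun y => ?_).trans (by simp)
      have := hc (Fin.cons y z) i.succ j t
      simpa [hF', ← Fin.cons_update] using this
    · rw [← Real.exp_add]
      refine le_of_eq (congrArg Real.exp ?_)
      push_cast
      ring

/-- **The bounded difference inequality** for independent tuples: the points of one tuple are
dependent, but a function which does not depend on their order concentrates as if they were
independent. -/
theorem measureReal_pi_tupleLaw_ge_le (hq : 0 < q) (hp : 0 < p) (hqp : q + p = 1) (hM : 1 ≤ M)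
    {n : ℕ} (hn : 1 ≤ n) {F : (Fin n → Fin M → X) → ℝ} (hF : BddMeas F)
    (hsymm : ∀ z i (σ : Equiv.Perm (Fin M)), F (Function.update z i fun j => z i (σ j)) = F z)
    {c : ℝ} (hc0 : 0 < c)
    (hc : ∀ z i j t, F (Function.update z i (Function.update (z i) j t)) - F z ≤ c)
    {δ : ℝ} (hδ : 0 < δ) (hδ1 : δ < 1) :
    (Measure.pi fun _ : Fin n => tupleLaw M q p pP pN).real
      {z | ∫ z, F z ∂(Measure.pi fun _ : Fin n => tupleLaw M q p pP pN) +
        c * √(M * n * Real.log (1 / δ) / 2) ≤ F z} ≤ δ := by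
  have hQ := isProbabilityMeasure_tupleLaw (M := M) (pP := pP) (pN := pN) hq hp
  set μ := Measure.pi fun _ : Fin n => tupleLaw M q p pP pN with hμ
  have hM0 : (0 : ℝ) < M := by exact_mod_cast hM
  have hn0 : (0 : ℝ) < n := by exact_mod_cast hn
  have hlog : 0 < Real.log (1 / δ) := Real.log_pos (by rw [lt_div_iff₀ hδ]; linarith)
  set s := √(M * n * Real.log (1 / δ) / 2) with hs
  have hs2 : s ^ 2 = M * n * Real.log (1 / δ) / 2 := Real.sq_sqrt (by positivity)
  have hs0 : 0 < s := Real.sqrt_pos.2 (by positivity)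
  -- The minimizer of the Chernoff exponent l² M n c²/8 − l c s; the minimum −2s²/(Mn) is log δ.
  set l := 4 * s / (M * n * c) with hl
  have hl0 : 0 < l := by positivity
  refine (measure_ge_le_exp_mul_mgf _ hl0.le
    ((hF.const_mul l).posBdd_exp.bddMeas.integrable μ)).trans ?_
  have h := integral_exp_pi_tupleLaw_le (pP := pP) (pN := pN) hq hp hqp hM hl0 n hF hsymm hc
  refine (mul_le_mul_of_nonneg_left h (Real.exp_pos _).le).trans ?_
  rw [← Real.exp_add, ← Real.le_log_iff_exp_le hδ]
  have hδlog : Real.log δ = -(2 * s ^ 2 / (M * n)) := by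
    rw [hs2, one_div, Real.log_inv]
    field_simp
  rw [hδlog]
  refine le_of_eq ?_
  rw [hl, ← hμ]
  field_simp
  ring

end Concentration

/-! ### The contraction principle for random signs -/

section Contraction

lemma bddAbove_range_of_abs_le {γ : Type*} {a : γ → ℝ} {C : ℝ} (h : ∀ g, |a g| ≤ C) :
    BddAbove (Set.range a) := ⟨C, by rintro _ ⟨g, rfl⟩; exact (abs_le.1 (h g)).2⟩

variable {γ : Type*} [Nonempty γ]

/-- The contraction step at one position, summed over its two signs. For near-maximizers g and g',
only v g − v g' enters; it is at most L |t g − t g'|, and the order of t g and t g' decides which of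
the two goes into which supremum. -/
lemma iSup_add_iSup_sub_le {a v t : γ → ℝ} {L C : ℝ} (ha : ∀ g, |a g| ≤ C) (ht : ∀ g, |L * t g| ≤ C)
    (hv : ∀ g g', |v g - v g'| ≤ L * |t g - t g'|) :
    (⨆ g, (a g + v g)) + ⨆ g, (a g - v g) ≤ (⨆ g, (a g + L * t g)) + ⨆ g, (a g - L * t g) := by
  have h1 : BddAbove (Set.range fun g => a g + L * t g) :=
    bddAbove_range_of_abs_le fun g => (abs_add_le _ _).trans (add_le_add (ha g) (ht g))
  have h2 : BddAbove (Set.range fun g => a g - L * t g) :=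
    bddAbove_range_of_abs_le fun g => (abs_sub _ _).trans (add_le_add (ha g) (ht g))
  have key : ∀ g g', (a g + v g) + (a g' - v g') ≤
      (⨆ g, (a g + L * t g)) + ⨆ g, (a g - L * t g) := by
    intro g g'
    have h := le_of_abs_le (hv g g')
    rcases le_total (t g') (t g) with ht | ht
    · rw [abs_of_nonneg (sub_nonneg.2 ht)] at h
      linarith [le_ciSup h1 g, le_ciSup h2 g']
    · rw [abs_of_nonpos (sub_nonpos.2 ht)] at h
      linarith [le_ciSup h1 g', le_ciSup h2 g]
  rw [← le_sub_iff_add_le]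
  refine ciSup_le fun g => ?_
  rw [le_sub_iff_add_le, ← le_sub_iff_add_le']
  exact ciSup_le fun g' => by linarith [key g g']

/-- Changing the sign at one position. -/
lemma sum_flip_eq {ι : Type*} [Fintype ι] [DecidableEq ι] (j : ι) (h : (ι → ℤˣ) → ℝ) :
    ∑ σ, h (Function.update σ j (-σ j)) = ∑ σ, h σ := by
  have hinv : Function.Involutive fun σ : ι → ℤˣ => Function.update σ j (-σ j) := by
    intro σ
    simp
  exact Equiv.sum_comp hinv.toPerm h

/-- Real value of a sign. -/
noncomputable def sgn (u : ℤˣ) : ℝ := ((u : ℤ) : ℝ)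

@[simp] lemma sgn_one : sgn 1 = 1 := by simp [sgn]

@[simp] lemma sgn_neg (u : ℤˣ) : sgn (-u) = -sgn u := by simp [sgn]

lemma abs_sgn (u : ℤˣ) : |sgn u| = 1 := by
  rcases Int.units_eq_one_or u with rfl | rfl <;> simp

/-- The **contraction principle** for Rademacher averages. -/
lemma sum_iSup_sign_le {ι : Type*} [Fintype ι] [DecidableEq ι] {v t : ι → γ → ℝ} {L C : ℝ}
    (hvC : ∀ i g, |v i g| ≤ C) (htC : ∀ i g, |L * t i g| ≤ C)
    (hv : ∀ i g g', |v i g - v i g'| ≤ L * |t i g - t i g'|) :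
    ∑ σ : ι → ℤˣ, ⨆ g, ∑ i, sgn (σ i) * v i g ≤
      ∑ σ : ι → ℤˣ, ⨆ g, ∑ i, sgn (σ i) * (L * t i g) := by
  classical
  -- Interpolation between the two families, one position at a time. At position j the sign vectors
  -- are paired with those flipped at j.
  set m : Finset ι → ι → γ → ℝ := fun J i g => if i ∈ J then v i g else L * t i g with hm
  have hmC : ∀ J i g, |m J i g| ≤ C := by
    intro J i g
    simp only [hm]
    split_ifs
    · exact hvC i g
    · exact htC i g
  have key : ∀ J : Finset ι, ∑ σ : ι → ℤˣ, ⨆ g, ∑ i, sgn (σ i) * m J i g ≤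
      ∑ σ : ι → ℤˣ, ⨆ g, ∑ i, sgn (σ i) * (L * t i g) := by
    intro J
    induction J using Finset.induction_on with
    | empty => simp [hm]
    | insert j J hj ih =>
      refine le_trans ?_ ih
      set H : (ι → ℤˣ) → ℝ := fun σ => ⨆ g, ∑ i, sgn (σ i) * m (insert j J) i g with hH
      set H' : (ι → ℤˣ) → ℝ := fun σ => ⨆ g, ∑ i, sgn (σ i) * m J i g with hH'
      have hpair : ∀ σ, H σ + H (Function.update σ j (-σ j)) ≤
          H' σ + H' (Function.update σ j (-σ j)) := by
        intro σ
        set a : γ → ℝ := fun g => ∑ i ∈ Finset.univ.erase j, sgn (σ i) * m J i g with ha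
        have haC : ∀ g, |a g| ≤ ∑ i ∈ Finset.univ.erase j, C := fun g =>
          (Finset.abs_sum_le_sum_abs _ _).trans (Finset.sum_le_sum fun i _ => by
            rw [abs_mul, abs_sgn, one_mul]; exact hmC _ _ _)
        have hsplit : ∀ (τ : ι → ℤˣ) (J' : Finset ι), (∀ i, i ≠ j → τ i = σ i) →
            (∀ i, i ≠ j → (i ∈ J' ↔ i ∈ J)) → ∀ g,
            ∑ i, sgn (τ i) * m J' i g = a g + sgn (τ j) * m J' j g := by
          intro τ J' hτ hJ' g
          rw [← Finset.sum_erase_add _ _ (Finset.mem_univ j)]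
          congr 1
          refine Finset.sum_congr rfl fun i hi => ?_
          have hij := Finset.ne_of_mem_erase hi
          rw [hτ i hij]
          simp only [hm, hJ' i hij]
        have hfl : ∀ i, i ≠ j → Function.update σ j (-σ j) i = σ i := fun i hi => by simp [hi]
        have hins : ∀ i, i ≠ j → (i ∈ insert j J ↔ i ∈ J) := fun i hi => by
          simp [Finset.mem_insert, hi]
        have e1 : H σ = ⨆ g, (a g + sgn (σ j) * v j g) :=
          iSup_congr fun g => by
            rw [hsplit σ (insert j J) (fun _ _ => rfl) hins g]; simp [hm]
        have e2 : H (Function.update σ j (-σ j)) = ⨆ g, (a g - sgn (σ j) * v j g) :=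
          iSup_congr fun g => by
            rw [hsplit _ (insert j J) hfl hins g]; simp [hm]; ring
        have e3 : H' σ = ⨆ g, (a g + L * (sgn (σ j) * t j g)) :=
          iSup_congr fun g => by
            rw [hsplit σ J (fun _ _ => rfl) (fun _ _ => Iff.rfl) g]; simp [hm, hj]; ring
        have e4 : H' (Function.update σ j (-σ j)) = ⨆ g, (a g - L * (sgn (σ j) * t j g)) :=
          iSup_congr fun g => by
            rw [hsplit _ J hfl (fun _ _ => Iff.rfl) g]; simp [hm, hj]; ring
        rw [e1, e2, e3, e4]
        refine iSup_add_iSup_sub_le (C := max (∑ i ∈ Finset.univ.erase j, C) C)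
          (fun g => (haC g).trans (le_max_left _ _)) (fun g => ?_) fun g g' => ?_
        · rw [mul_left_comm, abs_mul, abs_sgn, one_mul]
          exact (htC j g).trans (le_max_right _ _)
        · rw [← mul_sub, ← mul_sub, abs_mul, abs_mul, abs_sgn, one_mul, one_mul]
          exact hv j g g'
      have h1 := Finset.sum_le_sum fun σ (_ : σ ∈ Finset.univ) => hpair σ
      rw [Finset.sum_add_distrib, Finset.sum_add_distrib, sum_flip_eq j H, sum_flip_eq j H'] at h1
      linarith
  have := key Finset.univ
  simpa [hm] using this

end Contraction

/-! ### Suprema over the class, symmetrization, oscillation at a point -/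

section Suprema

variable {X : Type*} [MeasurableSpace X]

/-- The supremum over the class of a weighted sum of transformed values at sample points. -/
noncomputable def supSum {ι : Type*} [Fintype ι] (G : Set (X → ℝ)) (f : ℝ → ℝ) (c : ι → ℝ)
    (x : ι → X) : ℝ :=
  ⨆ g : G, ∑ i, c i * f (g.1 (x i))

/-- A uniformly bounded class with measurable suprema, and a bounded Lipschitz transformation. -/
structure LipClass (G : Set (X → ℝ)) (f : ℝ → ℝ) (L : ℝ) : Prop where
  nonempty : G.Nonempty
  meas : ∀ g ∈ G, Measurable g
  sup : MeasurableSuprema G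
  bdd : ∃ C, ∀ g ∈ G, ∀ x, |g x| ≤ C
  bdd' : ∃ C, ∀ z, |f z| ≤ C
  lip_nonneg : 0 ≤ L
  lip : ∀ z z', |f z - f z'| ≤ L * |z - z'|

lemma MeasurableSuprema.measurable_iSup {G : Set (X → ℝ)} (hG : MeasurableSuprema G)
    {ι Ω : Type*} [Fintype ι] [MeasurableSpace Ω] {φ : ι → ℝ → ℝ} (hφ : ∀ i, Continuous (φ i))
    {ξ : ι → Ω → X} (hξ : ∀ i, Measurable (ξ i)) :
    Measurable fun ω => ⨆ g : G, ∑ i, φ i (g.1 (ξ i ω)) := by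
  have h := hG (Fintype.card ι) (fun k => φ ((Fintype.equivFin ι).symm k)) fun _ => hφ _
  have hm : Measurable fun ω (k : Fin (Fintype.card ι)) => ξ ((Fintype.equivFin ι).symm k) ω :=
    measurable_pi_lambda _ fun k => hξ _
  refine (congrArg Measurable (funext fun ω => iSup_congr fun g => ?_)).mp (h.comp hm)
  exact Equiv.sum_comp (Fintype.equivFin ι).symm fun i => φ i (g.1 (ξ i ω))

lemma abs_iSup_le {γ : Type*} [Nonempty γ] {a : γ → ℝ} {C : ℝ} (h : ∀ g, |a g| ≤ C) :
    |⨆ g, a g| ≤ C := by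
  refine abs_le.2 ⟨?_, ciSup_le fun g => (abs_le.1 (h g)).2⟩
  obtain ⟨g⟩ := ‹Nonempty γ›
  exact (abs_le.1 (h g)).1.trans (le_ciSup (bddAbove_range_of_abs_le h) g)

namespace LipClass

variable {G : Set (X → ℝ)} {f : ℝ → ℝ} {L : ℝ} {ι : Type*} [Fintype ι]

lemma continuous (h : LipClass G f L) : Continuous f :=
  (LipschitzWith.of_dist_le_mul (K := ⟨L, h.lip_nonneg⟩) fun z z' => by
    rw [Real.dist_eq, Real.dist_eq]; exact h.lip z z').continuous

lemma nonempty_coe (h : LipClass G f L) : Nonempty G := h.nonempty.to_subtype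

lemma exists_bound (h : LipClass G f L) (c : ι → ℝ) :
    ∃ C, ∀ (x : ι → X) (g : G), |∑ i, c i * f (g.1 (x i))| ≤ C := by
  obtain ⟨C, hC⟩ := h.bdd'
  refine ⟨∑ i, |c i| * C, fun x g => (Finset.abs_sum_le_sum_abs _ _).trans
    (Finset.sum_le_sum fun i _ => ?_)⟩
  rw [abs_mul]
  exact mul_le_mul_of_nonneg_left (hC _) (abs_nonneg _)

lemma le_supSum (h : LipClass G f L) (c : ι → ℝ) (x : ι → X) {g : X → ℝ} (hg : g ∈ G) :
    ∑ i, c i * f (g (x i)) ≤ supSum G f c x := by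
  obtain ⟨C, hC⟩ := h.exists_bound c
  exact le_ciSup (bddAbove_range_of_abs_le (hC x)) (⟨g, hg⟩ : G)

lemma supSum_le (h : LipClass G f L) {c : ι → ℝ} {x : ι → X} {B : ℝ}
    (hB : ∀ g ∈ G, ∑ i, c i * f (g (x i)) ≤ B) : supSum G f c x ≤ B := by
  have := h.nonempty_coe
  exact ciSup_le fun g => hB g.1 g.2

lemma bddMeas_supSum (h : LipClass G f L) (c : ι → ℝ) {Ω : Type*} [MeasurableSpace Ω]
    {ξ : ι → Ω → X} (hξ : ∀ i, Measurable (ξ i)) :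
    BddMeas fun ω => supSum G f c fun i => ξ i ω := by
  have := h.nonempty_coe
  obtain ⟨C, hC⟩ := h.exists_bound c
  exact ⟨h.sup.measurable_iSup (fun i => continuous_const.mul h.continuous) hξ, C, fun ω =>
    abs_iSup_le (hC _)⟩

lemma bddMeas_supSum_id (h : LipClass G f L) (c : ι → ℝ) {Ω : Type*} [MeasurableSpace Ω]
    {ξ : ι → Ω → X} (hξ : ∀ i, Measurable (ξ i)) :
    BddMeas fun ω => supSum G id c fun i => ξ i ω := by
  have := h.nonempty_coe
  obtain ⟨C, hC⟩ := h.bdd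
  refine ⟨h.sup.measurable_iSup (fun i => continuous_const.mul continuous_id) hξ,
    ∑ i, |c i| * C, fun ω => abs_iSup_le fun g => (Finset.abs_sum_le_sum_abs _ _).trans
    (Finset.sum_le_sum fun i _ => ?_)⟩
  rw [abs_mul]
  exact mul_le_mul_of_nonneg_left (hC _ g.2 _) (abs_nonneg _)

lemma sum_supSum_sign_le (h : LipClass G f L) [DecidableEq ι] (x : ι → X) :
    ∑ σ : ι → ℤˣ, supSum G f (fun i => sgn (σ i)) x ≤
      L * ∑ σ : ι → ℤˣ, supSum G id (fun i => sgn (σ i)) x := by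
  have := h.nonempty_coe
  obtain ⟨C, hC⟩ := h.bdd
  obtain ⟨C', hC'⟩ := h.bdd'
  have key := sum_iSup_sign_le (γ := G) (v := fun i g => f (g.1 (x i))) (t := fun i g => g.1 (x i))
    (L := L) (C := max C' (L * C)) (fun i g => (hC' _).trans (le_max_left _ _))
    (fun i g => by
      rw [abs_mul, abs_of_nonneg h.lip_nonneg]
      exact (mul_le_mul_of_nonneg_left (hC _ g.2 _) h.lip_nonneg).trans (le_max_right _ _))
    fun i g g' => h.lip _ _
  refine key.trans (le_of_eq ?_)
  rw [Finset.mul_sum]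
  refine Finset.sum_congr rfl fun σ _ => ?_
  rw [supSum, Real.mul_iSup_of_nonneg h.lip_nonneg]
  refine iSup_congr fun g => ?_
  rw [Finset.mul_sum]
  exact Finset.sum_congr rfl fun i _ => by simp only [id]; ring

lemma integral_sum_supSum_sign (n : ℕ) (μ : Measure X) :
    ∫ z, (1 / 2 ^ n : ℝ) * ∑ σ : Fin n → ℤˣ, supSum G id (fun i => sgn (σ i)) z
      ∂(Measure.pi fun _ : Fin n => μ) = n * rademacher G μ n := by
  rcases Nat.eq_zero_or_pos n with rfl | hn
  · simp [supSum]
  have hn0 : (n : ℝ) ≠ 0 := by exact_mod_cast hn.ne'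
  unfold rademacher
  rw [← integral_const_mul]
  refine integral_congr_ae (.of_forall fun z => ?_)
  simp only
  rw [mul_left_comm]
  congr 1
  rw [Finset.mul_sum]
  refine Finset.sum_congr rfl fun σ _ => ?_
  rw [supSum, Real.mul_iSup_of_nonneg (Nat.cast_nonneg n)]
  refine iSup_congr fun g => ?_
  rw [← mul_assoc, mul_one_div_cancel hn0, one_mul]
  rfl

/-- **Symmetrization**, combined with the contraction principle. -/
lemma integral_supSum_symm_le (h : LipClass G f L) (n : ℕ) (μ : Measure X)
    [IsProbabilityMeasure μ] :
    ∫ w, supSum G f (Sum.elim (fun _ : Fin n => 1) fun _ : Fin n => -1) w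
      ∂(Measure.pi fun _ : Fin n ⊕ Fin n => μ) ≤ 2 * L * (n * rademacher G μ n) := by
  set ρ := Measure.pi fun _ : Fin n ⊕ Fin n => μ with hρ
  set c : Fin n ⊕ Fin n → ℝ := Sum.elim (fun _ => 1) fun _ => -1 with hc
  have hb : ∀ c' : Fin n ⊕ Fin n → ℝ, BddMeas (supSum G f c') := fun c' =>
    h.bddMeas_supSum c' fun i => measurable_pi_apply i
  have hb' : ∀ c' : Fin n → ℝ, BddMeas (supSum G f c') := fun c' =>
    h.bddMeas_supSum c' fun i => measurable_pi_apply i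
  have hbid : ∀ c' : Fin n → ℝ, BddMeas (supSum G id c') := fun c' =>
    h.bddMeas_supSum_id c' fun i => measurable_pi_apply i
  -- Exchanging the i-th points of the two independent halves wherever σ is −1 preserves the law and
  -- flips the corresponding signs.
  have hswap : ∀ σ : Fin n → ℤˣ, ∫ w, supSum G f c w ∂ρ =
      ∫ w, supSum G f (Sum.elim (fun i => sgn (σ i)) fun i => -sgn (σ i)) w ∂ρ := by
    intro σ
    set e : Fin n ⊕ Fin n → Fin n ⊕ Fin n :=
      Sum.elim (fun i => if σ i = 1 then Sum.inl i else Sum.inr i)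
        (fun i => if σ i = 1 then Sum.inr i else Sum.inl i) with he
    have hinv : Function.Involutive e := by
      rintro (i | i) <;> by_cases hi : σ i = 1 <;> simp [he, hi]
    have hint := integral_pi_comp_injective (fun _ : Fin n ⊕ Fin n => μ) hinv.injective (hb c).1
    rw [← hint]
    refine integral_congr_ae (.of_forall fun w => iSup_congr fun g => ?_)
    rw [← Equiv.sum_comp hinv.toPerm]
    refine Finset.sum_congr rfl fun i _ => ?_
    simp only [Function.Involutive.coe_toPerm]
    rw [hinv i]
    congr 1
    rcases i with i | i <;> rcases Int.units_eq_one_or (σ i) with hi | hi <;> simp [he, hc, hi]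
  set R : (Fin n → ℤˣ) → ℝ := fun σ => ∫ z, supSum G f (fun i => sgn (σ i)) z
    ∂(Measure.pi fun _ : Fin n => μ) with hR
  have hle : ∀ σ : Fin n → ℤˣ, ∫ w, supSum G f c w ∂ρ ≤ R σ + R (-σ) := by
    intro σ
    have hl := integral_pi_comp_injective (fun _ : Fin n ⊕ Fin n => μ)
      (e := Sum.inl) Sum.inl_injective (hb' fun i => sgn (σ i)).1
    have hr := integral_pi_comp_injective (fun _ : Fin n ⊕ Fin n => μ)
      (e := Sum.inr) Sum.inr_injective (hb' fun i => sgn ((-σ) i)).1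
    have i1 : BddMeas fun w : Fin n ⊕ Fin n → X =>
        supSum G f (fun i => sgn (σ i)) fun k => w (Sum.inl k) :=
      h.bddMeas_supSum _ fun i => measurable_pi_apply _
    have i2 : BddMeas fun w : Fin n ⊕ Fin n → X =>
        supSum G f (fun i => sgn ((-σ) i)) fun k => w (Sum.inr k) :=
      h.bddMeas_supSum _ fun i => measurable_pi_apply _
    rw [hswap σ, hR]
    simp only
    rw [← hl, ← hr, ← integral_add (i1.integrable _) (i2.integrable _)]
    refine integral_mono ((hb _).integrable _) ((i1.add i2).integrable _) fun w => ?_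
    refine h.supSum_le fun g hg => ?_
    rw [Fintype.sum_sum_type]
    refine add_le_add (h.le_supSum (fun i => sgn (σ i)) (fun k => w (Sum.inl k)) hg) ?_
    refine le_trans (le_of_eq ?_)
      (h.le_supSum (fun i => sgn ((-σ) i)) (fun k => w (Sum.inr k)) hg)
    refine Finset.sum_congr rfl fun i _ => ?_
    simp
  have hneg : ∑ σ, R (-σ) = ∑ σ, R σ := Equiv.sum_comp (Equiv.neg _) R
  have hsum := Finset.sum_le_sum fun σ (_ : σ ∈ Finset.univ) => hle σ
  rw [Finset.sum_add_distrib, hneg, Finset.sum_const, Finset.card_univ] at hsum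
  have hcard : Fintype.card (Fin n → ℤˣ) = 2 ^ n := by simp
  rw [hcard, nsmul_eq_mul] at hsum
  have hRle : ∑ σ, R σ ≤ L * (2 ^ n * (n * rademacher G μ n)) := by
    rw [← integral_sum_supSum_sign, ← integral_const_mul, ← integral_const_mul, hR]
    simp only
    rw [← integral_finsetSum _ fun σ _ => (hb' _).integrable _]
    refine integral_mono (integrable_finsetSum _ fun σ _ => (hb' _).integrable _) ?_ fun z => ?_
    · exact ((((BddMeas.sum _ fun σ _ => hbid _).const_mul _).const_mul _).const_mul _).integrable _
    · refine (h.sum_supSum_sign_le z).trans (le_of_eq ?_)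
      have : (2 : ℝ) ^ n ≠ 0 := by positivity
      field_simp
  push_cast at hsum
  have h2 : (0 : ℝ) < 2 ^ n := by positivity
  refine le_of_mul_le_mul_left (hsum.trans ?_) h2
  linarith

/-- The mean oscillation of the class at a point is controlled by the Rademacher complexity for
samples of size one. -/
lemma integral_osc_eq (μ : Measure X) [IsProbabilityMeasure μ]
    (h : LipClass G f L) :
    ∫ x, (supSum G id (fun _ : Unit => 1) (fun _ => x) +
      supSum G id (fun _ : Unit => -1) fun _ => x) ∂μ = 2 * rademacher G μ 1 := by
  have h1 := integral_sum_supSum_sign (G := G) 1 μ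
  rw [Nat.cast_one, one_mul] at h1
  rw [← h1, ← integral_const_mul]
  have hb : ∀ c : ℝ, BddMeas fun x : X => supSum G id (fun _ : Unit => c) fun _ => x := fun c =>
    h.bddMeas_supSum_id _ fun _ => measurable_id
  have hmp := measurePreserving_funUnique (β := X) μ (Fin 1)
  rw [← hmp.integral_comp' (g := fun x => supSum G id (fun _ : Unit => 1) (fun _ => x) +
      supSum G id (fun _ : Unit => -1) fun _ => x)]
  refine integral_congr_ae (.of_forall fun z => ?_)
  have hz : (MeasurableEquiv.funUnique (Fin 1) X) z = z 0 := rfl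
  have hsum : ∀ F : (Fin 1 → ℤˣ) → ℝ, ∑ σ, F σ = F (fun _ => 1) + F fun _ => -1 := by
    intro F
    rw [← Equiv.sum_comp (Equiv.funUnique (Fin 1) ℤˣ).symm F]
    rw [show (Finset.univ : Finset ℤˣ) = {1, -1} from rfl, Finset.sum_pair (by decide)]
    rfl
  simp only [hz, hsum, supSum]
  simp

end LipClass

end Suprema

/-! ### Comparison with ghost samples for fixed labels -/

section FixedLabels

variable {X : Type*} {G : Set (X → ℝ)} {f : ℝ → ℝ} {L : ℝ}

lemma supSum_comp_equiv {ι κ : Type*} [Fintype ι] [Fintype κ] (ε : κ ≃ ι) (c : ι → ℝ) (x : ι → X) :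
    supSum G f (fun k => c (ε k)) (fun k => x (ε k)) = supSum G f c x :=
  iSup_congr fun g => Equiv.sum_comp ε fun i => c i * f (g.1 (x i))

variable [MeasurableSpace X]

lemma natCast_mul_rademacher_le {μ : Measure X} {CG : ℝ}
    (hR : ∀ n : ℕ, 1 ≤ n → rademacher G μ n ≤ CG / √n) (n : ℕ) :
    n * rademacher G μ n ≤ CG * √n := by
  rcases Nat.eq_zero_or_pos n with rfl | hn
  · simp
  have h0 : (0 : ℝ) < n := by exact_mod_cast hn
  refine (mul_le_mul_of_nonneg_left (hR n hn) h0.le).trans (le_of_eq ?_)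
  rw [← mul_div_assoc, div_eq_iff (Real.sqrt_pos.2 h0).ne', mul_assoc, Real.mul_self_sqrt h0.le,
    mul_comm]

/-- The symmetrization bound for a part of a sample with independent points. -/
lemma LipClass.integral_supSum_comp_le (h : LipClass G f L) {ι κ : Type*} [Fintype ι] [Fintype κ]
    (ρ : ι → Measure X) [∀ i, IsProbabilityMeasure (ρ i)] (μ : Measure X) [IsProbabilityMeasure μ]
    {CG : ℝ} (hR : ∀ n : ℕ, 1 ≤ n → rademacher G μ n ≤ CG / √n) {e : κ ⊕ κ → ι}
    (he : Function.Injective e) (hρ : ∀ k, ρ (e k) = μ) :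
    ∫ w, supSum G f (Sum.elim (fun _ : κ => 1) fun _ : κ => -1) (fun k => w (e k))
      ∂(Measure.pi ρ) ≤ 2 * L * (CG * √(Fintype.card κ)) := by
  set N := Fintype.card κ with hN
  set ε : Fin N ≃ κ := (Fintype.equivFin κ).symm with hε
  set ε' : Fin N ⊕ Fin N ≃ κ ⊕ κ := Equiv.sumCongr ε ε with hε'
  have hc : (Sum.elim (fun _ : Fin N => (1 : ℝ)) fun _ : Fin N => -1) =
      fun k => (Sum.elim (fun _ : κ => (1 : ℝ)) fun _ : κ => -1) (ε' k) := by
    funext k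
    rcases k with k | k <;> rfl
  have h1 := h.integral_supSum_symm_le N μ
  have hb : BddMeas (supSum G f (Sum.elim (fun _ : Fin N => (1 : ℝ)) fun _ : Fin N => -1)) :=
    h.bddMeas_supSum _ fun i => measurable_pi_apply i
  have h2 := integral_pi_comp_injective ρ (he.comp ε'.injective) hb.1
  simp only [Function.comp, hρ] at h2
  rw [← h2] at h1
  have h3 : ∀ w : ι → X, supSum G f (Sum.elim (fun _ : Fin N => (1 : ℝ)) fun _ : Fin N => -1)
      (fun k => w (e (ε' k))) =
      supSum G f (Sum.elim (fun _ : κ => 1) fun _ : κ => -1) (fun k => w (e k)) := by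
    intro w
    rw [hc]
    exact supSum_comp_equiv ε' _ fun k => w (e k)
  simp only [h3] at h1
  refine h1.trans (mul_le_mul_of_nonneg_left (natCast_mul_rademacher_le hR N) ?_)
  have := h.lip_nonneg
  positivity

/-- The mean oscillations of the difference between negative and positive samples. -/
lemma LipClass.integral_supSum_diff_le (h : LipClass G f L) {I : Type*} [Fintype I]
    (pP pN : Measure X) [IsProbabilityMeasure pP] [IsProbabilityMeasure pN] {CG : ℝ}
    (hP : rademacher G pP 1 ≤ CG) (hN : rademacher G pN 1 ≤ CG) :
    ∫ v, supSum G f (Sum.elim (fun _ : I => 1) fun _ : I => -1) v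
        ∂(Measure.pi (Sum.elim (fun _ => pN) fun _ => pP)) +
      ∫ v, supSum G f (Sum.elim (fun _ : I => -1) fun _ : I => 1) v
        ∂(Measure.pi (Sum.elim (fun _ => pN) fun _ => pP)) ≤ Fintype.card I * (4 * L * CG) := by
  set τ : I ⊕ I → Measure X := Sum.elim (fun _ => pN) fun _ => pP with hτ
  have hτp : ∀ i, IsProbabilityMeasure (τ i) := by
    rintro (i | i)
    exacts [‹IsProbabilityMeasure pN›, ‹IsProbabilityMeasure pP›]
  set W : X → ℝ := fun x => supSum G id (fun _ : Unit => 1) (fun _ => x) +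
      supSum G id (fun _ : Unit => -1) fun _ => x with hW
  have hWb : BddMeas W := (h.bddMeas_supSum_id _ fun _ => measurable_id).add
    (h.bddMeas_supSum_id _ fun _ => measurable_id)
  have hWint : ∀ i, ∫ x, W x ∂(τ i) ≤ 2 * CG := by
    have hr : ∀ i, rademacher G (τ i) 1 ≤ CG := by rintro (i | i) <;> simpa [hτ]
    intro i
    rw [h.integral_osc_eq (μ := τ i)]
    linarith [hr i]
  -- W is the oscillation of the class at a point. Its mean is twice the complexity for samples of
  -- size one, whatever the class law of the point.
  have hosc : ∀ x, ∀ g ∈ G, ∀ g' ∈ G, |g x - g' x| ≤ W x := by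
    obtain ⟨C, hC⟩ := h.bdd
    have h1 : ∀ x, ∀ g ∈ G, ∀ g' ∈ G, g x - g' x ≤ W x := by
      intro x g hg g' hg'
      have b1 : BddAbove (Set.range fun g : G => ∑ _ : Unit, (1 : ℝ) * id (g.1 x)) :=
        bddAbove_range_of_abs_le (C := C) fun g => by simpa using hC g g.2 x
      have b2 : BddAbove (Set.range fun g : G => ∑ _ : Unit, (-1 : ℝ) * id (g.1 x)) :=
        bddAbove_range_of_abs_le (C := C) fun g => by simpa using hC g g.2 x
      have e1 := le_ciSup b1 ⟨g, hg⟩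
      have e2 := le_ciSup b2 ⟨g', hg'⟩
      simp only [Finset.univ_unique, Finset.sum_const, Finset.card_singleton, one_smul, id,
        one_mul, neg_mul] at e1 e2
      have e3 : W x = (⨆ g : G, g.1 x) + ⨆ g : G, -g.1 x := by simp [hW, supSum]
      rw [e3]
      linarith
    exact fun x g hg g' hg' => abs_le.2 ⟨by linarith [h1 x g' hg' g hg], h1 x g hg g' hg'⟩
  have hb : ∀ c : I ⊕ I → ℝ, BddMeas (supSum G f c) := fun c =>
    h.bddMeas_supSum _ fun i => measurable_pi_apply i
  have hWi : ∀ i : I ⊕ I, BddMeas fun v : I ⊕ I → X => L * W (v i) := fun i =>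
    (hWb.comp (measurable_pi_apply i)).const_mul L
  rw [← integral_add ((hb _).integrable _) ((hb _).integrable _)]
  -- For any two competitors the coefficients at each point are opposite, so only increments of f ∘
  -- g remain. The resulting bound is linear in the sample size, with no cancellation used.
  have hpt : ∀ v, supSum G f (Sum.elim (fun _ : I => 1) fun _ : I => -1) v +
      supSum G f (Sum.elim (fun _ : I => -1) fun _ : I => 1) v ≤ ∑ i, L * W (v i) := by
    intro v
    rw [← le_sub_iff_add_le]
    refine h.supSum_le fun g hg => ?_
    rw [le_sub_iff_add_le, ← le_sub_iff_add_le']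
    refine h.supSum_le fun g' hg' => ?_
    rw [le_sub_iff_add_le', ← Finset.sum_add_distrib]
    refine Finset.sum_le_sum fun i _ => ?_
    have hl := (h.lip (g (v i)) (g' (v i))).trans
      (mul_le_mul_of_nonneg_left (hosc (v i) g hg g' hg') h.lip_nonneg)
    rcases i with i | i
    · simp only [Sum.elim_inl]
      linarith [le_of_abs_le hl]
    · simp only [Sum.elim_inr]
      linarith [neg_le_of_abs_le hl]
  refine (integral_mono (((hb _).add (hb _)).integrable _)
    (integrable_finsetSum _ fun i _ => (hWi i).integrable _) hpt).trans ?_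
  rw [integral_finsetSum _ fun i _ => (hWi i).integrable _]
  refine (Finset.sum_le_sum (g := fun _ => 2 * L * CG) fun i _ => ?_).trans (le_of_eq ?_)
  · rw [integral_const_mul]
    have hev := measurePreserving_eval τ i
    have : ∫ v, W (v i) ∂(Measure.pi τ) = ∫ x, W x ∂(τ i) := by
      rw [← hev.map_eq, integral_map hev.measurable.aemeasurable hWb.1.aestronglyMeasurable]
    rw [this]
    have := mul_le_mul_of_nonneg_left (hWint i) h.lip_nonneg
    linarith
  · rw [Finset.sum_const, Finset.card_univ, Fintype.card_sum, nsmul_eq_mul]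
    push_cast
    ring

/-- Each index lies in equally many translates of S. Averaging over translates lets a comparison
that uses only |S| ghosts at a time involve all of them with equal weight. -/
lemma sum_sum_shift {I : Type*} [Fintype I] [AddCommGroup I] (S : Finset I) (u : I → ℝ) :
    ∑ r, ∑ i ∈ S, u (i + r) = S.card * ∑ k, u k := by
  rw [Finset.sum_comm]
  have : ∀ i ∈ S, ∑ r, u (i + r) = ∑ k, u k := fun i _ => Equiv.sum_comp (Equiv.addLeft i) u
  rw [Finset.sum_congr rfl this, Finset.sum_const, nsmul_eq_mul]

variable {I : Type*} [Fintype I] [AddCommGroup I] [DecidableEq I]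

/-- The laws of a sample with set `S` of negative positions, and of two ghost samples of negative
and of positive points. -/
def ghostLaw (pP pN : Measure X) (S : Finset I) : I ⊕ (I ⊕ I) → Measure X :=
  Sum.elim (labelLaw pP pN S) (Sum.elim (fun _ => pN) fun _ => pP)

instance (pP pN : Measure X) [IsProbabilityMeasure pP] [IsProbabilityMeasure pN] (S : Finset I)
    (i : I ⊕ (I ⊕ I)) : IsProbabilityMeasure (ghostLaw pP pN S i) := by
  rcases i with i | i | i <;> simp only [ghostLaw, Sum.elim_inl, Sum.elim_inr] <;> infer_instance

/-- The weights of the sample and of the two ghost samples. -/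
def ghostCoef (I : Type*) (a b : ℝ) : I ⊕ (I ⊕ I) → ℝ :=
  Sum.elim (fun _ => -1) (Sum.elim (fun _ => b) fun _ => a)

/-- The expected deviation from the ghost samples given the labels. -/
lemma LipClass.integral_ghost_le (h : LipClass G f L) (pP pN : Measure X) [IsProbabilityMeasure pP]
    [IsProbabilityMeasure pN] {CG : ℝ}
    (hP : ∀ n : ℕ, 1 ≤ n → rademacher G pP n ≤ CG / √n)
    (hN : ∀ n : ℕ, 1 ≤ n → rademacher G pN n ≤ CG / √n) {a b : ℝ} (hab : a + b = 1)
    (S : Finset I) :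
    ∫ w, supSum G f (ghostCoef I a b) w ∂(Measure.pi (ghostLaw pP pN S)) ≤
      2 * L * CG * (√(S.card) + √(Sᶜ.card)) +
      (max (b - S.card / Fintype.card I) 0 *
          ∫ v, supSum G f (Sum.elim (fun _ : I => 1) fun _ : I => -1) v
            ∂(Measure.pi (Sum.elim (fun _ => pN) fun _ => pP)) +
        max (S.card / Fintype.card I - b) 0 *
          ∫ v, supSum G f (Sum.elim (fun _ : I => -1) fun _ : I => 1) v
            ∂(Measure.pi (Sum.elim (fun _ => pN) fun _ => pP))) := by
  set T : ℝ := (Fintype.card I : ℝ) with hT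
  have hT0 : 0 < T := by
    rw [hT]
    exact_mod_cast Fintype.card_pos_iff.2 ⟨(0 : I)⟩
  set ρ := Measure.pi (ghostLaw pP pN S) with hρ
  -- For a shift r the negative points of the sample are paired with the negative ghosts at S + r;
  -- these points are distinct coordinates with common law pN, so symmetrization applies.
  set eN : I → {i // i ∈ S} ⊕ {i // i ∈ S} → I ⊕ (I ⊕ I) := fun r =>
    Sum.elim (fun k => Sum.inr (Sum.inl (k.1 + r))) fun k => Sum.inl k.1 with heN
  set eP : I → {i // i ∈ Sᶜ} ⊕ {i // i ∈ Sᶜ} → I ⊕ (I ⊕ I) := fun r =>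
    Sum.elim (fun k => Sum.inr (Sum.inr (k.1 + r))) fun k => Sum.inl k.1 with heP
  have injN : ∀ r, Function.Injective (eN r) := by
    rintro r (⟨i, hi⟩ | ⟨i, hi⟩) (⟨j, hj⟩ | ⟨j, hj⟩) hij <;> simp_all
  have injP : ∀ r, Function.Injective (eP r) := by
    rintro r (⟨i, hi⟩ | ⟨i, hi⟩) (⟨j, hj⟩ | ⟨j, hj⟩) hij <;> simp_all
  have lawN : ∀ r k, ghostLaw pP pN S (eN r k) = pN := by
    rintro r (⟨i, hi⟩ | ⟨i, hi⟩) <;> simp [heN, ghostLaw, labelLaw, hi]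
  have lawP : ∀ r k, ghostLaw pP pN S (eP r k) = pP := by
    rintro r (⟨i, hi⟩ | ⟨i, hi⟩)
    · simp [heP, ghostLaw]
    · simp [heP, ghostLaw, labelLaw, Finset.mem_compl.1 hi]
  set U : I → (I ⊕ (I ⊕ I) → X) → ℝ := fun r w =>
    supSum G f (Sum.elim (fun _ : {i // i ∈ S} => 1) fun _ : {i // i ∈ S} => -1)
      (fun k => w (eN r k)) with hU
  set V : I → (I ⊕ (I ⊕ I) → X) → ℝ := fun r w =>
    supSum G f (Sum.elim (fun _ : {i // i ∈ Sᶜ} => 1) fun _ : {i // i ∈ Sᶜ} => -1)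
      (fun k => w (eP r k)) with hV
  set D₁ : (I ⊕ I → X) → ℝ := supSum G f (Sum.elim (fun _ : I => 1) fun _ : I => -1) with hD₁
  set D₂ : (I ⊕ I → X) → ℝ := supSum G f (Sum.elim (fun _ : I => -1) fun _ : I => 1) with hD₂
  have bU : ∀ r, BddMeas (U r) := fun r => h.bddMeas_supSum _ fun i => measurable_pi_apply _
  have bV : ∀ r, BddMeas (V r) := fun r => h.bddMeas_supSum _ fun i => measurable_pi_apply _
  have bD₁ : BddMeas D₁ := h.bddMeas_supSum _ fun i => measurable_pi_apply _
  have bD₂ : BddMeas D₂ := h.bddMeas_supSum _ fun i => measurable_pi_apply _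
  have hinr : Measurable fun (w : I ⊕ (I ⊕ I) → X) k => w (Sum.inr k) :=
    measurable_pi_lambda _ fun k => measurable_pi_apply _
  -- The mismatch between the prescribed weight b and the actual proportion of negative labels.
  -- Since a + b = 1, the positive weights are off by −δ.
  set δ := b - S.card / T with hδ
  have hδ' : S.card / T - b = -δ := by rw [hδ]; ring
  rw [hδ']
  have hpt : ∀ w, supSum G f (ghostCoef I a b) w ≤ (1 / T * ∑ r, U r w + 1 / T * ∑ r, V r w) +
      (max δ 0 * D₁ (fun k => w (Sum.inr k)) + max (-δ) 0 * D₂ (fun k => w (Sum.inr k))) := by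
    intro w
    refine h.supSum_le fun g hg => ?_
    set z : I → ℝ := fun i => f (g (w (Sum.inl i))) with hz
    set x : I → ℝ := fun i => f (g (w (Sum.inr (Sum.inl i)))) with hx
    set y : I → ℝ := fun i => f (g (w (Sum.inr (Sum.inr i)))) with hy
    have eU : ∀ r, ∑ i ∈ S, x (i + r) - ∑ i ∈ S, z i ≤ U r w := by
      intro r
      refine (le_of_eq ?_).trans (h.le_supSum _ _ hg)
      rw [Fintype.sum_sum_type]
      simp only [Sum.elim_inl, Sum.elim_inr, one_mul, neg_mul, heN, Finset.sum_neg_distrib]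
      rw [← sub_eq_add_neg, Finset.sum_coe_sort S fun i => x (i + r), Finset.sum_coe_sort S z]
    have eV : ∀ r, ∑ i ∈ Sᶜ, y (i + r) - ∑ i ∈ Sᶜ, z i ≤ V r w := by
      intro r
      refine (le_of_eq ?_).trans (h.le_supSum _ _ hg)
      rw [Fintype.sum_sum_type]
      simp only [Sum.elim_inl, Sum.elim_inr, one_mul, neg_mul, heP, Finset.sum_neg_distrib]
      rw [← sub_eq_add_neg, Finset.sum_coe_sort Sᶜ fun i => y (i + r), Finset.sum_coe_sort Sᶜ z]
    have e1 : ∑ k, x k - ∑ k, y k ≤ D₁ fun k => w (Sum.inr k) := by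
      refine (le_of_eq ?_).trans (h.le_supSum _ _ hg)
      rw [Fintype.sum_sum_type]
      simp only [Sum.elim_inl, Sum.elim_inr, one_mul, neg_mul, Finset.sum_neg_distrib]
      rw [sub_eq_add_neg]
    have e2 : -(∑ k, x k - ∑ k, y k) ≤ D₂ fun k => w (Sum.inr k) := by
      refine (le_of_eq ?_).trans (h.le_supSum _ _ hg)
      rw [Fintype.sum_sum_type]
      simp only [Sum.elim_inl, Sum.elim_inr, one_mul, neg_mul, Finset.sum_neg_distrib]
      ring
    have sU := Finset.sum_le_sum fun r (_ : r ∈ Finset.univ) => eU r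
    have sV := Finset.sum_le_sum fun r (_ : r ∈ Finset.univ) => eV r
    rw [Finset.sum_sub_distrib, sum_sum_shift, Finset.sum_const, Finset.card_univ, nsmul_eq_mul,
      ← hT] at sU sV
    have hcard : (Sᶜ.card : ℝ) = T - S.card := by
      rw [Finset.card_compl, Nat.cast_sub (Finset.card_le_univ S)]
    rw [hcard] at sV
    have hzz : ∑ i, z i = ∑ i ∈ S, z i + ∑ i ∈ Sᶜ, z i := (Finset.sum_add_sum_compl S z).symm
    have hlhs : ∑ i, ghostCoef I a b i * f (g (w i)) =
        -∑ i, z i + (b * ∑ k, x k + a * ∑ k, y k) := by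
      rw [Fintype.sum_sum_type, Fintype.sum_sum_type]
      simp only [ghostCoef, Sum.elim_inl, Sum.elim_inr, neg_mul, one_mul, Finset.sum_neg_distrib,
        Finset.mul_sum]
      rfl
    rw [hlhs, hzz]
    have hmax : δ * (∑ k, x k - ∑ k, y k) ≤
        max δ 0 * D₁ (fun k => w (Sum.inr k)) + max (-δ) 0 * D₂ (fun k => w (Sum.inr k)) := by
      rcases le_total 0 δ with h0 | h0
      · rw [max_eq_left h0, max_eq_right (by linarith), zero_mul, add_zero]
        exact mul_le_mul_of_nonneg_left e1 h0
      · rw [max_eq_right h0, max_eq_left (by linarith), zero_mul, zero_add]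
        have := mul_le_mul_of_nonneg_left e2 (neg_nonneg.2 h0)
        linarith
    have sU' := mul_le_mul_of_nonneg_left sU (by positivity : 0 ≤ 1 / T)
    have sV' := mul_le_mul_of_nonneg_left sV (by positivity : 0 ≤ 1 / T)
    have ida : a = 1 - b := by linarith
    -- Class-by-class comparisons averaged over the shifts, with ghost weights |S|/T and 1 − |S|/T,
    -- plus δ times the difference of the ghost sums.
    have hid : -(∑ i ∈ S, z i + ∑ i ∈ Sᶜ, z i) + (b * ∑ k, x k + a * ∑ k, y k) =
        1 / T * (S.card * ∑ k, x k - T * ∑ i ∈ S, z i) +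
        1 / T * ((T - S.card) * ∑ k, y k - T * ∑ i ∈ Sᶜ, z i) +
        δ * (∑ k, x k - ∑ k, y k) := by
      rw [hδ, ida]
      field_simp
      ring
    rw [hid]
    linarith
  have bS := h.bddMeas_supSum (ghostCoef I a b) (ξ := fun i (w : I ⊕ (I ⊕ I) → X) => w i)
    fun i => measurable_pi_apply i
  have c1 := ((BddMeas.sum Finset.univ fun r _ => bU r).const_mul (1 / T))
  have c2 := ((BddMeas.sum Finset.univ fun r _ => bV r).const_mul (1 / T))
  have c3 := (bD₁.comp hinr).const_mul (max δ 0)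
  have c4 := (bD₂.comp hinr).const_mul (max (-δ) 0)
  refine (integral_mono (bS.integrable ρ) (((c1.add c2).add (c3.add c4)).integrable ρ) hpt).trans ?_
  rw [integral_add ((c1.add c2).integrable _) ((c3.add c4).integrable _),
    integral_add (c1.integrable _) (c2.integrable _),
    integral_add (c3.integrable _) (c4.integrable _), integral_const_mul, integral_const_mul,
    integral_const_mul, integral_const_mul,
    integral_finsetSum _ fun r _ => (bU r).integrable _,
    integral_finsetSum _ fun r _ => (bV r).integrable _,
    integral_pi_comp_injective (ghostLaw pP pN S) Sum.inr_injective bD₁.1,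
    integral_pi_comp_injective (ghostLaw pP pN S) Sum.inr_injective bD₂.1]
  refine add_le_add ?_ (le_of_eq rfl)
  have hUi : ∀ r, ∫ w, U r w ∂ρ ≤ 2 * L * (CG * √(S.card)) := by
    intro r
    have := h.integral_supSum_comp_le (ghostLaw pP pN S) pN hN (injN r) (lawN r)
    rwa [Fintype.card_coe] at this
  have hVi : ∀ r, ∫ w, V r w ∂ρ ≤ 2 * L * (CG * √(Sᶜ.card)) := by
    intro r
    have := h.integral_supSum_comp_le (ghostLaw pP pN S) pP hP (injP r) (lawP r)
    rwa [Fintype.card_coe] at this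
  have hs1 := Finset.sum_le_sum fun r (_ : r ∈ Finset.univ) => hUi r
  have hs2 := Finset.sum_le_sum fun r (_ : r ∈ Finset.univ) => hVi r
  rw [Finset.sum_const, Finset.card_univ, nsmul_eq_mul, ← hT] at hs1 hs2
  have k1 := mul_le_mul_of_nonneg_left hs1 (by positivity : 0 ≤ 1 / T)
  have k2 := mul_le_mul_of_nonneg_left hs2 (by positivity : 0 ≤ 1 / T)
  rw [← mul_assoc, one_div_mul_cancel hT0.ne', one_mul] at k1 k2
  linarith

end FixedLabels

/-! ### Moments of the truncated binomial law and the coefficients a, b -/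

section BinomialWeights

variable {q p : ℝ} {M : ℕ}

/-- The probability of `k` negative labels among `M`. -/
noncomputable def binWeight (M : ℕ) (q p : ℝ) (k : ℕ) : ℝ := M.choose k * q ^ (M - k) * p ^ k

lemma binWeight_nonneg (hq : 0 < q) (hp : 0 < p) (k : ℕ) : 0 ≤ binWeight M q p k := by
  unfold binWeight
  positivity

/-- The ratio of consecutive binomial weights. Summing it up to K, without or with a factor k + 1,
gives the two moment identities that follow; the boundary term at K is the effect of truncation. -/
lemma binWeight_succ (M : ℕ) (q p : ℝ) (k : ℕ) :
    (k + 1) * binWeight M q p (k + 1) * q = (M - k) * p * binWeight M q p k := by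
  unfold binWeight
  rcases lt_trichotomy k M with h | rfl | h
  · have h1 : (M.choose (k + 1) : ℝ) * (k + 1) = M.choose k * (M - k) := by
      have := Nat.choose_succ_right_eq M k
      rw [← Nat.cast_sub h.le]
      exact_mod_cast this
    have h2 : q ^ (M - (k + 1)) * q = q ^ (M - k) := by
      rw [← pow_succ]
      congr 1
      omega
    rw [← h2, pow_succ]
    linear_combination q ^ (M - (k + 1)) * q * p ^ k * p * h1
  · simp
  · rw [Nat.choose_eq_zero_of_lt h, Nat.choose_eq_zero_of_lt (h.trans (Nat.lt_succ_self k))]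
    simp

lemma sum_mul_binWeight (M : ℕ) (q p : ℝ) (K : ℕ) :
    q * ∑ k ∈ Finset.range (K + 1), k * binWeight M q p k =
      p * (M * ∑ k ∈ Finset.range (K + 1), binWeight M q p k -
        ∑ k ∈ Finset.range (K + 1), k * binWeight M q p k) -
      p * (M - K) * binWeight M q p K := by
  induction K with
  | zero => simp; ring
  | succ K ih =>
    rw [Finset.sum_range_succ, Finset.sum_range_succ (fun k => binWeight M q p k)]
    have h := binWeight_succ M q p K
    push_cast at h ⊢
    linear_combination ih + h

lemma sum_sq_mul_binWeight (M : ℕ) (q p : ℝ) (K : ℕ) :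
    q * ∑ k ∈ Finset.range (K + 1), (k : ℝ) ^ 2 * binWeight M q p k =
      p * (M * ∑ k ∈ Finset.range (K + 1), binWeight M q p k +
        (M - 1) * ∑ k ∈ Finset.range (K + 1), k * binWeight M q p k -
        ∑ k ∈ Finset.range (K + 1), (k : ℝ) ^ 2 * binWeight M q p k) -
      (K + 1) * (p * (M - K) * binWeight M q p K) := by
  induction K with
  | zero => simp; ring
  | succ K ih =>
    rw [Finset.sum_range_succ, Finset.sum_range_succ (fun k => binWeight M q p k),
      Finset.sum_range_succ (fun k : ℕ => (k : ℝ) * binWeight M q p k)]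
    have h := binWeight_succ M q p K
    push_cast at h ⊢
    linear_combination ih + (K + 1) * h

lemma normConst_eq (M : ℕ) (q p : ℝ) :
    normConst M q p = ∑ k ∈ Finset.range (M / 2 + 1), binWeight M q p k := rfl

/-- By M C(M−1, k−1) = k C(M, k): M b is the mean number of negative points of a tuple. -/
lemma natCast_mul_coefB (hM : 1 ≤ M) (q p : ℝ) :
    M * coefB M q p =
      (∑ k ∈ Finset.range (M / 2 + 1), k * binWeight M q p k) / normConst M q p := by
  unfold coefB
  rw [← mul_div_assoc, Finset.mul_sum, Finset.sum_range_succ', Nat.cast_zero, zero_mul, add_zero,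
    ← Finset.Ico_add_one_right_eq_Icc, Finset.sum_Ico_eq_sum_range, Nat.add_sub_cancel]
  refine congrArg (· / _) (Finset.sum_congr rfl fun k _ => ?_)
  obtain ⟨m, rfl⟩ : ∃ m, M = m + 1 := ⟨M - 1, by omega⟩
  have h : ((m + 1 : ℕ) : ℝ) * m.choose k = (m + 1).choose (k + 1) * (k + 1 : ℕ) := by
    exact_mod_cast Nat.add_one_mul_choose_eq m k
  rw [binWeight, Nat.add_sub_cancel, add_comm 1 k, Nat.add_sub_cancel]
  linear_combination q ^ (m + 1 - (k + 1)) * p ^ (k + 1) * h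

lemma natCast_mul_coefA (hM : 1 ≤ M) (hq : 0 < q) (hp : 0 < p) :
    M * coefA M q p =
      M - (∑ k ∈ Finset.range (M / 2 + 1), k * binWeight M q p k) / normConst M q p := by
  have hZ := normConst_pos (M := M) hq hp
  unfold coefA
  rw [eq_sub_iff_add_eq, ← mul_div_assoc, ← add_div, div_eq_iff hZ.ne', normConst_eq,
    Finset.mul_sum, Finset.mul_sum, ← Finset.sum_add_distrib]
  refine Finset.sum_congr rfl fun k _ => ?_
  obtain ⟨m, rfl⟩ : ∃ m, M = m + 1 := ⟨M - 1, by omega⟩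
  have h : ((m + 1 : ℕ) : ℝ) * m.choose k = (m + 1).choose k * ((m + 1 : ℕ) - k) := by
    rcases le_or_gt k (m + 1) with hk | hk
    · rw [← Nat.cast_sub hk]
      have h2 := Nat.choose_mul_succ_eq m k
      have : (m + 1) * m.choose k = (m + 1).choose k * (m + 1 - k) := by linarith
      exact_mod_cast this
    · rw [Nat.choose_eq_zero_of_lt hk, Nat.choose_eq_zero_of_lt (by omega)]
      simp
  rw [binWeight, Nat.add_sub_cancel]
  linear_combination q ^ (m + 1 - k) * p ^ k * h

lemma coefA_add_coefB (hM : 1 ≤ M) (hq : 0 < q) (hp : 0 < p) :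
    coefA M q p + coefB M q p = 1 := by
  have h0 : (M : ℝ) ≠ 0 := by exact_mod_cast (by omega : M ≠ 0)
  have h1 := natCast_mul_coefB hM q p
  have h2 := natCast_mul_coefA hM hq hp
  refine mul_left_cancel₀ h0 ?_
  linarith

lemma coefA_nonneg (hq : 0 < q) (hp : 0 < p) : 0 ≤ coefA M q p :=
  div_nonneg (Finset.sum_nonneg fun _ _ => by positivity) (normConst_pos hq hp).le

lemma coefB_nonneg (hq : 0 < q) (hp : 0 < p) : 0 ≤ coefB M q p :=
  div_nonneg (Finset.sum_nonneg fun _ _ => by positivity) (normConst_pos hq hp).le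

/-- The positive class has a larger share in the tuples than in the unlabeled points. -/
lemma coef_sub_pos (hM : 1 ≤ M) (hq : 0 < q) (hp : 0 < p) :
    0 < coefA M q p * p - coefB M q p * q := by
  have hM0 : (0 : ℝ) < M := by exact_mod_cast hM
  have hZ := normConst_pos (M := M) hq hp
  have hK : ((M / 2 : ℕ) : ℝ) < M := by exact_mod_cast (by omega : M / 2 < M)
  have hw : 0 < binWeight M q p (M / 2) := by
    unfold binWeight
    have : 0 < M.choose (M / 2) := Nat.choose_pos (by omega)
    positivity
  have h := sum_mul_binWeight M q p (M / 2)
  rw [← normConst_eq] at h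
  have hB : 0 < p * (M - (M / 2 : ℕ)) * binWeight M q p (M / 2) :=
    mul_pos (mul_pos hp (sub_pos.2 hK)) hw
  have h1 := natCast_mul_coefB hM q p
  have h2 := natCast_mul_coefA hM hq hp
  set s := ∑ k ∈ Finset.range (M / 2 + 1), k * binWeight M q p k
  -- By the first moment identity the difference is exactly the truncation boundary term, which is
  -- positive because ⌊M/2⌋ < M.
  have h3 : M * (coefA M q p * p - coefB M q p * q) =
      (p * (M - (M / 2 : ℕ)) * binWeight M q p (M / 2)) / normConst M q p := by
    rw [eq_div_iff hZ.ne']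
    rw [← div_mul_cancel₀ s hZ.ne'] at h
    linear_combination normConst M q p * p * h2 - normConst M q p * q * h1 - h
  have h4 : 0 < M * (coefA M q p * p - coefB M q p * q) := h3 ▸ div_pos hB hZ
  exact pos_of_mul_pos_right h4 hM0.le

/-- Truncation lowers the mean below pM, and the second moment identity gives a variance of q times
the truncated mean minus a term that is nonnegative because the mean is at most the cutoff. So the
variance is at most M q p ≤ M/4. -/
lemma sum_sq_sub_mul_binWeight_le (hM : 1 ≤ M) (hq : 0 < q) (hp : 0 < p) (hqp : q + p = 1) :
    (∑ k ∈ Finset.range (M / 2 + 1), ((k : ℝ) - M * coefB M q p) ^ 2 * binWeight M q p k) /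
      normConst M q p ≤ M / 4 := by
  have hZ := normConst_pos (M := M) hq hp
  have hM0 : (0 : ℝ) < M := by exact_mod_cast hM
  have hK : ((M / 2 : ℕ) : ℝ) ≤ M := by exact_mod_cast Nat.div_le_self M 2
  have hw := binWeight_nonneg (M := M) hq hp (M / 2)
  have h1 := sum_mul_binWeight M q p (M / 2)
  have h2 := sum_sq_mul_binWeight M q p (M / 2)
  rw [natCast_mul_coefB hM]
  have hsle : ∑ k ∈ Finset.range (M / 2 + 1), k * binWeight M q p k ≤
      (M / 2 : ℕ) * normConst M q p := by
    rw [normConst_eq, Finset.mul_sum]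
    refine Finset.sum_le_sum fun k hk => mul_le_mul_of_nonneg_right ?_ (binWeight_nonneg hq hp k)
    exact_mod_cast Nat.lt_succ_iff.1 (Finset.mem_range.1 hk)
  rw [← normConst_eq] at h1 h2
  set Z := normConst M q p
  set s := ∑ k ∈ Finset.range (M / 2 + 1), k * binWeight M q p k
  set t := ∑ k ∈ Finset.range (M / 2 + 1), (k : ℝ) ^ 2 * binWeight M q p k
  set B := p * (M - (M / 2 : ℕ)) * binWeight M q p (M / 2)
  have hB : 0 ≤ B := mul_nonneg (mul_nonneg hp.le (sub_nonneg.2 hK)) hw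
  set μ := s / Z with hμ
  have hs : s = μ * Z := by rw [hμ, div_mul_cancel₀ _ hZ.ne']
  have hμK : μ ≤ (M / 2 : ℕ) := by rwa [hμ, div_le_iff₀ hZ]
  have hexp : ∑ k ∈ Finset.range (M / 2 + 1), ((k : ℝ) - μ) ^ 2 * binWeight M q p k =
      t - 2 * μ * s + μ ^ 2 * Z := by
    simp only [t, s, Z, normConst_eq, Finset.mul_sum, ← Finset.sum_sub_distrib,
      ← Finset.sum_add_distrib]
    exact Finset.sum_congr rfl fun k _ => by ring
  rw [hexp, div_le_iff₀ hZ]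
  obtain rfl : q = 1 - p := by linarith
  have e1 : p * M * Z = s + B := by linear_combination -h1
  have e2 : t - 2 * μ * s + μ ^ 2 * Z = (1 - p) * s - B * ((M / 2 : ℕ) - μ) := by
    have e3 : t = p * M * Z + p * (M - 1) * s - ((M / 2 : ℕ) + 1) * B := by
      linear_combination h2
    have e4 : p * M * s = μ * (s + B) := by rw [← e1, hs]; ring
    rw [e3]
    linear_combination e1 + e4 - μ * hs
  rw [e2]
  have e5 : 0 ≤ B * ((M / 2 : ℕ) - μ) := mul_nonneg hB (sub_nonneg.2 hμK)
  have e6 : (1 - p) * s ≤ (1 - p) * (p * M * Z) := mul_le_mul_of_nonneg_left (by linarith) hq.le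
  have e7 : (1 - p) * p * (M * Z) ≤ 1 / 4 * (M * Z) :=
    mul_le_mul_of_nonneg_right (by nlinarith [sq_nonneg (p - 1 / 2)]) (by positivity)
  linarith

end BinomialWeights

/-! ### Random label sets and sums of independent counts -/

section LabelWeights

/-- The probability of the set `S` of negative positions of a tuple. -/
noncomputable def labelWeight (q p : ℝ) {M : ℕ} (S : Finset (Fin M)) : ℝ :=
  if S.card ≤ M / 2 then q ^ (M - S.card) * p ^ S.card / normConst M q p else 0

variable {q p : ℝ} {M : ℕ}

lemma labelWeight_nonneg (hq : 0 < q) (hp : 0 < p) (S : Finset (Fin M)) :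
    0 ≤ labelWeight q p S := by
  have hZ := normConst_pos (M := M) hq hp
  unfold labelWeight
  split_ifs <;> positivity

lemma sum_ite_card_le {A : Type*} [AddCommMonoid A] (h : ℕ → Finset (Fin M) → A) :
    ∑ S : Finset (Fin M), (if S.card ≤ M / 2 then h S.card S else 0) =
      ∑ k ∈ Finset.range (M / 2 + 1), ∑ S ∈ Finset.powersetCard k Finset.univ, h k S := by
  rw [← Finset.powerset_univ, Finset.sum_powerset, Finset.card_univ, Fintype.card_fin]
  have hsub : Finset.range (M / 2 + 1) ⊆ Finset.range (M + 1) :=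
    Finset.range_mono (Nat.succ_le_succ (Nat.div_le_self M 2))
  rw [← Finset.sum_subset hsub]
  · refine Finset.sum_congr rfl fun k hk => Finset.sum_congr rfl fun S hS => ?_
    rw [(Finset.mem_powersetCard.1 hS).2, if_pos (Nat.lt_succ_iff.1 (Finset.mem_range.1 hk))]
  · refine fun k _ hk => Finset.sum_eq_zero fun S hS => ?_
    rw [(Finset.mem_powersetCard.1 hS).2, if_neg fun h => hk (Finset.mem_range.2 (by omega))]

lemma sum_labelWeight_mul (φ : ℕ → ℝ) :
    ∑ S : Finset (Fin M), labelWeight q p S * φ S.card =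
      (∑ k ∈ Finset.range (M / 2 + 1), φ k * binWeight M q p k) / normConst M q p := by
  have := sum_ite_card_le (M := M) fun k _ => q ^ (M - k) * p ^ k / normConst M q p * φ k
  simp only [labelWeight, ite_mul, zero_mul]
  rw [this, Finset.sum_div]
  refine Finset.sum_congr rfl fun k _ => ?_
  rw [Finset.sum_const, Finset.card_powersetCard, Finset.card_univ, Fintype.card_fin,
    nsmul_eq_mul, binWeight]
  ring

lemma sum_labelWeight (hq : 0 < q) (hp : 0 < p) :
    ∑ S : Finset (Fin M), labelWeight q p S = 1 := by
  have := sum_labelWeight_mul (q := q) (p := p) (M := M) fun _ => 1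
  simp only [mul_one, one_mul] at this
  rw [this, ← normConst_eq, div_self (normConst_pos hq hp).ne']

lemma sum_labelWeight_mul_card_sub (hM : 1 ≤ M) (hq : 0 < q) (hp : 0 < p) :
    ∑ S : Finset (Fin M), labelWeight q p S * (S.card - M * coefB M q p) = 0 := by
  have h1 := sum_labelWeight_mul (q := q) (p := p) (M := M) fun k => k
  simp only [mul_sub, Finset.sum_sub_distrib]
  rw [h1, ← natCast_mul_coefB hM, ← Finset.sum_mul, sum_labelWeight hq hp]
  ring

lemma sum_labelWeight_mul_card_sub_sq_le (hM : 1 ≤ M) (hq : 0 < q) (hp : 0 < p)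
    (hqp : q + p = 1) :
    ∑ S : Finset (Fin M), labelWeight q p S * ((S.card : ℝ) - M * coefB M q p) ^ 2 ≤ M / 4 := by
  rw [sum_labelWeight_mul fun k => ((k : ℝ) - M * coefB M q p) ^ 2]
  exact sum_sq_sub_mul_binWeight_le hM hq hp hqp

/-- Total mass, mean and variance of a sum of n independent centred variables. The three are proved
together because the cross terms of the variance vanish by the mean. -/
lemma sum_pi_prod_mul {α : Type*} [Fintype α] {w ξ : α → ℝ} (hw : ∑ a, w a = 1)
    (hξ : ∑ a, w a * ξ a = 0) (n : ℕ) :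
    (∑ s : Fin n → α, ∏ i, w (s i) = 1) ∧ (∑ s : Fin n → α, (∏ i, w (s i)) * ∑ i, ξ (s i) = 0) ∧
      ∑ s : Fin n → α, (∏ i, w (s i)) * (∑ i, ξ (s i)) ^ 2 = n * ∑ a, w a * ξ a ^ 2 := by
  induction n with
  | zero => simp
  | succ n ih =>
    obtain ⟨h0, h1, h2⟩ := ih
    have hsum : ∀ h : (Fin (n + 1) → α) → ℝ,
        ∑ s, h s = ∑ a, ∑ s : Fin n → α, h (Fin.cons a s) := by
      intro h
      rw [← Fintype.sum_prod_type', ← (Fin.consEquiv fun _ => α).sum_comp]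
      rfl
    refine ⟨?_, ?_, ?_⟩
    · rw [hsum]
      simp only [Fin.prod_univ_succ, Fin.cons_zero, Fin.cons_succ, ← Finset.mul_sum, h0, mul_one,
        hw]
    · rw [hsum]
      simp only [Fin.prod_univ_succ, Fin.sum_univ_succ, Fin.cons_zero, Fin.cons_succ]
      have : ∀ a, ∑ s : Fin n → α, (w a * ∏ i, w (s i)) * (ξ a + ∑ i, ξ (s i)) = w a * ξ a := by
        intro a
        calc _ = w a * ξ a * ∑ s : Fin n → α, ∏ i, w (s i) +
              w a * ∑ s : Fin n → α, (∏ i, w (s i)) * ∑ i, ξ (s i) := by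
              rw [Finset.mul_sum, Finset.mul_sum, ← Finset.sum_add_distrib]
              exact Finset.sum_congr rfl fun s _ => by ring
          _ = _ := by rw [h0, h1]; ring
      simp only [this, hξ]
    · rw [hsum]
      simp only [Fin.prod_univ_succ, Fin.sum_univ_succ, Fin.cons_zero, Fin.cons_succ]
      have : ∀ a, ∑ s : Fin n → α, (w a * ∏ i, w (s i)) * (ξ a + ∑ i, ξ (s i)) ^ 2 =
          w a * ξ a ^ 2 + w a * (n * ∑ a, w a * ξ a ^ 2) := by
        intro a
        calc _ = w a * ξ a ^ 2 * ∑ s : Fin n → α, ∏ i, w (s i) +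
              2 * w a * ξ a * ∑ s : Fin n → α, (∏ i, w (s i)) * ∑ i, ξ (s i) +
              w a * ∑ s : Fin n → α, (∏ i, w (s i)) * (∑ i, ξ (s i)) ^ 2 := by
              rw [Finset.mul_sum, Finset.mul_sum, Finset.mul_sum, ← Finset.sum_add_distrib,
                ← Finset.sum_add_distrib]
              exact Finset.sum_congr rfl fun s _ => by ring
          _ = _ := by rw [h0, h1, h2]; ring
      simp only [this, Finset.sum_add_distrib, ← Finset.sum_mul, hw]
      push_cast
      ring

end LabelWeights

/-! ### Conditioning the tuples on their labels -/

section LabelDecomposition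

variable {X : Type*} [MeasurableSpace X] {pP pN : Measure X} [IsProbabilityMeasure pP]
  [IsProbabilityMeasure pN] {q p : ℝ} {M : ℕ}

lemma tupleLaw_eq_sum (M : ℕ) (q p : ℝ) (pP pN : Measure X) : tupleLaw M q p pP pN =
    ∑ S : Finset (Fin M), ENNReal.ofReal (labelWeight q p S) • Measure.pi (labelLaw pP pN S) := by
  have := sum_ite_card_le (M := M) fun k S =>
    ENNReal.ofReal (q ^ (M - k) * p ^ k / normConst M q p) • Measure.pi (labelLaw pP pN S)
  refine Eq.trans this.symm (Finset.sum_congr rfl fun S _ => ?_)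
  unfold labelWeight
  split_ifs <;> simp

lemma pi_tupleLaw_eq_sum (hq : 0 < q) (hp : 0 < p) (n : ℕ) :
    (Measure.pi fun _ : Fin n => tupleLaw M q p pP pN) =
      ∑ s : Fin n → Finset (Fin M), ENNReal.ofReal (∏ i, labelWeight q p (s i)) •
        Measure.pi fun i => Measure.pi (labelLaw pP pN (s i)) := by
  have hQ := isProbabilityMeasure_tupleLaw (M := M) (pP := pP) (pN := pN) hq hp
  refine Measure.pi_eq fun B hB => ?_
  simp only [Measure.coe_finsetSum, Finset.sum_apply, Measure.coe_smul, Pi.smul_apply, smul_eq_mul,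
    Measure.pi_pi, tupleLaw_eq_sum]
  rw [Finset.prod_univ_sum, Fintype.piFinset_univ]
  refine Finset.sum_congr rfl fun s _ => ?_
  rw [Finset.prod_mul_distrib, ENNReal.ofReal_prod_of_nonneg fun i _ => labelWeight_nonneg hq hp _]

lemma integral_pi_tupleLaw (hq : 0 < q) (hp : 0 < p) {n : ℕ} {F : (Fin n → Fin M → X) → ℝ}
    (hF : BddMeas F) :
    ∫ z, F z ∂(Measure.pi fun _ : Fin n => tupleLaw M q p pP pN) =
      ∑ s : Fin n → Finset (Fin M), (∏ i, labelWeight q p (s i)) *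
        ∫ z, F z ∂(Measure.pi fun i => Measure.pi (labelLaw pP pN (s i))) := by
  rw [pi_tupleLaw_eq_sum hq hp, integral_finsetSum_measure fun s _ =>
    (hF.integrable _).smul_measure ENNReal.ofReal_ne_top]
  refine Finset.sum_congr rfl fun s _ => ?_
  rw [integral_smul_measure, ENNReal.toReal_ofReal
    (Finset.prod_nonneg fun i _ => labelWeight_nonneg hq hp _), smul_eq_mul]

end LabelDecomposition

/-! ### The expected supremum of the deviations -/

section MeanBound

variable {X : Type*} [MeasurableSpace X] {G : Set (X → ℝ)} {f : ℝ → ℝ} {L : ℝ} {pP pN : Measure X}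
  [IsProbabilityMeasure pP] [IsProbabilityMeasure pN] {q p : ℝ} {M n : ℕ}

/-- The negative positions of a sample of tuples. -/
def labelSet (s : Fin n → Finset (Fin M)) : Finset (Fin n × Fin M) :=
  Finset.univ.filter fun i => i.2 ∈ s i.1

lemma card_labelSet (s : Fin n → Finset (Fin M)) : (labelSet s).card = ∑ i, (s i).card := by
  rw [labelSet, Finset.card_filter, Fintype.sum_prod_type]
  exact Finset.sum_congr rfl fun i _ => by simp

/-- A sample of tuples together with ghost samples. -/
def joinGhost (z : (Fin n → Fin M → X) × ((Fin n × Fin M) ⊕ (Fin n × Fin M) → X)) :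
    (Fin n × Fin M) ⊕ ((Fin n × Fin M) ⊕ (Fin n × Fin M)) → X :=
  Sum.elim (fun i => z.1 i.1 i.2) z.2

lemma measurable_joinGhost : Measurable (joinGhost (X := X) (n := n) (M := M)) := by
  refine measurable_pi_lambda _ ?_
  rintro (i | i)
  · exact (measurable_pi_apply i.2).comp ((measurable_pi_apply i.1).comp measurable_fst)
  · exact (measurable_pi_apply i).comp measurable_snd

/-- The law of the two ghost samples. -/
noncomputable def ghostPi (I : Type*) [Fintype I] (pP pN : Measure X) : Measure (I ⊕ I → X) :=
  Measure.pi (Sum.elim (fun _ => pN) fun _ => pP)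

instance (I : Type*) (i : I ⊕ I) :
    IsProbabilityMeasure (Sum.elim (fun _ => pN) (fun _ => pP) i : Measure X) := by
  rcases i with i | i
  exacts [‹IsProbabilityMeasure pN›, ‹IsProbabilityMeasure pP›]

instance (I : Type*) [Fintype I] : IsProbabilityMeasure (ghostPi I pP pN) := by
  unfold ghostPi
  infer_instance

/-- Given all labels, the nested product over tuples, joined with the ghosts, is one flat product,
which is the setting of the bound for fixed labels. -/
lemma map_joinGhost (s : Fin n → Finset (Fin M)) :
    ((Measure.pi fun i => Measure.pi (labelLaw pP pN (s i))).prod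
      (ghostPi (Fin n × Fin M) pP pN)).map joinGhost =
      Measure.pi (ghostLaw pP pN (labelSet s)) := by
  symm
  refine Measure.pi_eq fun B hB => ?_
  rw [Measure.map_apply measurable_joinGhost (MeasurableSet.univ_pi hB)]
  have : joinGhost ⁻¹' (Set.univ.pi B) =
      (Set.univ.pi fun i : Fin n => Set.univ.pi fun j : Fin M => B (Sum.inl (i, j))) ×ˢ
        (Set.univ.pi fun k => B (Sum.inr k)) := by
    ext z
    simp [joinGhost, Set.mem_prod]
  rw [this, Measure.prod_prod, Measure.pi_pi, ghostPi, Measure.pi_pi]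
  simp [Fintype.prod_sum_type, Fintype.prod_prod_type, ghostLaw, labelLaw, labelSet]

/-- The expected deviation of a sample of tuples from ghost samples. -/
noncomputable def ghostMean (G : Set (X → ℝ)) (f : ℝ → ℝ) (pP pN : Measure X) (a b : ℝ)
    (z : Fin n → Fin M → X) : ℝ :=
  ∫ v, supSum G f (ghostCoef (Fin n × Fin M) a b) (joinGhost (z, v))
    ∂(ghostPi (Fin n × Fin M) pP pN)

lemma LipClass.bddMeas_joinGhost (h : LipClass G f L) (a b : ℝ) :
    BddMeas fun z : (Fin n → Fin M → X) × ((Fin n × Fin M) ⊕ (Fin n × Fin M) → X) =>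
      supSum G f (ghostCoef (Fin n × Fin M) a b) (joinGhost z) :=
  h.bddMeas_supSum _ fun i => (measurable_pi_apply i).comp measurable_joinGhost

lemma LipClass.bddMeas_ghostMean (h : LipClass G f L) (a b : ℝ) :
    BddMeas (ghostMean (n := n) (M := M) G f pP pN a b) :=
  (h.bddMeas_joinGhost a b).integral_right _

lemma LipClass.integral_ghostMean (h : LipClass G f L) (a b : ℝ) (s : Fin n → Finset (Fin M)) :
    ∫ z, ghostMean G f pP pN a b z ∂(Measure.pi fun i => Measure.pi (labelLaw pP pN (s i))) =
      ∫ w, supSum G f (ghostCoef (Fin n × Fin M) a b) w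
        ∂(Measure.pi (ghostLaw pP pN (labelSet s))) := by
  have hb := h.bddMeas_supSum (ghostCoef (Fin n × Fin M) a b)
    (ξ := fun i (w : (Fin n × Fin M) ⊕ ((Fin n × Fin M) ⊕ (Fin n × Fin M)) → X) => w i)
    fun i => measurable_pi_apply i
  rw [← map_joinGhost s, integral_map measurable_joinGhost.aemeasurable hb.1.aestronglyMeasurable,
    integral_prod _ ((h.bddMeas_joinGhost a b).integrable _)]
  rfl

lemma sqrt_add_sqrt_sub_le {N T : ℝ} (hN : 0 ≤ N) (hNT : N ≤ T) :
    √N + √(T - N) ≤ √2 * √T := by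
  rw [← Real.sqrt_mul (by norm_num)]
  refine Real.le_sqrt_of_sq_le ?_
  have h1 := Real.sq_sqrt hN
  have h2 := Real.sq_sqrt (sub_nonneg.2 hNT)
  nlinarith [sq_nonneg (√N - √(T - N))]

/-- The first absolute moment is controlled by the second, through |V| ≤ V²/(2v) + v/2 averaged over
w. -/
lemma sum_weighted_abs_le {α : Type*} [Fintype α] {w V : α → ℝ} (hw : ∀ s, 0 ≤ w s)
    (hw1 : ∑ s, w s = 1) {v : ℝ} (hv : 0 < v) (hV : ∑ s, w s * V s ^ 2 ≤ v ^ 2) :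
    ∑ s, w s * |V s| ≤ v := by
  have hpt : ∀ s, w s * |V s| ≤ 1 / (2 * v) * (w s * V s ^ 2) + v / 2 * w s := by
    intro s
    have : |V s| ≤ 1 / (2 * v) * V s ^ 2 + v / 2 := by
      rw [← sub_nonneg, ← sq_abs (V s)]
      have : 1 / (2 * v) * |V s| ^ 2 + v / 2 - |V s| = (|V s| - v) ^ 2 / (2 * v) := by
        field_simp
        ring
      rw [this]
      positivity
    have := mul_le_mul_of_nonneg_left this (hw s)
    linarith
  refine (Finset.sum_le_sum fun s _ => hpt s).trans ?_
  rw [Finset.sum_add_distrib, ← Finset.mul_sum, ← Finset.mul_sum, hw1]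
  have := mul_le_mul_of_nonneg_left hV (by positivity : 0 ≤ 1 / (2 * v))
  have e : 1 / (2 * v) * v ^ 2 = v / 2 := by field_simp
  linarith

/-- **The mean bound**: the maximal deviation of the points of the tuples from their expectation
is that of independent points, up to a constant factor. -/
lemma LipClass.integral_ghostMean_le (h : LipClass G f L) (hq : 0 < q) (hp : 0 < p)
    (hqp : q + p = 1) (hM : 1 ≤ M) (hn : 1 ≤ n) {CG : ℝ} (hCG : 0 ≤ CG)
    (hP : ∀ n : ℕ, 1 ≤ n → rademacher G pP n ≤ CG / √n)
    (hN : ∀ n : ℕ, 1 ≤ n → rademacher G pN n ≤ CG / √n) :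
    ∫ z, ghostMean G f pP pN (coefA M q p) (coefB M q p) z
        ∂(Measure.pi fun _ : Fin n => tupleLaw M q p pP pN) ≤ 4 * L * CG * √(M * n) := by
  -- With `NeZero` both factors of the index set are cyclic groups, as the shifts of the ghost
  -- samples require.
  have : NeZero n := ⟨by omega⟩
  have : NeZero M := ⟨by omega⟩
  have hL := h.lip_nonneg
  have hM0 : (0 : ℝ) < M := by exact_mod_cast hM
  have hn0 : (0 : ℝ) < n := by exact_mod_cast hn
  set T : ℝ := M * n with hT
  have hT0 : 0 < T := by positivity
  have hcard : (Fintype.card (Fin n × Fin M) : ℝ) = T := by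
    rw [Fintype.card_prod, Fintype.card_fin, Fintype.card_fin, hT]
    push_cast
    ring
  set b := coefB M q p with hb
  set W : (Fin n → Finset (Fin M)) → ℝ := fun s => ∏ i, labelWeight q p (s i) with hW
  have hW0 : ∀ s, 0 ≤ W s := fun s => Finset.prod_nonneg fun i _ => labelWeight_nonneg hq hp _
  set V : (Fin n → Finset (Fin M)) → ℝ := fun s => b - (labelSet s).card / T with hV
  obtain ⟨w1, w2, w3⟩ := sum_pi_prod_mul (sum_labelWeight hq hp)
    (sum_labelWeight_mul_card_sub hM hq hp) n
  have hVs : ∀ s, V s = -(∑ i, (((s i).card : ℝ) - M * b)) / T := by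
    intro s
    simp only [hV, card_labelSet, Finset.sum_sub_distrib, Finset.sum_const, Finset.card_univ,
      Fintype.card_fin, nsmul_eq_mul]
    push_cast
    rw [hT]
    field_simp
    ring
  -- The mismatch is centred because M b is the mean label count. Hence the unknown difference of
  -- the two ghost integrals drops out, and only their sum matters.
  have hV1 : ∑ s, W s * V s = 0 := by
    have : ∀ s, W s * V s = -(1 / T) * (W s * ∑ i, (((s i).card : ℝ) - M * b)) := by
      intro s
      rw [hVs]
      ring
    simp only [this, ← Finset.mul_sum]
    rw [w2, mul_zero]
  have hV2 : ∑ s, W s * V s ^ 2 ≤ (1 / (2 * √T)) ^ 2 := by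
    have : ∀ s, W s * V s ^ 2 = 1 / T ^ 2 * (W s * (∑ i, (((s i).card : ℝ) - M * b)) ^ 2) := by
      intro s
      rw [hVs]
      ring
    simp only [this, ← Finset.mul_sum]
    rw [w3, div_pow, mul_pow 2 (√T), Real.sq_sqrt hT0.le]
    have h4 := mul_le_mul_of_nonneg_left (sum_labelWeight_mul_card_sub_sq_le hM hq hp hqp) hn0.le
    have h5 := mul_le_mul_of_nonneg_left h4 (by positivity : 0 ≤ 1 / T ^ 2)
    refine h5.trans (le_of_eq ?_)
    rw [hT]
    field_simp
    norm_num
  have hE := sum_weighted_abs_le hW0 w1 (v := 1 / (2 * √T)) (by positivity) hV2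
  have hdiff := h.integral_supSum_diff_le (I := Fin n × Fin M) pP pN (CG := CG)
    (by simpa using hP 1 le_rfl) (by simpa using hN 1 le_rfl)
  rw [hcard] at hdiff
  rw [integral_pi_tupleLaw hq hp (h.bddMeas_ghostMean _ _)]
  set D₁ := ∫ v, supSum G f (Sum.elim (fun _ : Fin n × Fin M => 1) fun _ : Fin n × Fin M => -1) v
    ∂(Measure.pi (Sum.elim (fun _ => pN) fun _ => pP))
  set D₂ := ∫ v, supSum G f (Sum.elim (fun _ : Fin n × Fin M => -1) fun _ : Fin n × Fin M => 1) v
    ∂(Measure.pi (Sum.elim (fun _ => pN) fun _ => pP))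
  have hpt : ∀ s, W s * ∫ z, ghostMean G f pP pN (coefA M q p) b z
        ∂(Measure.pi fun i => Measure.pi (labelLaw pP pN (s i))) ≤
      W s * (2 * L * CG * (√2 * √T)) + W s * |V s| * (T * (2 * L * CG)) +
        W s * V s * ((D₁ - D₂) / 2) := by
    intro s
    rw [h.integral_ghostMean]
    have h1 := h.integral_ghost_le pP pN hP hN (coefA_add_coefB hM hq hp) (labelSet s)
    have hle : ((labelSet s).card : ℝ) ≤ T := by
      rw [← hcard]
      exact_mod_cast Finset.card_le_univ _
    have hcc : ((labelSet s)ᶜ.card : ℝ) = T - (labelSet s).card := by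
      rw [Finset.card_compl, Nat.cast_sub (Finset.card_le_univ _), hcard]
    have h2 := mul_le_mul_of_nonneg_left (sqrt_add_sqrt_sub_le (Nat.cast_nonneg _) hle)
      (by positivity : 0 ≤ 2 * L * CG)
    rw [hcc, hcard] at h1
    -- Positive and negative parts are split into |V| and V: the first multiplies `D₁ + D₂`, which
    -- is bounded, and the second multiplies `D₁ - D₂`, which averages out.
    have e1 : max (b - (labelSet s).card / T) 0 = (|V s| + V s) / 2 := by
      change max (V s) 0 = _
      rcases le_total 0 (V s) with h0 | h0
      · rw [max_eq_left h0, abs_of_nonneg h0]; ring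
      · rw [max_eq_right h0, abs_of_nonpos h0]; ring
    have e2 : max ((labelSet s).card / T - b) 0 = (|V s| - V s) / 2 := by
      have : (labelSet s).card / T - b = -V s := by simp only [hV]; ring
      rw [this]
      rcases le_total 0 (V s) with h0 | h0
      · rw [max_eq_right (by linarith), abs_of_nonneg h0]; ring
      · rw [max_eq_left (by linarith), abs_of_nonpos h0]; ring
    rw [e1, e2] at h1
    have h3 := mul_le_mul_of_nonneg_left hdiff (abs_nonneg (V s))
    have h4 := mul_le_mul_of_nonneg_left (h1.trans (b := _) (c := 2 * L * CG * (√2 * √T) +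
      |V s| * (T * (2 * L * CG)) + V s * ((D₁ - D₂) / 2)) (by linarith)) (hW0 s)
    linarith
  refine (Finset.sum_le_sum fun s _ => hpt s).trans ?_
  rw [Finset.sum_add_distrib, Finset.sum_add_distrib, ← Finset.sum_mul, ← Finset.sum_mul,
    ← Finset.sum_mul, hV1]
  have hw1 : ∑ s, W s = 1 := w1
  rw [hw1, zero_mul, one_mul, add_zero]
  have h6 := mul_le_mul_of_nonneg_right hE (by positivity : 0 ≤ T * (2 * L * CG))
  have h7 : 1 / (2 * √T) * (T * (2 * L * CG)) = L * CG * √T := by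
    have hs : √T ≠ 0 := (Real.sqrt_pos.2 hT0).ne'
    field_simp
    rw [Real.sq_sqrt hT0.le]
  -- The constant 4 is 2 · 3/2 from the class-by-class comparisons plus 1 from the mismatch of
  -- labels.
  have h8 : √2 ≤ 3 / 2 := Real.sqrt_le_iff.2 ⟨by norm_num, by norm_num⟩
  have h9 := mul_le_mul_of_nonneg_left h8 (by positivity : 0 ≤ 2 * L * CG * √T)
  rw [h7] at h6
  linarith

end MeanBound

/-! ### Sums over a sample after a change of one tuple or point -/

section Sums

variable {X : Type*} {M n : ℕ}

lemma sum_ghostCoef_joinGhost (u : X → ℝ) (a b : ℝ)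
    (z : (Fin n → Fin M → X) × ((Fin n × Fin M) ⊕ (Fin n × Fin M) → X)) :
    ∑ k, ghostCoef (Fin n × Fin M) a b k * u (joinGhost z k) =
      -(∑ i, ∑ j, u (z.1 i j)) +
        (∑ k, b * u (z.2 (Sum.inl k)) + ∑ k, a * u (z.2 (Sum.inr k))) := by
  rw [Fintype.sum_sum_type, Fintype.sum_sum_type, ← Fintype.sum_prod_type']
  simp [ghostCoef, joinGhost]

lemma sum_sum_update (u : X → ℝ) (z : Fin n → Fin M → X) (i : Fin n) (y : Fin M → X) :
    ∑ k, ∑ j, u (Function.update z i y k j) =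
      ∑ k, ∑ j, u (z k j) + (∑ j, u (y j) - ∑ j, u (z i j)) := by
  rw [← Finset.add_sum_erase _ _ (Finset.mem_univ i),
    ← Finset.add_sum_erase _ (fun k => ∑ j, u (z k j)) (Finset.mem_univ i), Function.update_self]
  have : ∑ k ∈ Finset.univ.erase i, ∑ j, u (Function.update z i y k j) =
      ∑ k ∈ Finset.univ.erase i, ∑ j, u (z k j) :=
    Finset.sum_congr rfl fun k hk => by rw [Function.update_of_ne (Finset.ne_of_mem_erase hk)]
  rw [this]
  ring

lemma sum_update (u : X → ℝ) (y : Fin M → X) (j : Fin M) (t : X) :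
    ∑ k, u (Function.update y j t k) - ∑ k, u (y k) = u t - u (y j) := by
  rw [← Finset.add_sum_erase _ _ (Finset.mem_univ j),
    ← Finset.add_sum_erase _ (fun k => u (y k)) (Finset.mem_univ j), Function.update_self]
  have : ∑ k ∈ Finset.univ.erase j, u (Function.update y j t k) =
      ∑ k ∈ Finset.univ.erase j, u (y k) :=
    Finset.sum_congr rfl fun k hk => by rw [Function.update_of_ne (Finset.ne_of_mem_erase hk)]
  rw [this]
  ring

end Sums

/-! ### Uniform deviation bounds -/

section Deviation

variable {X : Type*} [MeasurableSpace X] {G : Set (X → ℝ)} {f : ℝ → ℝ} {L : ℝ} {pP pN : Measure X}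
  [IsProbabilityMeasure pP] [IsProbabilityMeasure pN] {q p : ℝ} {M n : ℕ}

lemma LipClass.bddMeas_comp (h : LipClass G f L) {g : X → ℝ} (hg : g ∈ G) :
    BddMeas fun x => f (g x) := by
  obtain ⟨C, hC⟩ := h.bdd'
  exact ⟨h.continuous.measurable.comp (h.meas g hg), C, fun x => hC _⟩

lemma integral_pi_eval {ι Y : Type*} [Fintype ι] [MeasurableSpace Y] (μ : ι → Measure Y)
    [∀ i, IsProbabilityMeasure (μ i)] (i : ι) {u : Y → ℝ} (hu : Measurable u) :
    ∫ z, u (z i) ∂(Measure.pi μ) = ∫ x, u x ∂(μ i) := by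
  rw [← (measurePreserving_eval μ i).map_eq,
    integral_map (measurable_pi_apply i).aemeasurable hu.aestronglyMeasurable]

/-- The mean of the points of the tuples. -/
lemma integral_sum_pi_tupleLaw (hq : 0 < q) (hp : 0 < p) (hM : 1 ≤ M) {u : X → ℝ}
    (hu : BddMeas u) :
    ∫ z : Fin n → Fin M → X, ∑ i, ∑ j, u (z i j)
        ∂(Measure.pi fun _ : Fin n => tupleLaw M q p pP pN) =
      M * n * (coefA M q p * ∫ x, u x ∂pP + coefB M q p * ∫ x, u x ∂pN) := by
  have hm : ∀ (i : Fin n) (j : Fin M), BddMeas fun z : Fin n → Fin M → X => u (z i j) :=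
    fun i j => hu.comp ((measurable_pi_apply j).comp (measurable_pi_apply i))
  have hm' : ∀ j : Fin M, BddMeas fun y : Fin M → X => u (y j) :=
    fun j => hu.comp (measurable_pi_apply j)
  rw [integral_pi_tupleLaw hq hp (BddMeas.sum _ fun i _ => BddMeas.sum _ fun j _ => hm i j)]
  have hs : ∀ s : Fin n → Finset (Fin M),
      ∫ z : Fin n → Fin M → X, ∑ i, ∑ j, u (z i j)
        ∂(Measure.pi fun i => Measure.pi (labelLaw pP pN (s i))) =
      M * n * (coefA M q p * ∫ x, u x ∂pP + coefB M q p * ∫ x, u x ∂pN) +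
        (∑ i, ((s i).card - M * coefB M q p)) * (∫ x, u x ∂pN - ∫ x, u x ∂pP) := by
    intro s
    rw [integral_finsetSum _ fun i _ => (BddMeas.sum _ fun j _ => hm i j).integrable _]
    have : ∀ i, ∫ z : Fin n → Fin M → X, ∑ j, u (z i j)
        ∂(Measure.pi fun i => Measure.pi (labelLaw pP pN (s i))) =
        M * (coefA M q p * ∫ x, u x ∂pP + coefB M q p * ∫ x, u x ∂pN) +
        ((s i).card - M * coefB M q p) * (∫ x, u x ∂pN - ∫ x, u x ∂pP) := by
      intro i
      rw [integral_finsetSum _ fun j _ => (hm i j).integrable _]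
      have hj : ∀ j, ∫ z : Fin n → Fin M → X, u (z i j)
          ∂(Measure.pi fun i => Measure.pi (labelLaw pP pN (s i))) =
          ∫ x, u x ∂pP + (if j ∈ s i then 1 else 0) * (∫ x, u x ∂pN - ∫ x, u x ∂pP) := by
        intro j
        rw [integral_pi_eval (fun i => Measure.pi (labelLaw pP pN (s i))) i
          (u := fun y => u (y j)) (hm' j).1, integral_pi_eval _ j hu.1, labelLaw]
        split_ifs <;> ring
      simp only [hj, Finset.sum_add_distrib, ← Finset.sum_mul, Finset.sum_const, Finset.card_univ,
        Fintype.card_fin, nsmul_eq_mul, Finset.sum_ite_mem, Finset.univ_inter, mul_one]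
      have hab := coefA_add_coefB hM hq hp
      linear_combination -(M : ℝ) * (∫ x, u x ∂pP) * hab
    simp only [this, Finset.sum_add_distrib, ← Finset.sum_mul, Finset.sum_const, Finset.card_univ,
      Fintype.card_fin, nsmul_eq_mul]
    ring
  obtain ⟨w1, w2, -⟩ := sum_pi_prod_mul (sum_labelWeight hq hp)
    (sum_labelWeight_mul_card_sub hM hq hp) n
  simp only [hs, mul_add, Finset.sum_add_distrib, ← Finset.sum_mul, ← mul_assoc]
  rw [w1, w2]
  ring

/-- The deviation of the sample from its mean is at most the expected deviation from the ghost
samples. -/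
lemma LipClass.sub_sum_le_ghostMean (h : LipClass G f L) (a b : ℝ) (z : Fin n → Fin M → X)
    {g : X → ℝ} (hg : g ∈ G) :
    M * n * (a * ∫ x, f (g x) ∂pP + b * ∫ x, f (g x) ∂pN) - ∑ i, ∑ j, f (g (z i j)) ≤
      ghostMean G f pP pN a b z := by
  have hu := h.bddMeas_comp hg
  have hk : ∀ (c : ℝ) (k : (Fin n × Fin M) ⊕ (Fin n × Fin M)),
      BddMeas fun v : (Fin n × Fin M) ⊕ (Fin n × Fin M) → X => c * f (g (v k)) :=
    fun c k => (hu.comp (measurable_pi_apply k)).const_mul c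
  have b1 := BddMeas.sum Finset.univ fun k (_ : k ∈ Finset.univ) => hk b (Sum.inl k)
  have b2 := BddMeas.sum Finset.univ fun k (_ : k ∈ Finset.univ) => hk a (Sum.inr k)
  have b0 : BddMeas fun _ : (Fin n × Fin M) ⊕ (Fin n × Fin M) → X =>
    -(∑ i, ∑ j, f (g (z i j))) := bddMeas_const _
  have hmono : ∫ v, (-(∑ i, ∑ j, f (g (z i j))) +
      (∑ k, b * f (g (v (Sum.inl k))) + ∑ k, a * f (g (v (Sum.inr k)))))
        ∂(ghostPi (Fin n × Fin M) pP pN) ≤ ghostMean G f pP pN a b z := by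
    refine integral_mono ((b0.add (b1.add b2)).integrable _)
      (((h.bddMeas_joinGhost a b).comp measurable_prodMk_left).integrable _) fun v => ?_
    have := h.le_supSum (ghostCoef (Fin n × Fin M) a b) (joinGhost (z, v)) hg
    rwa [sum_ghostCoef_joinGhost (fun x => f (g x)) a b (z, v)] at this
  refine le_trans (le_of_eq ?_) hmono
  rw [integral_add (b0.integrable _) ((b1.add b2).integrable _),
    integral_add (b1.integrable _) (b2.integrable _),
    integral_finsetSum _ fun k _ => (hk b (Sum.inl k)).integrable _,
    integral_finsetSum _ fun k _ => (hk a (Sum.inr k)).integrable _]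
  simp only [integral_const_mul, ghostPi]
  simp only [integral_pi_eval _ _ hu.1, Sum.elim_inl, Sum.elim_inr, Finset.sum_const,
    Finset.card_univ, Fintype.card_prod, Fintype.card_fin, nsmul_eq_mul, integral_const,
    probReal_univ, one_smul]
  push_cast
  ring

/-- **Uniform deviation bound** for the increments of the empirical means over independent
tuples. -/
theorem LipClass.exists_deviation_le (h : LipClass G f L) (hq : 0 < q) (hp : 0 < p)
    (hqp : q + p = 1) (hM : 1 ≤ M) (hn : 1 ≤ n) {CG : ℝ} (hCG : 0 ≤ CG)
    (hP : ∀ n : ℕ, 1 ≤ n → rademacher G pP n ≤ CG / √n)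
    (hN : ∀ n : ℕ, 1 ≤ n → rademacher G pN n ≤ CG / √n) {w : ℝ} (hw : 0 < w)
    (hfw : ∀ z z', f z - f z' ≤ w) {δ : ℝ} (hδ : 0 < δ) (hδ1 : δ < 1) {g₀ : X → ℝ}
    (hg₀ : g₀ ∈ G) :
    ∃ E : Set (Fin n → Fin M → X), MeasurableSet E ∧
      (Measure.pi fun _ : Fin n => tupleLaw M q p pP pN).real Eᶜ ≤ δ ∧ ∀ z ∈ E, ∀ g ∈ G,
        (M * n * (coefA M q p * ∫ x, f (g x) ∂pP + coefB M q p * ∫ x, f (g x) ∂pN) -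
            ∑ i, ∑ j, f (g (z i j))) -
          (M * n * (coefA M q p * ∫ x, f (g₀ x) ∂pP + coefB M q p * ∫ x, f (g₀ x) ∂pN) -
            ∑ i, ∑ j, f (g₀ (z i j))) ≤
        4 * L * CG * √(M * n) + 2 * w * √(M * n * Real.log (1 / δ) / 2) := by
  have hQ := isProbabilityMeasure_tupleLaw (M := M) (pP := pP) (pN := pN) hq hp
  set a := coefA M q p
  set b := coefB M q p
  set μ := Measure.pi fun _ : Fin n => tupleLaw M q p pP pN with hμ
  have hu := h.bddMeas_comp hg₀
  have hsumb : BddMeas fun z : Fin n → Fin M → X => ∑ i, ∑ j, f (g₀ (z i j)) :=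
    BddMeas.sum _ fun i _ => BddMeas.sum _ fun j _ =>
      hu.comp ((measurable_pi_apply j).comp (measurable_pi_apply i))
  have hgm := h.bddMeas_ghostMean (pP := pP) (pN := pN) (n := n) (M := M) a b
  -- Adding the sum at g₀ makes a single concentration bound cover the increments relative to g₀: up
  -- to the fixed mean of that sum, F dominates them all.
  set F : (Fin n → Fin M → X) → ℝ := fun z =>
    ghostMean G f pP pN a b z + ∑ i, ∑ j, f (g₀ (z i j)) with hF
  have hFb : BddMeas F := hgm.add hsumb
  have hmean : ∫ z, F z ∂μ ≤ 4 * L * CG * √(M * n) +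
      M * n * (a * ∫ x, f (g₀ x) ∂pP + b * ∫ x, f (g₀ x) ∂pN) := by
    rw [hF, integral_add (hgm.integrable _) (hsumb.integrable _),
      integral_sum_pi_tupleLaw hq hp hM hu]
    exact add_le_add (h.integral_ghostMean_le hq hp hqp hM hn hCG hP hN) le_rfl
  have hsymm : ∀ z i (σ : Equiv.Perm (Fin M)),
      F (Function.update z i fun j => z i (σ j)) = F z := by
    intro z i σ
    have hsum : ∀ u : X → ℝ, ∑ k, ∑ j, u (Function.update z i (fun j => z i (σ j)) k j) =
        ∑ k, ∑ j, u (z k j) := by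
      intro u
      rw [sum_sum_update, Equiv.sum_comp σ fun j => u (z i j), sub_self, add_zero]
    refine congrArg₂ (· + ·) ?_ (hsum fun x => f (g₀ x))
    refine integral_congr_ae (.of_forall fun v => iSup_congr fun g => ?_)
    rw [sum_ghostCoef_joinGhost (fun x => f (g.1 x)), sum_ghostCoef_joinGhost (fun x => f (g.1 x)),
      hsum fun x => f (g.1 x)]
  -- One w comes from the supremum and one from the sum at g₀.
  have hc : ∀ z i j t, F (Function.update z i (Function.update (z i) j t)) - F z ≤ 2 * w := by
    intro z i j t
    have hsum : ∀ u : X → ℝ, ∑ k, ∑ l, u (Function.update z i (Function.update (z i) j t) k l) =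
        ∑ k, ∑ l, u (z k l) + (u t - u (z i j)) := by
      intro u
      rw [sum_sum_update, sum_update]
    have hs : ∀ z : Fin n → Fin M → X, BddMeas fun v =>
        supSum G f (ghostCoef (Fin n × Fin M) a b) (joinGhost (z, v)) := fun z =>
      (h.bddMeas_joinGhost a b).comp measurable_prodMk_left
    have h1 : ghostMean G f pP pN a b (Function.update z i (Function.update (z i) j t)) ≤
        ghostMean G f pP pN a b z + w := by
      have hint : ∫ v, (supSum G f (ghostCoef (Fin n × Fin M) a b) (joinGhost (z, v)) + w)
          ∂(ghostPi (Fin n × Fin M) pP pN) = ghostMean G f pP pN a b z + w := by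
        rw [integral_add ((hs z).integrable _) (integrable_const _)]
        simp [ghostMean]
      rw [← hint]
      refine integral_mono ((hs _).integrable _) (((hs z).add (bddMeas_const w)).integrable _)
        fun v => h.supSum_le fun g hg => ?_
      have h2 := h.le_supSum (ghostCoef (Fin n × Fin M) a b) (joinGhost (z, v)) hg
      rw [sum_ghostCoef_joinGhost (fun x => f (g x))] at h2 ⊢
      simp only [hsum fun x => f (g x)]
      linarith [hfw (g (z i j)) (g t)]
    simp only [hF, hsum fun x => f (g₀ x)]
    linarith [hfw (g₀ t) (g₀ (z i j))]
  have hdev := measureReal_pi_tupleLaw_ge_le (pP := pP) (pN := pN) hq hp hqp hM hn hFb hsymm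
    (by positivity) hc hδ hδ1
  rw [← hμ] at hdev
  set r := 2 * w * √(M * n * Real.log (1 / δ) / 2)
  refine ⟨{z | ∫ z, F z ∂μ + r ≤ F z}ᶜ, (measurableSet_le measurable_const hFb.1).compl,
    by rwa [compl_compl], fun z hz g hg => ?_⟩
  have h1 : F z < ∫ z, F z ∂μ + r := not_le.1 hz
  have h2 := h.sub_sum_le_ghostMean (pP := pP) (pN := pN) a b z hg
  simp only [hF] at h1
  simp only [hF] at hmean
  linarith

lemma tupleLaw_self (hq : 0 < q) (hp : 0 < p) (μ : Measure X) :
    tupleLaw M q p μ μ = Measure.pi fun _ => μ := by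
  have : ∀ S : Finset (Fin M), labelLaw μ μ S = fun _ => μ := fun S => by
    funext i
    simp [labelLaw]
  simp only [tupleLaw_eq_sum, this]
  rw [← Finset.sum_smul, ← ENNReal.ofReal_sum_of_nonneg fun S _ => labelWeight_nonneg hq hp S,
    sum_labelWeight hq hp, ENNReal.ofReal_one, one_smul]

/-- **Uniform deviation bound** for the increments of the empirical means over independent
points. -/
theorem LipClass.exists_deviation_le_pi (h : LipClass G f L) {μ : Measure X}
    [IsProbabilityMeasure μ] (hn : 1 ≤ n) {CG : ℝ} (hCG : 0 ≤ CG)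
    (hμ : ∀ n : ℕ, 1 ≤ n → rademacher G μ n ≤ CG / √n) {w : ℝ} (hw : 0 < w)
    (hfw : ∀ z z', f z - f z' ≤ w) {δ : ℝ} (hδ : 0 < δ) (hδ1 : δ < 1) {g₀ : X → ℝ}
    (hg₀ : g₀ ∈ G) :
    ∃ E : Set (Fin n → X), MeasurableSet E ∧ (Measure.pi fun _ : Fin n => μ).real Eᶜ ≤ δ ∧
      ∀ z ∈ E, ∀ g ∈ G,
        (n * ∫ x, f (g x) ∂μ - ∑ i, f (g (z i))) - (n * ∫ x, f (g₀ x) ∂μ - ∑ i, f (g₀ (z i))) ≤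
          4 * L * CG * √n + 2 * w * √(n * Real.log (1 / δ) / 2) := by
  -- Independent points are tuples of length one with both class laws equal to μ; the priors are
  -- then irrelevant.
  have hq : (0 : ℝ) < 1 / 2 := by norm_num
  obtain ⟨E, hE, hEδ, hEz⟩ := h.exists_deviation_le (pP := μ) (pN := μ) hq hq (by norm_num)
    le_rfl hn hCG hμ hμ hw hfw hδ hδ1 hg₀
  set e : (Fin n → X) → Fin n → Fin 1 → X := fun z i _ => z i with he
  have hem : Measurable e := measurable_pi_lambda _ fun i => measurable_pi_lambda _ fun _ =>
    measurable_pi_apply i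
  have hev : ∀ _ : Fin n, Measurable fun y : Fin 1 → X => y 0 := fun _ => measurable_pi_apply 0
  have hmap : (Measure.pi fun _ : Fin n => tupleLaw 1 (1 / 2) (1 / 2) μ μ).map
      (fun z i => z i 0) = Measure.pi fun _ : Fin n => μ := by
    rw [tupleLaw_self hq hq]
    refine (Measure.pi_map_pi fun i => (hev i).aemeasurable).trans ?_
    congr 1
    funext i
    exact (measurePreserving_eval (fun _ : Fin 1 => μ) 0).map_eq
  refine ⟨e ⁻¹' E, hem hE, ?_, fun z hz g hg => ?_⟩
  · have hem' : Measurable fun (z : Fin n → Fin 1 → X) i => z i 0 :=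
      measurable_pi_lambda _ fun i => (hev i).comp (measurable_pi_apply i)
    rw [← hmap, map_measureReal_apply hem' (hem hE).compl]
    refine le_of_eq_of_le (congrArg _ ?_) hEδ
    ext z
    have : e (fun i => z i 0) = z := by
      funext i j
      rw [he, Subsingleton.elim j 0]
    simp only [Set.mem_preimage, Set.mem_compl_iff, this]
  · have h1 := hEz (e z) hz g hg
    simp only [← add_mul, coefA_add_coefB le_rfl hq hq] at h1
    simpa [he] using h1

end Deviation

/-! ### Truncation of predicted values -/

section Clamp

/-- Truncation to the interval `[-C, C]`. -/
def clamp (C z : ℝ) : ℝ := max (-C) (min z C)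

lemma abs_clamp_le {C : ℝ} (hC : 0 < C) (z : ℝ) : |clamp C z| ≤ C :=
  abs_le.2 ⟨le_max_left _ _, max_le (by linarith) (min_le_right _ _)⟩

lemma clamp_of_abs_le {C z : ℝ} (h : |z| ≤ C) : clamp C z = z := by
  rw [clamp, min_eq_left (abs_le.1 h).2, max_eq_right (abs_le.1 h).1]

lemma abs_clamp_sub_clamp_le (C z z' : ℝ) : |clamp C z - clamp C z'| ≤ |z - z'| := by
  unfold clamp
  refine (abs_max_sub_max_le_max _ _ _ _).trans (max_le (by simp) ?_)
  exact (abs_min_sub_min_le_max _ _ _ _).trans (max_le le_rfl (by simp))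

end Clamp

/-! ### The corrected losses and the rewriting of the risk -/

section Losses

variable {ℓ : ℝ → ℤˣ → ℝ} {Cg Cℓ ρ πp πm : ℝ} {M : ℕ}

lemma nonneg_of_abs_sub_le (hCg : 0 < Cg)
    (hρ : ∀ z z' y, |z| ≤ Cg → |z'| ≤ Cg → |ℓ z y - ℓ z' y| ≤ ρ * |z - z'|) : 0 ≤ ρ := by
  have h := hρ Cg 0 1 (abs_of_pos hCg).le (by simpa using hCg.le)
  rw [sub_zero, abs_of_pos hCg] at h
  exact nonneg_of_mul_nonneg_left ((abs_nonneg _).trans h) hCg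

/-- The loss is controlled on [−Cg, Cg] only. Clamping its argument yields a bounded Lipschitz
function on the whole line, as measurability of suprema and contraction require, and changes nothing
on values of the class. -/
lemma lipClass_of_loss {X : Type*} [MeasurableSpace X] {G : Set (X → ℝ)} (hG : G.Nonempty)
    (hGmeas : ∀ g ∈ G, Measurable g) (hGsup : MeasurableSuprema G) (hCg : 0 < Cg)
    (hGbdd : ∀ g ∈ G, ∀ x, |g x| ≤ Cg) {φ : ℝ → ℝ} {L A B : ℝ} (hL : 0 ≤ L)
    (hφ : ∀ z, |z| ≤ Cg → A ≤ φ z ∧ φ z ≤ B)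
    (hlip : ∀ z z', |z| ≤ Cg → |z'| ≤ Cg → |φ z - φ z'| ≤ L * |z - z'|) :
    LipClass G (fun z => φ (clamp Cg z)) L where
  nonempty := hG
  meas := hGmeas
  sup := hGsup
  bdd := ⟨Cg, hGbdd⟩
  bdd' := by
    refine ⟨max |A| |B|, fun z => ?_⟩
    obtain ⟨h1, h2⟩ := hφ _ (abs_clamp_le hCg z)
    exact abs_le_max_abs_abs h1 h2
  lip_nonneg := hL
  lip z z' := (hlip _ _ (abs_clamp_le hCg z) (abs_clamp_le hCg z')).trans
    (mul_le_mul_of_nonneg_left (abs_clamp_sub_clamp_le Cg z z') hL)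

lemma lossMDP_mem (hD : 0 < coefA M πp πm * πm - coefB M πp πm * πp) (hℓ0 : ∀ z y, 0 ≤ ℓ z y)
    (hℓC : ∀ z y, |z| ≤ Cg → ℓ z y ≤ Cℓ) {z : ℝ} (hz : |z| ≤ Cg) :
    -Cℓ / (coefA M πp πm * πm - coefB M πp πm * πp) ≤ lossMDP ℓ M πp πm z ∧
      lossMDP ℓ M πp πm z ≤ Cℓ / (coefA M πp πm * πm - coefB M πp πm * πp) := by
  have h1 := hℓ0 z 1
  have h2 := hℓ0 z (-1)
  have h3 := hℓC z 1 hz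
  have h4 := hℓC z (-1) hz
  exact ⟨div_le_div_of_nonneg_right (by linarith) hD.le,
    div_le_div_of_nonneg_right (by linarith) hD.le⟩

lemma lossU_mem (hD : 0 < coefA M πp πm * πm - coefB M πp πm * πp)
    (ha : 0 ≤ coefA M πp πm * πm) (hb : 0 ≤ coefB M πp πm * πp) (hℓ0 : ∀ z y, 0 ≤ ℓ z y)
    (hℓC : ∀ z y, |z| ≤ Cg → ℓ z y ≤ Cℓ) {z : ℝ} (hz : |z| ≤ Cg) :
    -(coefB M πp πm * πp * Cℓ) / (coefA M πp πm * πm - coefB M πp πm * πp) ≤ lossU ℓ M πp πm z ∧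
      lossU ℓ M πp πm z ≤
        coefA M πp πm * πm * Cℓ / (coefA M πp πm * πm - coefB M πp πm * πp) := by
  have h1 := mul_nonneg hb (hℓ0 z 1)
  have h2 := mul_nonneg ha (hℓ0 z (-1))
  have h3 := mul_le_mul_of_nonneg_left (hℓC z 1 hz) hb
  have h4 := mul_le_mul_of_nonneg_left (hℓC z (-1) hz) ha
  exact ⟨div_le_div_of_nonneg_right (by linarith) hD.le,
    div_le_div_of_nonneg_right (by linarith) hD.le⟩

lemma abs_lossMDP_sub_le (hD : 0 < coefA M πp πm * πm - coefB M πp πm * πp)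
    (hρ : ∀ z z' y, |z| ≤ Cg → |z'| ≤ Cg → |ℓ z y - ℓ z' y| ≤ ρ * |z - z'|) {z z' : ℝ}
    (hz : |z| ≤ Cg) (hz' : |z'| ≤ Cg) :
    |lossMDP ℓ M πp πm z - lossMDP ℓ M πp πm z'| ≤
      2 * ρ / (coefA M πp πm * πm - coefB M πp πm * πp) * |z - z'| := by
  unfold lossMDP
  rw [← sub_div, abs_div, abs_of_pos hD, div_mul_eq_mul_div]
  refine div_le_div_of_nonneg_right ?_ hD.le
  obtain ⟨h1, h2⟩ := abs_le.1 (hρ z z' 1 hz hz')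
  obtain ⟨h3, h4⟩ := abs_le.1 (hρ z z' (-1) hz hz')
  exact abs_le.2 ⟨by linarith, by linarith⟩

lemma abs_lossU_sub_le (hD : 0 < coefA M πp πm * πm - coefB M πp πm * πp)
    (ha : 0 ≤ coefA M πp πm * πm) (hb : 0 ≤ coefB M πp πm * πp)
    (hρ : ∀ z z' y, |z| ≤ Cg → |z'| ≤ Cg → |ℓ z y - ℓ z' y| ≤ ρ * |z - z'|) {z z' : ℝ}
    (hz : |z| ≤ Cg) (hz' : |z'| ≤ Cg) :
    |lossU ℓ M πp πm z - lossU ℓ M πp πm z'| ≤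
      (coefB M πp πm * πp + coefA M πp πm * πm) * ρ /
        (coefA M πp πm * πm - coefB M πp πm * πp) * |z - z'| := by
  unfold lossU
  rw [← sub_div, abs_div, abs_of_pos hD, div_mul_eq_mul_div]
  refine div_le_div_of_nonneg_right ?_ hD.le
  obtain ⟨h1, h2⟩ := abs_le.1 (hρ z z' 1 hz hz')
  obtain ⟨h3, h4⟩ := abs_le.1 (hρ z z' (-1) hz hz')
  have k1 := mul_le_mul_of_nonneg_left h1 hb
  have k2 := mul_le_mul_of_nonneg_left h2 hb
  have k3 := mul_le_mul_of_nonneg_left h3 ha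
  have k4 := mul_le_mul_of_nonneg_left h4 ha
  exact abs_le.2 ⟨by linarith, by linarith⟩

/-- The rewriting of the risk by which it can be estimated from tuples and unlabeled points. -/
lemma risk_eq {X : Type*} [MeasurableSpace X] {pP pN : Measure X}
    (hD : 0 < coefA M πp πm * πm - coefB M πp πm * πp)
    {g : X → ℝ} (hp : ∀ y, Integrable (fun x => ℓ (g x) y) pP)
    (hn : ∀ y, Integrable (fun x => ℓ (g x) y) pN) :
    risk ℓ πp πm pP pN g =
      πp * πm * (coefA M πp πm * ∫ x, lossMDP ℓ M πp πm (g x) ∂pP +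
        coefB M πp πm * ∫ x, lossMDP ℓ M πp πm (g x) ∂pN) +
      (πp * ∫ x, lossU ℓ M πp πm (g x) ∂pP + πm * ∫ x, lossU ℓ M πp πm (g x) ∂pN) := by
  unfold risk lossMDP lossU
  simp only [integral_div]
  rw [integral_sub (hp _) (hp _), integral_sub (hn _) (hn _),
    integral_add ((hp _).const_mul _) ((hp _).const_mul _),
    integral_add ((hn _).const_mul _) ((hn _).const_mul _)]
  simp only [integral_const_mul, div_eq_mul_inv]
  linear_combination
    -(πp * ∫ x, ℓ (g x) 1 ∂pP + πm * ∫ x, ℓ (g x) (-1) ∂pN) * mul_inv_cancel₀ hD.ne'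

end Losses

/-! ### Combination of the two deviation bounds -/

lemma one_div_mul_sub_sub {T : ℝ} (hT : T ≠ 0) (I S I₀ S₀ : ℝ) :
    1 / T * (T * I - S - (T * I₀ - S₀)) = I - I₀ - 1 / T * (S - S₀) := by
  linear_combination (I - I₀) * one_div_mul_cancel hT

lemma one_div_mul_sqrt_bound {T x : ℝ} (hT : 0 < T) (hx : 0 ≤ x) (A B : ℝ) :
    1 / T * (A * √T + B * √(T * x / 2)) = (A + B * (√2 / 2 * √x)) * (1 / √T) := by
  have e1 : √(T * x / 2) = √T * (√2 / 2 * √x) := by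
    rw [mul_div_assoc, Real.sqrt_mul hT.le, Real.sqrt_div hx, Real.sqrt_div_self]
    ring
  have e2 : 1 / T * √T = 1 / √T := by
    rw [div_mul_eq_mul_div, one_mul, Real.sqrt_div_self']
  rw [e1, ← e2]
  ring

/-- The excess risk bound, with the two absolute values evaluated. -/
lemma exists_excess_risk_le {X : Type*} [MeasurableSpace X]
    (ν : Measure X) (pP pN : Measure X) [IsProbabilityMeasure pP] [IsProbabilityMeasure pN]
    (hpP : pP ≪ ν) (hpN : pN ≪ ν) {πp πm : ℝ} (hπp : 0 < πp) (hπm : 0 < πm) (hπ : πp + πm = 1)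
    {M : ℕ} (hM : 1 ≤ M) {G : Set (X → ℝ)} (hGmeas : ∀ g ∈ G, Measurable g)
    (hGsup : MeasurableSuprema G) {Cg : ℝ} (hCg : 0 < Cg) (hGbdd : ∀ g ∈ G, ∀ x, |g x| ≤ Cg)
    {CG : ℝ} (hCG : 0 ≤ CG)
    (hrad : ∀ μ : Measure X, IsProbabilityMeasure μ → μ ≪ ν →
      ∀ n : ℕ, 1 ≤ n → rademacher G μ n ≤ CG / √(n : ℝ))
    {ℓ : ℝ → ℤˣ → ℝ} (hℓ0 : ∀ z y, 0 ≤ ℓ z y) {Cℓ : ℝ} (hCℓ : 0 < Cℓ)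
    (hℓC : ∀ z y, |z| ≤ Cg → ℓ z y ≤ Cℓ) {ρ : ℝ}
    (hρ : ∀ z z' y, |z| ≤ Cg → |z'| ≤ Cg → |ℓ z y - ℓ z' y| ≤ ρ * |z - z'|)
    {gstar : X → ℝ} (hgstar : gstar ∈ G) {n m : ℕ} (hn : 1 ≤ n) (hm : 1 ≤ m) {δ : ℝ} (hδ : 0 < δ)
    (hδ1 : δ < 1) :
    ∃ E : Set ((Fin n → Fin M → X) × (Fin m → X)), MeasurableSet E ∧
      ENNReal.ofReal (1 - δ) ≤ sampleLaw M n m πp πm pP pN E ∧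
      ∀ d ∈ E, ∀ ghat ∈ G, IsMinOn (empRisk ℓ M n m πp πm d) G ghat →
        risk ℓ πp πm pP pN ghat - risk ℓ πp πm pP pN gstar ≤
          πp * πm * (8 * ρ * CG + 2 * √2 * Cℓ * √(Real.log (4 / δ))) /
            (coefA M πp πm * πm - coefB M πp πm * πp) * (1 / √((M : ℝ) * n)) +
          (coefB M πp πm * πp + coefA M πp πm * πm) *
            (4 * ρ * CG + √2 * Cℓ * √(Real.log (4 / δ))) /
            (coefA M πp πm * πm - coefB M πp πm * πp) * (1 / √(m : ℝ)) := by
  have hQ := isProbabilityMeasure_tupleLaw (M := M) (pP := pP) (pN := pN) hπp hπm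
  have hU := isProbabilityMeasure_unlabeledLaw (pP := pP) (pN := pN) hπp.le hπm.le hπ
  have hUν : unlabeledLaw πp πm pP pN ≪ ν :=
    Measure.AbsolutelyContinuous.add_left (hpP.smul_left _) (hpN.smul_left _)
  have hD := coef_sub_pos hM hπp hπm
  have ha : 0 ≤ coefA M πp πm * πm := mul_nonneg (coefA_nonneg hπp hπm) hπm.le
  have hb : 0 ≤ coefB M πp πm * πp := mul_nonneg (coefB_nonneg hπp hπm) hπp.le
  have hM0 : (0 : ℝ) < M := by exact_mod_cast hM
  have hn0 : (0 : ℝ) < n := by exact_mod_cast hn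
  have hm0 : (0 : ℝ) < m := by exact_mod_cast hm
  have hlog : 0 ≤ Real.log (4 / δ) :=
    Real.log_nonneg (by rw [le_div_iff₀ hδ]; linarith)
  have hρ0 : 0 ≤ ρ := nonneg_of_abs_sub_le hCg hρ
  set a := coefA M πp πm with ha_def
  set b := coefB M πp πm with hb_def
  set D := a * πm - b * πp with hD_def
  have hs : 0 < b * πp + a * πm := by linarith
  have hcl : ∀ g ∈ G, ∀ x, clamp Cg (g x) = g x := fun g hg x => clamp_of_abs_le (hGbdd g hg x)
  have h1 : LipClass G (fun z => lossMDP ℓ M πp πm (clamp Cg z)) (2 * ρ / D) :=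
    lipClass_of_loss ⟨gstar, hgstar⟩ hGmeas hGsup hCg hGbdd (by positivity)
      (fun z hz => lossMDP_mem hD hℓ0 hℓC hz) fun z z' hz hz' => abs_lossMDP_sub_le hD hρ hz hz'
  have h2 : LipClass G (fun z => lossU ℓ M πp πm (clamp Cg z)) ((b * πp + a * πm) * ρ / D) :=
    lipClass_of_loss ⟨gstar, hgstar⟩ hGmeas hGsup hCg hGbdd (by positivity)
      (fun z hz => lossU_mem hD ha hb hℓ0 hℓC hz) fun z z' hz hz' =>
        abs_lossU_sub_le hD ha hb hρ hz hz'
  have h3 : ∀ y, LipClass G (fun z => ℓ (clamp Cg z) y) ρ := fun y =>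
    lipClass_of_loss ⟨gstar, hgstar⟩ hGmeas hGsup hCg hGbdd (φ := fun z => ℓ z y) hρ0
      (fun z hz => ⟨hℓ0 z y, hℓC z y hz⟩) fun z z' hz hz' => hρ z z' y hz hz'
  have hw1 : ∀ z z', lossMDP ℓ M πp πm (clamp Cg z) - lossMDP ℓ M πp πm (clamp Cg z') ≤
      2 * Cℓ / D := by
    intro z z'
    have k1 := (lossMDP_mem (M := M) hD hℓ0 hℓC (abs_clamp_le hCg z)).2
    have k2 := (lossMDP_mem (M := M) hD hℓ0 hℓC (abs_clamp_le hCg z')).1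
    have : 2 * Cℓ / D = Cℓ / D - -Cℓ / D := by ring
    linarith
  have hw2 : ∀ z z', lossU ℓ M πp πm (clamp Cg z) - lossU ℓ M πp πm (clamp Cg z') ≤
      (b * πp + a * πm) * Cℓ / D := by
    intro z z'
    have k1 := (lossU_mem (M := M) hD ha hb hℓ0 hℓC (abs_clamp_le hCg z)).2
    have k2 := (lossU_mem (M := M) hD ha hb hℓ0 hℓC (abs_clamp_le hCg z')).1
    have : (b * πp + a * πm) * Cℓ / D = a * πm * Cℓ / D - -(b * πp * Cℓ) / D := by ring
    linarith
  -- Failure probability δ/4 for each part produces the log(4/δ) of the bound; by independence the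
  -- two good events have joint probability at least (1 − δ/4)² ≥ 1 − δ.
  have hδ4 : δ / 4 < 1 := by linarith
  obtain ⟨E₁, hE₁, hE₁δ, hd₁⟩ := h1.exists_deviation_le (pP := pP) (pN := pN) hπp hπm hπ hM hn hCG
    (hrad pP ‹_› hpP) (hrad pN ‹_› hpN) (by positivity : 0 < 2 * Cℓ / D) hw1
    (by positivity : 0 < δ / 4) hδ4 hgstar
  obtain ⟨E₂, hE₂, hE₂δ, hd₂⟩ := h2.exists_deviation_le_pi (μ := unlabeledLaw πp πm pP pN) hm hCG
    (hrad _ hU hUν) (by positivity : 0 < (b * πp + a * πm) * Cℓ / D) hw2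
    (by positivity : 0 < δ / 4) hδ4 hgstar
  refine ⟨E₁ ×ˢ E₂, hE₁.prod hE₂, ?_, ?_⟩
  · rw [sampleLaw, Measure.prod_prod]
    rw [probReal_compl_eq_one_sub hE₁] at hE₁δ
    rw [probReal_compl_eq_one_sub hE₂] at hE₂δ
    rw [← ofReal_measureReal, ← ofReal_measureReal, ← ENNReal.ofReal_mul measureReal_nonneg]
    refine ENNReal.ofReal_le_ofReal ?_
    refine le_trans (b := (1 - δ / 4) * (1 - δ / 4)) (by nlinarith)
      (mul_le_mul ?_ ?_ (by linarith) measureReal_nonneg) <;> linarith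
  · rintro ⟨z, u⟩ ⟨hz, hu⟩ ghat hghat hmin
    have k1 := hd₁ z hz ghat hghat
    have k2 := hd₂ u hu ghat hghat
    have k3 : empRisk ℓ M n m πp πm (z, u) ghat ≤ empRisk ℓ M n m πp πm (z, u) gstar := hmin hgstar
    have hint : ∀ g ∈ G, ∀ y, BddMeas fun x => ℓ (g x) y := by
      intro g hg y
      have := (h3 y).bddMeas_comp hg
      simpa only [hcl g hg] using this
    have hrisk : ∀ g ∈ G, _ := fun g hg => risk_eq (M := M) (πp := πp) (πm := πm) (pP := pP)
      (pN := pN) hD (fun y => (hint g hg y).integrable pP) fun y => (hint g hg y).integrable pN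
    have hUint : ∀ g ∈ G, ∫ x, lossU ℓ M πp πm (g x) ∂(unlabeledLaw πp πm pP pN) =
        πp * ∫ x, lossU ℓ M πp πm (g x) ∂pP + πm * ∫ x, lossU ℓ M πp πm (g x) ∂pN := by
      intro g hg
      have := h2.bddMeas_comp hg
      simp only [hcl g hg] at this
      exact integral_unlabeledLaw hπp.le hπm.le this
    simp only [hcl ghat hghat, hcl gstar hgstar, one_div_div] at k1 k2
    rw [hUint ghat hghat, hUint gstar hgstar] at k2
    rw [hrisk ghat hghat, hrisk gstar hgstar]
    simp only [empRisk] at k3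
    have hT0 : (0 : ℝ) < M * n := by positivity
    have k1' := mul_le_mul_of_nonneg_left k1 (by positivity : 0 ≤ πp * πm * (1 / (M * n : ℝ)))
    have k2' := mul_le_mul_of_nonneg_left k2 (by positivity : 0 ≤ 1 / (m : ℝ))
    rw [one_div_mul_sub_sub hm0.ne', one_div_mul_sqrt_bound hm0 hlog] at k2'
    rw [mul_assoc (πp * πm), mul_assoc (πp * πm), one_div_mul_sub_sub hT0.ne',
      one_div_mul_sqrt_bound hT0 hlog] at k1'
    rw [div_eq_mul_one_div (πp * πm)] at k3
    -- The two deviations add up to the increment of R − R̂ from g* to ĝ, and R̂(ĝ) ≤ R̂(g*) by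
    -- `k3`.
    refine le_trans ?_ ((add_le_add k1' k2').trans (le_of_eq ?_))
    · linarith
    · ring

end MDPU

/-! ### The explicit bound and the rate in probability -/

theorem theorem2 {X : Type*} [MeasurableSpace X]
    -- the reference measure, the class-conditional laws (with densities) and the class priors
    (ν : Measure X) [SigmaFinite ν]
    (pP pN : Measure X) [IsProbabilityMeasure pP] [IsProbabilityMeasure pN]
    (hpP : pP ≪ ν) (hpN : pN ≪ ν)
    (πp πm : ℝ) (hπp : 0 < πp) (hπm : 0 < πm) (hπ : πp + πm = 1)
    (M : ℕ) (hM : 1 ≤ M)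
    -- the hypothesis class
    (G : Set (X → ℝ)) (hGmeas : ∀ g ∈ G, Measurable g) (hGsup : MDPU.MeasurableSuprema G)
    (Cg : ℝ) (hCg : 0 < Cg) (hGbdd : ∀ g ∈ G, ∀ x, |g x| ≤ Cg)
    (CG : ℝ) (hCG : 0 ≤ CG)
    (hrad : ∀ μ : Measure X, IsProbabilityMeasure μ → μ ≪ ν →
      ∀ n : ℕ, 1 ≤ n → MDPU.rademacher G μ n ≤ CG / √(n : ℝ))
    -- the loss
    (ℓ : ℝ → ℤˣ → ℝ) (hℓ0 : ∀ z y, 0 ≤ ℓ z y)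
    (Cℓ : ℝ) (hCℓ : 0 < Cℓ) (hℓC : ∀ z y, |z| ≤ Cg → ℓ z y ≤ Cℓ)
    (ρ : ℝ) (hρ : ∀ z z' y, |z| ≤ Cg → |z'| ≤ Cg → |ℓ z y - ℓ z' y| ≤ ρ * |z - z'|)
    -- a minimizer of the true risk
    (gstar : X → ℝ) (hgstar : gstar ∈ G)
    (hmin : IsMinOn (MDPU.risk ℓ πp πm pP pN) G gstar) :
    -- the explicit bound
    (∀ n m : ℕ, 1 ≤ n → 1 ≤ m → ∀ δ : ℝ, 0 < δ →
      ∃ E : Set ((Fin n → Fin M → X) × (Fin m → X)), MeasurableSet E ∧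
        ENNReal.ofReal (1 - δ) ≤ MDPU.sampleLaw M n m πp πm pP pN E ∧
        ∀ d ∈ E, ∀ ghat ∈ G, IsMinOn (MDPU.empRisk ℓ M n m πp πm d) G ghat →
          MDPU.risk ℓ πp πm pP pN ghat - MDPU.risk ℓ πp πm pP pN gstar ≤
            2 * πp * πm * ((4 * √2 * ρ * CG + 2 * Cℓ * √(Real.log (4 / δ))) /
              (|MDPU.coefA M πp πm * πm - MDPU.coefB M πp πm * πp| *
                √(2 * (M : ℝ) * (n : ℝ)))) +
            2 * (|-(MDPU.coefB M πp πm * πp)| + |MDPU.coefA M πp πm * πm|) * √8 * ρ * CG /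
              (|MDPU.coefA M πp πm * πm - MDPU.coefB M πp πm * πp| * √(2 * (m : ℝ))) +
            2 * (|-(MDPU.coefB M πp πm * πp)| + |MDPU.coefA M πp πm * πm|) * Cℓ *
                √(Real.log (4 / δ)) /
              (|MDPU.coefA M πp πm * πm - MDPU.coefB M πp πm * πp| * √(2 * (m : ℝ)))) ∧
    -- the rate: the excess risk is bounded in probability by `1/√n + 1/√m`
    (∀ ε : ℝ, 0 < ε → ∃ K : ℝ, ∀ n m : ℕ, 1 ≤ n → 1 ≤ m →
      ∃ E : Set ((Fin n → Fin M → X) × (Fin m → X)), MeasurableSet E ∧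
        ENNReal.ofReal (1 - ε) ≤ MDPU.sampleLaw M n m πp πm pP pN E ∧
        ∀ d ∈ E, ∀ ghat ∈ G, IsMinOn (MDPU.empRisk ℓ M n m πp πm d) G ghat →
          |MDPU.risk ℓ πp πm pP pN ghat - MDPU.risk ℓ πp πm pP pN gstar| ≤
            K * (1 / √(n : ℝ) + 1 / √(m : ℝ))) := by
  have hD := MDPU.coef_sub_pos hM hπp hπm
  have ha : 0 ≤ MDPU.coefA M πp πm * πm := mul_nonneg (MDPU.coefA_nonneg hπp hπm) hπm.le
  have hb : 0 ≤ MDPU.coefB M πp πm * πp := mul_nonneg (MDPU.coefB_nonneg hπp hπm) hπp.le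
  have hM0 : (0 : ℝ) < M := by exact_mod_cast hM
  have hρ0 : 0 ≤ ρ := MDPU.nonneg_of_abs_sub_le hCg hρ
  have key : ∀ n m : ℕ, 1 ≤ n → 1 ≤ m → ∀ δ : ℝ, 0 < δ → δ < 1 → _ := fun n m hn hm δ hδ hδ1 =>
    MDPU.exists_excess_risk_le ν pP pN hpP hpN hπp hπm hπ hM hGmeas hGsup hCg hGbdd hCG hrad hℓ0
      hCℓ hℓC hρ hgstar hn hm hδ hδ1
  refine ⟨fun n m hn hm δ hδ => ?_, fun ε hε => ?_⟩
  · rcases le_or_gt 1 δ with h1 | h1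
    · refine ⟨∅, MeasurableSet.empty, ?_, fun d hd => absurd hd (Set.notMem_empty d)⟩
      rw [ENNReal.ofReal_of_nonpos (by linarith)]
      exact zero_le
    · obtain ⟨E, hE, hEδ, hd⟩ := key n m hn hm δ hδ h1
      refine ⟨E, hE, hEδ, fun d hdE ghat hghat hm' => (hd d hdE ghat hghat hm').trans
        (le_of_eq ?_)⟩
      have hn0 : (0 : ℝ) < n := by exact_mod_cast hn
      have hm0 : (0 : ℝ) < m := by exact_mod_cast hm
      have h8 : √8 = 2 * √2 := by
        rw [show (8 : ℝ) = 2 ^ 2 * 2 by norm_num, Real.sqrt_mul (by norm_num),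
          Real.sqrt_sq (by norm_num)]
      have h2 : √2 * √2 = 2 := Real.mul_self_sqrt (by norm_num)
      have hMn : 0 < √((M : ℝ) * n) := Real.sqrt_pos.2 (by positivity)
      have hms : 0 < √(m : ℝ) := Real.sqrt_pos.2 hm0
      have h20 : 0 < √(2 : ℝ) := Real.sqrt_pos.2 (by norm_num)
      rw [abs_neg, abs_of_nonneg hb, abs_of_nonneg ha, abs_of_pos hD, h8,
        mul_assoc (2 : ℝ) (M : ℝ), Real.sqrt_mul (by norm_num : (0 : ℝ) ≤ 2) ((M : ℝ) * n),
        Real.sqrt_mul (by norm_num : (0 : ℝ) ≤ 2) (m : ℝ)]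
      -- From here on only constants are normalized: with √8 = 2√2 and √2 cancelled, the stated
      -- bound equals the one already proved.
      set D := MDPU.coefA M πp πm * πm - MDPU.coefB M πp πm * πp
      have e1 : ∀ A : ℝ, A / (D * (√2 * √((M : ℝ) * n))) =
          A * √2 / 2 / D * (1 / √((M : ℝ) * n)) := by
        intro A
        field_simp
        linear_combination -A * h2
      have e2 : ∀ A : ℝ, A / (D * (√2 * √(m : ℝ))) = A * √2 / 2 / D * (1 / √(m : ℝ)) := by
        intro A
        field_simp
        linear_combination -A * h2
      rw [e1, e2, e2]
      linear_combination (-(4 * πp * πm * ρ * CG / D * (1 / √((M : ℝ) * n))) - 2 *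
        (MDPU.coefB M πp πm * πp + MDPU.coefA M πp πm * πm) * ρ * CG / D * (1 / √(m : ℝ))) * h2
  · set D := MDPU.coefA M πp πm * πm - MDPU.coefB M πp πm * πp
    -- The cap keeps δ below 1 when ε is large; the resulting constants do not depend on the sample
    -- sizes.
    set δ := min ε (1 / 2) with hδ
    have hδ0 : 0 < δ := lt_min hε (by norm_num)
    have hδ1 : δ < 1 := (min_le_right _ _).trans_lt (by norm_num)
    set A := πp * πm * (8 * ρ * CG + 2 * √2 * Cℓ * √(Real.log (4 / δ))) / D with hA
    set B := (MDPU.coefB M πp πm * πp + MDPU.coefA M πp πm * πm) *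
      (4 * ρ * CG + √2 * Cℓ * √(Real.log (4 / δ))) / D with hB
    have hA0 : 0 ≤ A := by positivity
    have hB0 : 0 ≤ B := div_nonneg (mul_nonneg (add_nonneg hb ha) (by positivity)) hD.le
    refine ⟨A + B, fun n m hn hm => ?_⟩
    obtain ⟨E, hE, hEδ, hd⟩ := key n m hn hm δ hδ0 hδ1
    have hn0 : (0 : ℝ) < n := by exact_mod_cast hn
    refine ⟨E, hE, (ENNReal.ofReal_le_ofReal (by linarith [min_le_left ε (1 / 2)])).trans hEδ,
      fun d hdE ghat hghat hm' => ?_⟩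
    rw [abs_of_nonneg (sub_nonneg.2 (hmin hghat))]
    refine (hd d hdE ghat hghat hm').trans ?_
    have hMn : 1 / √((M : ℝ) * n) ≤ 1 / √(n : ℝ) := by
      refine one_div_le_one_div_of_le (Real.sqrt_pos.2 hn0) (Real.sqrt_le_sqrt ?_)
      exact le_mul_of_one_le_left hn0.le (by exact_mod_cast hM)
    have k1 := mul_le_mul_of_nonneg_left hMn hA0
    have k2 : 0 ≤ A * (1 / √(m : ℝ)) := by positivity
    have k3 : 0 ≤ B * (1 / √(n : ℝ)) := by positivity
    linarith
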